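/- **Setting.** Let $X$ be a locally compact Hausdorff space. Measures are Radon measures: a positive Radon measure is a regular Borel measure, equivalently a positive linear functional on $C_c(X)$, and signed Radon measures are given by their Jordan decompositions $\nu=\nu^+-\nu^-$. A *kernel* is a symmetric lower semicontinuous function $\kappa:X\times X\to(-\infty,\infty]$ with $\kappa\ge 0$ unless $X$ is compact. Put $\kappa(\nu,\nu_1)=\int\kappa\,d(\nu\otimes\nu_1)$ and $\kappa(x,\nu)=\int\kappa(x,y)\,d\nu(y)$ (whenever not of the form $\infty-\infty$), and let $\mathcal E$ be the set of signed Radon measures with $-\infty<\kappa(\nu,\nu)<\infty$ and $\mathcal E^+$ the set of positive ones in it. Assume that $\kappa$ is *positive definite*, i.e. $\kappa(\nu,\nu)\ge0$ for every signed Radon measure for which it is defined; write $\|\nu\|^2=\kappa(\nu,\nu)$ for the resulting seminorm on $\mathcal E$. Assume also that $\kappa$ is *consistent*, i.e. one of the following (equivalent) properties holds: every strong (that is, $\|\cdot\|$-) Cauchy net in $\mathcal E^+$ converges strongly to each of its vague cluster points; or every strongly bounded, vaguely convergent net $(\nu_s)$ in $\mathcal E^+$ with vague limit $\nu$ satisfies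 $\kappa(\nu_s,\mu)\to\kappa(\nu,\mu)$ for all $\mu\in\mathcal E$. For $E\subset X$ let $C(E)$ be the interior capacity, the supremum over compact $K\subset E$ of $1/\inf\kappa(\nu,\nu)$, the infimum being over positive Radon measures $\nu$ on $K$ with $\nu(X)=1$; a property holds *nearly everywhere* in $E$ if it fails only on a subset of $E$ of interior capacity zero. **Condensers.** Let $I=I^+\sqcup I^-$ be a countable index set and $\alpha_i=\pm1$ for $i\in I^\pm$. A *condenser* $\mathbf A=(A_i)_{i\in I}$ is a family of nonempty closed subsets of $X$ such that every compact set meets only finitely many $A_i$ and $A_i\cap A_j=\varnothing$ for $i\in I^+$, $j\in I^-$. Let $A^\pm=\bigcup_{i\in I^\pm}A_i$; $\mathbf A'\prec\mathbf A$ means $A_i'\subset A_i$ for all $i$, and $\mathbf A$ is *compact* if all $A_i$ are. A measure associated with $\mathbf A$ is a formal sum $\mu=\sum_{i}\alpha_i\mu^i$, identified with $(\mu^i)_{i\in I}$, where $\mu^i$ is a positive Radon measure supported by $A_i$; the set of these carries the *$\mathbf A$-vague topology* of coordinatewise vague convergence. Let $R\mu=\sum_i\alpha_i\mu^i$ be the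 corresponding signed Radon measure, and let $\|\mu\|=\|R\mu\|$, $\|\mu-\nu\|=\|R\mu-R\nu\|$ if $R\mu,R\nu\in\mathcal E$. Fix continuous $g_i:X\to(0,\infty)$ and $a_i\in(0,\infty)$, $i\in I$. Let $\mathcal E(\mathbf A,\mathbf a,\mathbf g)$ be the set of measures $\mu$ associated with $\mathbf A$ with $R\mu\in\mathcal E$ and $\int g_i\,d\mu^i=a_i$ for all $i$; let $\mathrm{cap}\,\mathbf A=1/\inf_{\mu\in\mathcal E(\mathbf A,\mathbf a,\mathbf g)}\|\mu\|^2$ (with $\inf\varnothing=+\infty$, $1/0=\infty$, $1/\infty=0$), and let $\mathfrak S(\mathbf A,\mathbf a,\mathbf g)$ be the set of all $\lambda\in\mathcal E(\mathbf A,\mathbf a,\mathbf g)$ attaining this infimum. **Theorem.** Let $\mathbf A$ be a condenser with $\mathrm{cap}\,\mathbf A>0$. Assume that either $I^-=\varnothing$, or both $$\sum_{i\in I}\frac{a_i}{\inf_{A_i}g_i}<\infty\qquad\text{and}\qquad\sup_{x\in A^+,\,y\in A^-}\kappa(x,y)<\infty .$$ Assume that for every $i\in I$ either $\sup_{A_i}g_i<\infty$,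 or there are $r_i\in(1,\infty)$ and $\omega_i\in\mathcal E$ with $g_i(x)^{r_i}\le\kappa(x,\omega_i)$ nearly everywhere in $A_i$; and that for every $i\in I$ either $A_i$ is compact or $C(A_i)<\infty$. Let $\{\mathbf K\}_{\mathbf A}$ be the family of all compact condensers $\mathbf K\prec\mathbf A$ (with the same $I^+,I^-$) with $\mathrm{cap}\,\mathbf K>0$, directed by $\prec$. Then $\mathfrak S(\mathbf K,\mathbf a,\mathbf g)\neq\varnothing$ for all $\mathbf K\in\{\mathbf K\}_{\mathbf A}$, and for every choice of $\lambda_{\mathbf K}\in\mathfrak S(\mathbf K,\mathbf a,\mathbf g)$, $\mathbf K\in\{\mathbf K\}_{\mathbf A}$: 1. the net $(\lambda_{\mathbf K})_{\mathbf K\in\{\mathbf K\}_{\mathbf A}}$ has an $\mathbf A$-vague cluster point, and every $\mathbf A$-vague cluster point of it belongs to $\mathfrak S(\mathbf A,\mathbf a,\mathbf g)$; 2. for every $\lambda_{\mathbf A}\in\mathfrak S(\mathbf A,\mathbf a,\mathbf g)$, $\displaystyle\lim_{\mathbf K\uparrow\mathbf A}\|\lambda_{\mathbf K}-\lambda_{\mathbf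 A}\|^2=0$. -/

import Mathlib

open MeasureTheory Set Filter Topology
open scoped ENNReal CompactlySupported

noncomputable section

/-! ### Radon measures -/

section Radon

variable (X : Type*) [TopologicalSpace X] [MeasurableSpace X]

/-- Positive Radon measures on `X`, realised as regular Borel measures (for a locally compact
Hausdorff space, the Riesz representation identifies them with the positive linear functionals
on `C_c(X, ℝ)`). -/
def PosRadon : Type _ := {ν : Measure X // ν.Regular}

/-- A signed Radon measure, given by its Jordan decomposition `pos - neg`. Both parts may have
infinite total mass; that they are mutually singular is expressed on compact sets. -/
structure SignedRadon where
  pos : PosRadon X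
  neg : PosRadon X
  singular : ∀ K : Set X, IsCompact K → (pos.1.restrict K) ⟂ₘ (neg.1.restrict K)

variable {X}

/-- The vague topology: pointwise convergence on `C_c(X, ℝ)`. -/
instance : TopologicalSpace (PosRadon X) :=
  TopologicalSpace.induced (fun (ν : PosRadon X) (φ : C_c(X, ℝ)) => ∫ x, φ x ∂ν.1) inferInstance

/-- A positive Radon measure regarded as a signed one. -/
def PosRadon.toSigned (ν : PosRadon X) : SignedRadon X where
  pos := ν
  neg := ⟨0, inferInstance⟩
  singular := fun K _ => by simp

end Radon

/-! ### Kernels, potentials, energies -/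

section Kernel

variable {X : Type*} [TopologicalSpace X]

/-- A kernel on `X`: a lower semicontinuous function `X × X → (-∞, ∞]`, nonnegative unless
`X` is compact. -/
structure IsKernel (κ : X → X → EReal) : Prop where
  lsc : LowerSemicontinuous fun p : X × X => κ p.1 p.2
  ne_bot : ∀ x y, κ x y ≠ ⊥
  nonneg : ¬ CompactSpace X → ∀ x y, 0 ≤ κ x y

variable [MeasurableSpace X]

/-- `∫ κ(x, y) dν(y)` for a positive Radon measure `ν`. As usual for Radon measures, the integral
of a lower semicontinuous function is the supremum of the integrals of its minorants in `C_c`. -/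
def PosRadon.potential (κ : X → X → EReal) (x : X) (ν : PosRadon X) : EReal :=
  ⨆ (φ : C_c(X, ℝ)) (_ : ∀ y, ((φ y : ℝ) : EReal) ≤ κ x y), ((∫ y, φ y ∂ν.1 : ℝ) : EReal)

/-- `∫ κ d(ν ⊗ ν₁)` for positive Radon measures `ν`, `ν₁`. The Radon measure `ν ⊗ ν₁` is the
functional `φ ↦ ∫∫ φ(x, y) dν₁(y) dν(x)` on `C_c(X × X)`, and the integral of the lower
semicontinuous function `κ` is the supremum over its minorants in `C_c(X × X)`. -/
def PosRadon.mutualEnergy (κ : X → X → EReal) (ν ν₁ : PosRadon X) : EReal :=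
  ⨆ (φ : C_c(X × X, ℝ)) (_ : ∀ p : X × X, ((φ p : ℝ) : EReal) ≤ κ p.1 p.2),
    ((∫ x, ∫ y, φ (x, y) ∂ν₁.1 ∂ν.1 : ℝ) : EReal)

namespace SignedRadon

/-- The integral of `κ` against the positive part of `ν ⊗ ν₁`. -/
def energyPlus (κ : X → X → EReal) (ν ν₁ : SignedRadon X) : EReal :=
  ν.pos.mutualEnergy κ ν₁.pos + ν.neg.mutualEnergy κ ν₁.neg

/-- The integral of `κ` against the negative part of `ν ⊗ ν₁`. -/
def energyMinus (κ : X → X → EReal) (ν ν₁ : SignedRadon X) : EReal :=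
  ν.pos.mutualEnergy κ ν₁.neg + ν.neg.mutualEnergy κ ν₁.pos

/-- The mutual energy `κ(ν, ν₁)` is well defined: it is not of the form `∞ - ∞`. -/
def EnergyDefined (κ : X → X → EReal) (ν ν₁ : SignedRadon X) : Prop :=
  ¬ (ν.energyPlus κ ν₁ = ⊤ ∧ ν.energyMinus κ ν₁ = ⊤)

/-- The mutual energy `κ(ν, ν₁)`; in the undefined case `∞ - ∞` it takes the value `⊥ = -∞`. -/
def mutualEnergy (κ : X → X → EReal) (ν ν₁ : SignedRadon X) : EReal :=
  ν.energyPlus κ ν₁ - ν.energyMinus κ ν₁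

/-- `ν ∈ 𝓔`, that is, `-∞ < κ(ν, ν) < ∞`. -/
def FiniteEnergy (κ : X → X → EReal) (ν : SignedRadon X) : Prop :=
  ν.EnergyDefined κ ν ∧ ⊥ < ν.mutualEnergy κ ν ∧ ν.mutualEnergy κ ν < ⊤

/-- The potential `κ(x, ν)`; in the undefined case `∞ - ∞` it takes the value `⊥ = -∞`. -/
def potential (κ : X → X → EReal) (x : X) (ν : SignedRadon X) : EReal :=
  ν.pos.potential κ x - ν.neg.potential κ x

/-- `‖ν - ν₁‖²` in the pre-Hilbert space `𝓔` with scalar product `κ(·, ·)`. -/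
def distSq (κ : X → X → EReal) (ν ν₁ : SignedRadon X) : EReal :=
  ν.mutualEnergy κ ν + ν₁.mutualEnergy κ ν₁ - (ν.mutualEnergy κ ν₁ + ν₁.mutualEnergy κ ν)

end SignedRadon

/-- `κ` is symmetric and all energies of signed Radon measures are nonnegative whenever defined. -/
def IsPositiveDefinite (κ : X → X → EReal) : Prop :=
  (∀ x y, κ x y = κ y x) ∧
    ∀ ν : SignedRadon X, ν.EnergyDefined κ ν → 0 ≤ ν.mutualEnergy κ ν

/-- `𝓔⁺`: the positive Radon measures of finite energy. -/
def posFiniteEnergy (κ : X → X → EReal) : Set (PosRadon X) :=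
  {ν | ν.toSigned.FiniteEnergy κ}

/-- Every strong Cauchy net (here: filter) in `𝓔⁺` converges strongly to each of its vague
cluster points. -/
def ConsistencyC1 (κ : X → X → EReal) : Prop :=
  ∀ F : Filter (PosRadon X), F.NeBot → posFiniteEnergy κ ∈ F →
    (∀ ε : ℝ, 0 < ε → ∃ S ∈ F, ∀ ν ∈ S, ∀ ν' ∈ S,
      SignedRadon.distSq κ ν.toSigned ν'.toSigned < (ε : EReal)) →
    ∀ ν₀ ∈ posFiniteEnergy κ, ClusterPt ν₀ F →
      Tendsto (fun ν : PosRadon X => SignedRadon.distSq κ ν.toSigned ν₀.toSigned) F (𝓝 0)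

/-- Every strongly bounded and vaguely convergent net (here: filter) in `𝓔⁺` converges weakly to
the vague limit. -/
def ConsistencyC2 (κ : X → X → EReal) : Prop :=
  ∀ F : Filter (PosRadon X), F.NeBot → posFiniteEnergy κ ∈ F →
    (∃ M : ℝ, ∀ᶠ ν in F, ν.toSigned.mutualEnergy κ ν.toSigned ≤ (M : EReal)) →
    ∀ ν₀ ∈ posFiniteEnergy κ, F ≤ 𝓝 ν₀ →
      ∀ μ : SignedRadon X, μ.FiniteEnergy κ →
        Tendsto (fun ν : PosRadon X => ν.toSigned.mutualEnergy κ μ) F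
          (𝓝 (ν₀.toSigned.mutualEnergy κ μ))

/-- Consistency of a (positive definite) kernel. -/
def IsConsistent (κ : X → X → EReal) : Prop :=
  ConsistencyC1 κ ∨ ConsistencyC2 κ

/-- The interior capacity of a set: the supremum over its compact subsets `K` of
`1 / inf κ(ν, ν)`, where `ν` ranges over the positive measures on `K` of total mass one. -/
def interiorCapacity (κ : X → X → EReal) (E : Set X) : ℝ≥0∞ :=
  ⨆ (K : Set X) (_ : IsCompact K ∧ K ⊆ E),
    (⨅ (ν : PosRadon X) (_ : ν.1 Kᶜ = 0 ∧ ν.1 univ = 1), ν.mutualEnergy κ ν).toENNReal⁻¹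

/-- `p` holds nearly everywhere in `E`: it fails only on a set of interior capacity zero. -/
def NearlyEverywhere (κ : X → X → EReal) (E : Set X) (p : X → Prop) : Prop :=
  interiorCapacity κ {x ∈ E | ¬ p x} = 0

end Kernel

/-! ### Condensers -/

/-- A condenser with positive plates indexed by `P` and negative plates indexed by `Pᶜ`. -/
structure Condenser {ι : Type*} (P : Set ι) (X : Type*) [TopologicalSpace X] where
  plate : ι → Set X
  nonempty : ∀ i, (plate i).Nonempty
  isClosed : ∀ i, IsClosed (plate i)
  finite_inter : ∀ K : Set X, IsCompact K → {i | (plate i ∩ K).Nonempty}.Finite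
  disjoint : ∀ i ∈ P, ∀ j ∉ P, Disjoint (plate i) (plate j)

section Condensers

variable {ι : Type*} {P : Set ι} {X : Type*} [TopologicalSpace X]

/-- `A' ≤ A` means `A'ᵢ ⊆ Aᵢ` for all `i`. -/
instance : Preorder (Condenser P X) := Preorder.lift Condenser.plate

/-- The union of the positive plates. -/
def Condenser.posUnion (A : Condenser P X) : Set X := ⋃ i ∈ P, A.plate i

/-- The union of the negative plates. -/
def Condenser.negUnion (A : Condenser P X) : Set X := ⋃ i ∈ Pᶜ, A.plate i

theorem Condenser.locallyFinite [LocallyCompactSpace X] (A : Condenser P X) :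
    LocallyFinite A.plate := by
  intro x
  obtain ⟨K, hK, hx⟩ := exists_compact_mem_nhds x
  exact ⟨K, hx, A.finite_inter K hK⟩

variable [MeasurableSpace X]

/-- A measure `∑ αᵢ μⁱ` associated with the condenser `A`, given by its coordinates `μⁱ`, each of
which is a positive Radon measure supported by `Aᵢ`. -/
structure CondenserMeasure (A : Condenser P X) where
  coord : ι → PosRadon X
  supported : ∀ i, (coord i).1 (A.plate i)ᶜ = 0

/-- The `A`-vague topology: vague convergence of all coordinates. -/
instance (A : Condenser P X) : TopologicalSpace (CondenserMeasure A) :=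
  TopologicalSpace.induced CondenserMeasure.coord inferInstance

/-- A measure associated with `A'` is a measure associated with every `A ≥ A'`. -/
def CondenserMeasure.ofLE {A' A : Condenser P X} (h : A' ≤ A) (μ : CondenserMeasure A') :
    CondenserMeasure A where
  coord := μ.coord
  supported i := measure_mono_null (compl_subset_compl.2 (h i)) (μ.supported i)

variable [BorelSpace X]

/-- The sum of countably many regular measures supported by the sets of a locally finite family
of closed sets is regular. -/
theorem regular_sum_of_locallyFinite [T2Space X] {J : Type*} [Countable J] (m : J → Measure X)
    (hm : ∀ j, (m j).Regular) (B : J → Set X) (hB : ∀ j, IsClosed (B j)) (hlf : LocallyFinite B)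
    (hsupp : ∀ j, m j (B j)ᶜ = 0) : (Measure.sum m).Regular := by
  have hfin : ∀ K : Set X, IsCompact K → Measure.sum m K < ⊤ := by
    intro K hK
    have hf : {j | (B j ∩ K).Nonempty}.Finite := hlf.finite_nonempty_inter_compact hK
    rw [Measure.sum_apply _ hK.measurableSet, tsum_eq_sum (s := hf.toFinset)]
    · exact ENNReal.sum_lt_top.2 fun j _ => hK.measure_lt_top
    · intro j hj
      refine measure_mono_null ?_ (hsupp j)
      intro x hx hxB
      exact hj (hf.mem_toFinset.2 ⟨x, hxB, hx⟩)
  have houter : (Measure.sum m).OuterRegular := by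
    refine ⟨fun E hE r hr => ?_⟩
    rw [gt_iff_lt, Measure.sum_apply _ hE] at hr
    have hne : (∑' j, m j E) ≠ ⊤ := (lt_of_lt_of_le hr le_top).ne
    obtain ⟨ε, hε, hεs⟩ :=
      ENNReal.exists_pos_sum_of_countable' (ε := r - ∑' j, m j E) (tsub_pos_of_lt hr).ne' J
    have hex : ∀ j, ∃ U, E ⊆ U ∧ IsOpen U ∧ m j U < m j E + ε j := fun j =>
      E.exists_isOpen_lt_add (ENNReal.ne_top_of_tsum_ne_top hne j) (hε j).ne'
    choose U hEU hUo hUm using hex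
    have hcl : IsClosed (⋃ j, B j ∩ (U j)ᶜ) :=
      (hlf.subset fun j => inter_subset_left).isClosed_iUnion
        fun j => (hB j).inter (hUo j).isClosed_compl
    refine ⟨(⋃ j, B j ∩ (U j)ᶜ)ᶜ, ?_, hcl.isOpen_compl, ?_⟩
    · intro x hx hx'
      obtain ⟨j, hj⟩ := mem_iUnion.1 hx'
      exact hj.2 (hEU j hx)
    · rw [Measure.sum_apply _ hcl.isOpen_compl.measurableSet]
      have hle : ∀ j, m j (⋃ j, B j ∩ (U j)ᶜ)ᶜ ≤ m j E + ε j := by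
        intro j
        have hsub : (⋃ j, B j ∩ (U j)ᶜ)ᶜ ⊆ U j ∪ (B j)ᶜ := by
          intro x hx
          by_contra hcon
          rw [mem_union, not_or, mem_compl_iff, not_not] at hcon
          exact hx (mem_iUnion.2 ⟨j, hcon.2, hcon.1⟩)
        calc m j (⋃ j, B j ∩ (U j)ᶜ)ᶜ ≤ m j (U j ∪ (B j)ᶜ) := measure_mono hsub
          _ ≤ m j (U j) + m j (B j)ᶜ := measure_union_le _ _
          _ = m j (U j) := by rw [hsupp j, add_zero]
          _ ≤ m j E + ε j := (hUm j).le
      calc ∑' j, m j (⋃ j, B j ∩ (U j)ᶜ)ᶜ ≤ ∑' j, (m j E + ε j) := ENNReal.tsum_le_tsum hle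
        _ = ∑' j, m j E + ∑' j, ε j := ENNReal.tsum_add
        _ < ∑' j, m j E + (r - ∑' j, m j E) := ENNReal.add_lt_add_left hne hεs
        _ = r := add_tsub_cancel_of_le hr.le
  refine { lt_top_of_isCompact := fun K hK => hfin K hK
           outerRegular := houter.outerRegular
           innerRegular := ?_ }
  intro U hU r hr
  rw [Measure.sum_apply _ hU.measurableSet, ENNReal.tsum_eq_iSup_sum, lt_iSup_iff] at hr
  obtain ⟨s, hs⟩ := hr
  have heq : ∑ j ∈ s, m j U = ⨆ K : {K : Set X // K ⊆ U ∧ IsCompact K}, ∑ j ∈ s, m j K.1 := by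
    rw [← ENNReal.finsetSum_iSup]
    · refine Finset.sum_congr rfl fun j _ => ?_
      have := hm j
      rw [hU.measure_eq_iSup_isCompact, iSup_subtype]
      simp only [iSup_and]
    · intro K L
      exact ⟨⟨K.1 ∪ L.1, union_subset K.2.1 L.2.1, K.2.2.union L.2.2⟩, fun j =>
        ⟨measure_mono subset_union_left, measure_mono subset_union_right⟩⟩
  rw [heq, lt_iSup_iff] at hs
  obtain ⟨K, hK⟩ := hs
  exact ⟨K.1, K.2.1, K.2.2, hK.trans_le
    ((ENNReal.sum_le_tsum s).trans (Measure.le_sum_apply m K.1))⟩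

variable [T2Space X] [LocallyCompactSpace X] [Countable ι] {A : Condenser P X}

/-- `∑_{i ∈ S} μⁱ` as a Radon measure. -/
def CondenserMeasure.sumOver (μ : CondenserMeasure A) (S : Set ι) : PosRadon X :=
  ⟨Measure.sum fun i : S => (μ.coord i).1,
    regular_sum_of_locallyFinite _ (fun i => (μ.coord i).2) (fun i : S => A.plate i)
      (fun i => A.isClosed i) (A.locallyFinite.comp_injective Subtype.val_injective)
      (fun i => μ.supported i)⟩

/-- The signed Radon measure `Rμ = ∑ αᵢ μⁱ`. -/
def CondenserMeasure.R (μ : CondenserMeasure A) : SignedRadon X where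
  pos := μ.sumOver P
  neg := μ.sumOver Pᶜ
  singular := by
    have hms : MeasurableSet A.posUnion :=
      MeasurableSet.biUnion (Set.to_countable P) fun i _ => (A.isClosed i).measurableSet
    have h : (μ.sumOver P).1 ⟂ₘ (μ.sumOver Pᶜ).1 := by
      refine ⟨A.posUnionᶜ, hms.compl, ?_, ?_⟩
      · rw [CondenserMeasure.sumOver, Measure.sum_apply _ hms.compl, ENNReal.tsum_eq_zero]
        intro i
        exact measure_mono_null
          (compl_subset_compl.2 (subset_biUnion_of_mem (u := A.plate) i.2)) (μ.supported i)
      · rw [compl_compl, CondenserMeasure.sumOver, Measure.sum_apply _ hms, ENNReal.tsum_eq_zero]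
        intro j
        refine measure_mono_null ?_ (μ.supported j)
        exact iUnion₂_subset fun i hi => (A.disjoint i hi j j.2).subset_compl_right
    intro K _
    exact ((h.restrict K).symm.restrict K).symm

namespace Condenser

/-- The class `𝓔(A, a, g)`: the measures `μ` associated with `A` with finite energy
`κ(Rμ, Rμ)` and `∫ gᵢ dμⁱ = aᵢ` for all `i`. -/
def admissible (κ : X → X → EReal) (a : ι → ℝ) (g : ι → C(X, ℝ)) (A : Condenser P X) :
    Set (CondenserMeasure A) :=
  {μ | μ.R.FiniteEnergy κ ∧
    ∀ i, ∫⁻ x, ENNReal.ofReal (g i x) ∂(μ.coord i).1 = ENNReal.ofReal (a i)}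

/-- `‖𝓔(A, a, g)‖²`: the infimum of the energies over `𝓔(A, a, g)` (`⊤` if this is empty). -/
def infEnergy (κ : X → X → EReal) (a : ι → ℝ) (g : ι → C(X, ℝ)) (A : Condenser P X) : EReal :=
  ⨅ μ ∈ A.admissible κ a g, μ.R.mutualEnergy κ μ.R

/-- The (interior) capacity of a condenser, with `1 / 0 = ∞` and `1 / ∞ = 0`. -/
def capacity (κ : X → X → EReal) (a : ι → ℝ) (g : ι → C(X, ℝ)) (A : Condenser P X) : ℝ≥0∞ :=
  (A.infEnergy κ a g).toENNReal⁻¹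

/-- The class `𝔖(A, a, g)` of all minimizers. -/
def minimizers (κ : X → X → EReal) (a : ι → ℝ) (g : ι → C(X, ℝ)) (A : Condenser P X) :
    Set (CondenserMeasure A) :=
  {μ | μ ∈ A.admissible κ a g ∧ μ.R.mutualEnergy κ μ.R = A.infEnergy κ a g}

/-- The family of all compact condensers `K ≤ A` of nonzero capacity, ordered by `≤`. -/
abbrev CompactFamily (κ : X → X → EReal) (a : ι → ℝ) (g : ι → C(X, ℝ)) (A : Condenser P X) :
    Type _ :=
  {K : Condenser P X // (∀ i, IsCompact (K.plate i)) ∧ K ≤ A ∧ 0 < K.capacity κ a g}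

end Condenser

end Condensers

end

set_option linter.unusedSectionVars false

open scoped NNReal

universe u

noncomputable section

/-! Positive measures of finite energy are realised as vectors of a Hilbert space in which the
mutual energy is the inner product (`exists_energyEmbedding`). The problem becomes that of
minimising a norm over a convex set, so by the parallelogram law two admissible measures with
energies close to the infimum are strongly close (`EnergyEmbedding.norm_sub_sq_le`). Strong
convergence therefore only needs the infima over compact condensers to approach the infimum over
`A`; this is obtained by truncating an almost optimal measure to compact sets and rescaling its
coordinates (`exists_compact_admissible_le`).

That cluster points are minimizers rests on the stability of the admissible class under vague limits
with bounded energy (`admissible_of_tendsto`). The hypotheses on masses and on `κ` across the two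
signs bound the mutual energy of the positive and negative parts, so a bound for the energy of `Rμ`
bounds the energy of each part (`exists_bound_energy`). By consistency, vague limits of such parts
are also their weak limits in the Hilbert space (`EnergyEmbedding.tendsto_inner_of_tendsto`), and
the norm is weakly lower semicontinuous.

The constraints `∫ gᵢ dμⁱ = aᵢ` survive because nothing escapes to infinity. On a plate of finite
capacity, probability measures of bounded energy leaving every compact set would tend vaguely, hence
weakly, to zero; by Mazur's lemma their convex combinations would have arbitrarily small energy,
against the finite capacity (`exists_compact_measure_compl_le`). When `gᵢ` is unbounded, the
potential majorising `gᵢ ^ r` with `r > 1` provides uniform integrability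
(`exists_compact_lintegral_compl_le`).

Integrals of `κ` are handled through minorants in `C_c`, since Radon measures need not be
`σ`-finite. The kernel may be negative only on compact `X`, where no truncation is needed. -/

namespace PosRadon

/-! ### The cone of Radon measures and its vague topology -/

section Algebra

variable {X : Type*} [TopologicalSpace X] [MeasurableSpace X]

instance (ν : PosRadon X) : ν.1.Regular := ν.2

theorem ext {μ ν : PosRadon X} (h : μ.1 = ν.1) : μ = ν := Subtype.ext h

instance : Zero (PosRadon X) := ⟨⟨0, inferInstance⟩⟩

theorem zero_val : (0 : PosRadon X).1 = 0 := rfl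

instance [BorelSpace X] : SMul ℝ≥0 (PosRadon X) := ⟨fun c ν => ⟨c • ν.1, inferInstance⟩⟩

theorem smul_val [BorelSpace X] (c : ℝ≥0) (ν : PosRadon X) : (c • ν).1 = c • ν.1 := rfl

variable [BorelSpace X] [T2Space X]

instance : Add (PosRadon X) :=
  ⟨fun μ ν => ⟨μ.1 + ν.1, by
    have := regular_sum_of_locallyFinite (X := X) (fun b : Bool => cond b μ.1 ν.1)
      (fun b => by cases b; exacts [ν.2, μ.2]) (fun _ => univ) (fun _ => isClosed_univ)
      (locallyFinite_of_finite _) (fun b => by simp)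
    rwa [Measure.sum_cond] at this⟩⟩

theorem add_val (μ ν : PosRadon X) : (μ + ν).1 = μ.1 + ν.1 := rfl

/-- The restriction of a Radon measure to a compact set. -/
def restrict (ν : PosRadon X) (K : Set X) (hK : IsCompact K) : PosRadon X :=
  ⟨ν.1.restrict K, Measure.Regular.restrict_of_measure_ne_top hK.measure_ne_top⟩

/-- A measure dominated by a finite Radon measure is a Radon measure. -/
theorem _root_.MeasureTheory.Measure.Regular.of_le {μ ν : Measure X} [IsFiniteMeasure ν]
    [ν.Regular] (h : μ ≤ ν) : μ.Regular := by
  have hfin : IsFiniteMeasure μ := ⟨(h univ).trans_lt (measure_lt_top ν univ)⟩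
  have hir : μ.InnerRegularCompactLTTop := by
    refine ⟨fun E hE r hr => ?_⟩
    have hε : μ E - r ≠ 0 := (tsub_pos_of_lt hr).ne'
    -- `ν` is inner regular on `E` with an error below `μ E - r`, and domination passes this error
    -- on to `μ`.
    obtain ⟨K, hKE, hK, hνK⟩ := hE.1.exists_isCompact_sdiff_lt (measure_ne_top ν E) hε
    refine ⟨K, hKE, hK, ?_⟩
    have h1 : μ E ≤ μ K + μ (E \ K) := by
      rw [← measure_inter_add_sdiff E hK.measurableSet, inter_eq_self_of_subset_right hKE]
    by_contra hcon
    have h2 : μ (E \ K) < μ E - r := (h _).trans_lt hνK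
    have h3 : μ K + μ (E \ K) < μ E := by
      calc μ K + μ (E \ K) ≤ r + μ (E \ K) := by gcongr; exact not_lt.1 hcon
        _ < r + (μ E - r) := ENNReal.add_lt_add_left (hr.trans_le le_top).ne h2
        _ = μ E := add_tsub_cancel_of_le hr.le
    exact absurd h1 (not_le.2 h3)
  have : μ.WeaklyRegular := inferInstance
  exact ⟨fun V hV r hr => MeasurableSet.exists_lt_isCompact_of_ne_top hV.measurableSet
    (measure_ne_top μ V) hr⟩

end Algebra

section Vague

variable {X : Type*} [TopologicalSpace X] [MeasurableSpace X]

theorem tendsto_iff {α : Type*} {F : Filter α} {ν : α → PosRadon X} {ν₀ : PosRadon X} :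
    Tendsto ν F (𝓝 ν₀) ↔
      ∀ φ : C_c(X, ℝ), Tendsto (fun s => ∫ x, φ x ∂(ν s).1) F (𝓝 (∫ x, φ x ∂ν₀.1)) := by
  rw [nhds_induced, tendsto_comap_iff, tendsto_pi_nhds]
  rfl

end Vague

end PosRadon

/-! ### Compactly supported functions against products of Radon measures -/

section Integrals

variable {X : Type*} [TopologicalSpace X] [MeasurableSpace X] [BorelSpace X]

theorem integrable_cc (φ : C_c(X, ℝ)) (ν : PosRadon X) : Integrable (fun x => φ x) ν.1 :=
  φ.continuous.integrable_of_hasCompactSupport φ.hasCompactSupport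

variable [T2Space X]

theorem integral_cc_add (φ : C_c(X, ℝ)) (μ ν : PosRadon X) :
    ∫ x, φ x ∂(μ + ν).1 = ∫ x, φ x ∂μ.1 + ∫ x, φ x ∂ν.1 :=
  integral_add_measure (integrable_cc φ μ) (integrable_cc φ ν)

theorem integral_cc_smul (φ : C_c(X, ℝ)) (c : ℝ≥0) (ν : PosRadon X) :
    ∫ x, φ x ∂(c • ν).1 = c * ∫ x, φ x ∂ν.1 := by
  rw [PosRadon.smul_val, integral_smul_nnreal_measure]; rfl

/-- A compactly supported continuous function on `X × X`, as a function of the first variable with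
values in the compactly supported functions of the second one. -/
def sliceLeft (φ : C_c(X × X, ℝ)) (x : X) : C_c(X, ℝ) where
  toFun y := φ (x, y)
  continuous_toFun := by fun_prop
  hasCompactSupport' := by
    refine HasCompactSupport.intro (φ.hasCompactSupport.isCompact.image continuous_snd) ?_
    intro y hy
    by_contra h
    exact hy ⟨(x, y), subset_tsupport _ h, rfl⟩

/-- One compact set serves both variables, so that both measures of a pairing can be restricted to
it simultaneously. -/
theorem exists_compact_support (φ : C_c(X × X, ℝ)) :
    ∃ L : Set X, IsCompact L ∧ ∀ x y, φ (x, y) ≠ 0 → x ∈ L ∧ y ∈ L := by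
  refine ⟨Prod.fst '' tsupport φ ∪ Prod.snd '' tsupport φ,
    (φ.hasCompactSupport.isCompact.image continuous_fst).union
      (φ.hasCompactSupport.isCompact.image continuous_snd), fun x y h => ?_⟩
  have := subset_tsupport _ (show (x, y) ∈ Function.support φ from h)
  exact ⟨Or.inl ⟨_, this, rfl⟩, Or.inr ⟨_, this, rfl⟩⟩

/-- The function `x ↦ ∫ φ(x, y) dν(y)`. -/
def partialIntegral (φ : C_c(X × X, ℝ)) (ν : PosRadon X) : C_c(X, ℝ) where
  toFun x := ∫ y, φ (x, y) ∂ν.1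
  continuous_toFun := by
    obtain ⟨L, hL, hφ⟩ := exists_compact_support φ
    rw [← continuousOn_univ]
    refine continuousOn_integral_of_compact_support hL (f := fun x y => φ (x, y)) ?_ ?_
    · exact (show Continuous (Function.uncurry fun x y => φ (x, y)) from φ.continuous).continuousOn
    · intro x y _ hy
      by_contra h
      exact hy (hφ x y h).2
  hasCompactSupport' := by
    obtain ⟨L, hL, hφ⟩ := exists_compact_support φ
    refine HasCompactSupport.intro hL fun x hx => ?_
    have : ∀ y, φ (x, y) = 0 := fun y => by
      by_contra h
      exact hx (hφ x y h).1
    simp [this]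

theorem partialIntegral_apply (φ : C_c(X × X, ℝ)) (ν : PosRadon X) (x : X) :
    partialIntegral φ ν x = ∫ y, φ (x, y) ∂ν.1 := rfl

/-- The integral of `φ` against the product of two Radon measures. -/
def pairing (φ : C_c(X × X, ℝ)) (μ ν : PosRadon X) : ℝ := ∫ x, ∫ y, φ (x, y) ∂ν.1 ∂μ.1

theorem pairing_eq (φ : C_c(X × X, ℝ)) (μ ν : PosRadon X) :
    pairing φ μ ν = ∫ x, partialIntegral φ ν x ∂μ.1 := rfl

theorem pairing_add_left (φ : C_c(X × X, ℝ)) (μ μ' ν : PosRadon X) :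
    pairing φ (μ + μ') ν = pairing φ μ ν + pairing φ μ' ν := by
  simp only [pairing_eq, integral_cc_add]

theorem pairing_smul_left (φ : C_c(X × X, ℝ)) (c : ℝ≥0) (μ ν : PosRadon X) :
    pairing φ (c • μ) ν = c * pairing φ μ ν := by
  simp only [pairing_eq, integral_cc_smul]

/-- The function `φ(y, x)`. -/
def swapVars (φ : C_c(X × X, ℝ)) : C_c(X × X, ℝ) where
  toFun p := φ (p.2, p.1)
  continuous_toFun := by fun_prop
  hasCompactSupport' := by
    obtain ⟨L, hL, hφ⟩ := exists_compact_support φ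
    refine HasCompactSupport.intro (hL.prod hL) fun p hp => ?_
    by_contra h
    exact hp ⟨(hφ _ _ h).2, (hφ _ _ h).1⟩

/-- The measures need not be `σ`-finite; continuity and compact support justify the interchange of
integrals. -/
theorem pairing_swap (φ : C_c(X × X, ℝ)) (μ ν : PosRadon X) :
    pairing (swapVars φ) μ ν = pairing φ ν μ := by
  unfold pairing
  exact (integral_integral_swap_of_hasCompactSupport (f := fun y x => φ (y, x))
    (show Continuous (Function.uncurry fun x y => φ (x, y)) from φ.continuous)
    (show HasCompactSupport (Function.uncurry fun x y => φ (x, y)) from φ.hasCompactSupport)).symm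

theorem pairing_mono {φ ψ : C_c(X × X, ℝ)} (h : ∀ p, φ p ≤ ψ p) (μ ν : PosRadon X) :
    pairing φ μ ν ≤ pairing ψ μ ν := by
  refine integral_mono (integrable_cc (partialIntegral φ ν) μ)
    (integrable_cc (partialIntegral ψ ν) μ) fun x => ?_
  exact integral_mono (integrable_cc (sliceLeft φ x) ν) (integrable_cc (sliceLeft ψ x) ν)
    fun y => h (x, y)

theorem pairing_add (φ ψ : C_c(X × X, ℝ)) (μ ν : PosRadon X) :
    pairing (φ + ψ) μ ν = pairing φ μ ν + pairing ψ μ ν := by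
  rw [pairing_eq φ, pairing_eq ψ, ← integral_add (integrable_cc (partialIntegral φ ν) μ)
    (integrable_cc (partialIntegral ψ ν) μ)]
  refine integral_congr_ae (.of_forall fun x => ?_)
  exact integral_add (integrable_cc (sliceLeft φ x) ν) (integrable_cc (sliceLeft ψ x) ν)

theorem pairing_zero (μ ν : PosRadon X) : pairing 0 μ ν = 0 := by
  simp [pairing]

theorem pairing_mono_left {φ : C_c(X × X, ℝ)} (h : ∀ p, 0 ≤ φ p) {μ μ' : PosRadon X}
    (hμ : μ.1 ≤ μ'.1) (ν : PosRadon X) : pairing φ μ ν ≤ pairing φ μ' ν :=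
  integral_mono_measure hμ (.of_forall fun x => integral_nonneg fun y => h (x, y))
    (integrable_cc (partialIntegral φ ν) μ')

theorem pairing_mono_measure {φ : C_c(X × X, ℝ)} (h : ∀ p, 0 ≤ φ p) {μ μ' ν ν' : PosRadon X}
    (hμ : μ.1 ≤ μ'.1) (hν : ν.1 ≤ ν'.1) : pairing φ μ ν ≤ pairing φ μ' ν' := by
  refine (pairing_mono_left h hμ ν).trans ?_
  rw [← pairing_swap φ ν μ', ← pairing_swap φ ν' μ']
  exact pairing_mono_left (φ := swapVars φ) (fun p => h _) hν μ'

theorem pairing_zero_left (φ : C_c(X × X, ℝ)) (ν : PosRadon X) : pairing φ 0 ν = 0 := by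
  simp [pairing, PosRadon.zero_val]

theorem pairing_zero_right (φ : C_c(X × X, ℝ)) (ν : PosRadon X) : pairing φ ν 0 = 0 := by
  simp [pairing, PosRadon.zero_val]

/-- When a single test function is involved, arbitrary Radon measures can thus be replaced by finite
ones. -/
theorem pairing_restrict {φ : C_c(X × X, ℝ)} {L : Set X} (hL : IsCompact L)
    (hφ : ∀ x y, φ (x, y) ≠ 0 → x ∈ L ∧ y ∈ L) (μ ν : PosRadon X) :
    pairing φ (μ.restrict L hL) (ν.restrict L hL) = pairing φ μ ν := by
  unfold pairing PosRadon.restrict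
  dsimp only
  have h1 : ∀ x, ∫ y in L, φ (x, y) ∂ν.1 = ∫ y, φ (x, y) ∂ν.1 := fun x =>
    setIntegral_eq_integral_of_forall_compl_eq_zero fun y hy => by
      by_contra h
      exact hy (hφ x y h).2
  simp only [h1]
  refine setIntegral_eq_integral_of_forall_compl_eq_zero fun x hx => ?_
  have : ∀ y, φ (x, y) = 0 := fun y => by
    by_contra h
    exact hx (hφ x y h).1
  simp [this]

end Integrals

/-! ### Joint vague continuity of product integrals -/

section Continuity

variable {X : Type*} [TopologicalSpace X] [T2Space X] [LocallyCompactSpace X] [MeasurableSpace X]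
  [BorelSpace X]

theorem exists_cutoff {K U : Set X} (hK : IsCompact K) (hU : IsOpen U) (hKU : K ⊆ U) :
    ∃ χ : C_c(X, ℝ), (∀ x ∈ K, χ x = 1) ∧ (∀ x, 0 ≤ χ x) ∧ (∀ x, χ x ≤ 1) ∧
      tsupport χ ⊆ U := by
  obtain ⟨f, h1, h2, h3, h4⟩ := exists_continuousMap_one_of_isCompact_subset_isOpen hK hU hKU
  exact ⟨⟨f, h2⟩, fun x hx => h1 hx, fun x => (h4 x).1, fun x => (h4 x).2, h3⟩

/-- The integrals `∬ φ dν dμ` depend continuously on `(μ, ν)` for the vague topologies. -/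
theorem tendsto_pairing {α : Type*} {F : Filter α} {μ ν : α → PosRadon X} {μ₀ ν₀ : PosRadon X}
    (hμ : Tendsto μ F (𝓝 μ₀)) (hν : Tendsto ν F (𝓝 ν₀)) (φ : C_c(X × X, ℝ)) :
    Tendsto (fun s => pairing φ (μ s) (ν s)) F (𝓝 (pairing φ μ₀ ν₀)) := by
  obtain ⟨L, hL, hφ⟩ := exists_compact_support φ
  obtain ⟨χ, hχ1, hχ0, -, -⟩ := exists_cutoff hL isOpen_univ (subset_univ L)
  rw [PosRadon.tendsto_iff] at hμ hν
  set C : ℝ := (∫ x, χ x ∂μ₀.1) + 1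
  set D : ℝ := (∫ x, χ x ∂ν₀.1) + 1
  have hC : 0 < C := add_pos_of_nonneg_of_pos (integral_nonneg hχ0) one_pos
  have hD : 0 < D := add_pos_of_nonneg_of_pos (integral_nonneg hχ0) one_pos
  -- The partial integrals converge uniformly, with the cutoff `χ` as envelope. They are
  -- equicontinuous because `∫ χ dν` eventually stays below `D`, so convergence at the finitely many
  -- centres of a cover of `L` suffices.
  have hunif : ∀ η : ℝ, 0 < η → ∀ᶠ s in F, ∀ x,
      |partialIntegral φ (ν s) x - partialIntegral φ ν₀ x| ≤ η * χ x := by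
    intro η hη
    set ε : ℝ := η / (3 * D)
    have hε : 0 < ε := by positivity
    have hU : ∀ x ∈ L, ∃ V ∈ 𝓝 x, ∀ x' ∈ V, ∀ y, |φ (x', y) - φ (x, y)| ≤ ε * χ y := by
      intro x _
      have h := hL.eventually_forall_of_forall_eventually (x₀ := x)
        (P := fun x' y => |φ (x', y) - φ (x, y)| < ε) (fun y _ => by
          have hc : Continuous fun z : X × X => |φ z - φ (x, z.2)| := by fun_prop
          have := hc.tendsto (x, y)
          refine this.eventually_lt_const ?_
          simpa using hε)
      refine ⟨_, h, fun x' hx' y => ?_⟩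
      by_cases hy : y ∈ L
      · rw [hχ1 y hy, mul_one]
        exact (hx' y hy).le
      · have h1 : φ (x', y) = 0 := by_contra fun h => hy (hφ _ _ h).2
        have h2 : φ (x, y) = 0 := by_contra fun h => hy (hφ _ _ h).2
        rw [h1, h2, sub_zero, abs_zero]
        exact mul_nonneg hε.le (hχ0 y)
    choose! V hV hVφ using hU
    obtain ⟨t, htL, htV⟩ := hL.elim_nhds_subcover V hV
    have hfin : ∀ᶠ s in F, ∀ x ∈ t,
        |partialIntegral φ (ν s) x - partialIntegral φ ν₀ x| < η / 3 := by
      rw [eventually_all_finset]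
      intro x _
      have h := ((hν (sliceLeft φ x)).sub_const (∫ y, sliceLeft φ x y ∂ν₀.1)).abs
      refine h.eventually_lt_const ?_
      rw [sub_self, abs_zero]
      positivity
    have hmass : ∀ᶠ s in F, ∫ x, χ x ∂(ν s).1 < D :=
      (hν χ).eventually_lt_const (lt_add_one _)
    filter_upwards [hfin, hmass] with s hs hsD x
    by_cases hx : x ∈ L
    · rw [hχ1 x hx, mul_one]
      obtain ⟨z, hz, hxz⟩ := mem_iUnion₂.1 (htV hx)
      have key : ∀ ρ : PosRadon X, ∫ x, χ x ∂ρ.1 ≤ D →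
          |partialIntegral φ ρ x - partialIntegral φ ρ z| ≤ η / 3 := by
        intro ρ hρ
        change |∫ y, sliceLeft φ x y ∂ρ.1 - ∫ y, sliceLeft φ z y ∂ρ.1| ≤ η / 3
        rw [← integral_sub (integrable_cc (sliceLeft φ x) ρ) (integrable_cc (sliceLeft φ z) ρ)]
        refine abs_integral_le_integral_abs.trans ?_
        calc ∫ y, |sliceLeft φ x y - sliceLeft φ z y| ∂ρ.1 ≤ ∫ y, ε * χ y ∂ρ.1 := by
              refine integral_mono ((integrable_cc (sliceLeft φ x) ρ).sub
                (integrable_cc (sliceLeft φ z) ρ)).abs ((integrable_cc χ ρ).const_mul ε) ?_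
              exact fun y => hVφ z (htL z hz) x hxz y
          _ = ε * ∫ y, χ y ∂ρ.1 := integral_const_mul _ _
          _ ≤ ε * D := by gcongr
          _ = η / 3 := by simp only [ε]; field_simp
      have h1 := key (ν s) hsD.le
      have h2 := key ν₀ (lt_add_one _).le
      have h3 := hs z hz
      rw [abs_le] at h1 h2 ⊢
      rw [abs_lt] at h3
      constructor <;> linarith [h1.1, h1.2, h2.1, h2.2, h3.1, h3.2]
    · have h0 : ∀ ρ : PosRadon X, partialIntegral φ ρ x = 0 := fun ρ => by
        have : ∀ y, φ (x, y) = 0 := fun y => by_contra fun h => hx (hφ _ _ h).1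
        simp [partialIntegral_apply, this]
      rw [h0, h0, sub_zero, abs_zero]
      exact mul_nonneg hη.le (hχ0 x)
  rw [Metric.tendsto_nhds]
  intro ε hε
  have h1 := hunif (ε / (2 * C)) (by positivity)
  have h2 := hμ (partialIntegral φ ν₀)
  rw [Metric.tendsto_nhds] at h2
  have h3 : ∀ᶠ s in F, ∫ x, χ x ∂(μ s).1 < C := (hμ χ).eventually_lt_const (lt_add_one _)
  filter_upwards [h1, h2 (ε / 2) (by positivity), h3] with s hs1 hs2 hs3
  rw [Real.dist_eq] at hs2 ⊢
  have h4 : |pairing φ (μ s) (ν s) - ∫ x, partialIntegral φ ν₀ x ∂(μ s).1| ≤ ε / 2 := by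
    rw [pairing_eq, ← integral_sub (integrable_cc (partialIntegral φ (ν s)) (μ s))
      (integrable_cc (partialIntegral φ ν₀) (μ s))]
    refine abs_integral_le_integral_abs.trans ?_
    calc _ ≤ ∫ x, ε / (2 * C) * χ x ∂(μ s).1 := by
          refine integral_mono ((integrable_cc (partialIntegral φ (ν s)) (μ s)).sub
            (integrable_cc (partialIntegral φ ν₀) (μ s))).abs
            ((integrable_cc χ (μ s)).const_mul _) ?_
          exact hs1
      _ = ε / (2 * C) * ∫ x, χ x ∂(μ s).1 := integral_const_mul _ _
      _ ≤ ε / (2 * C) * C := by gcongr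
      _ = ε / 2 := by field_simp
  rw [← pairing_eq, ← pairing_eq] at hs2
  rw [← pairing_eq] at h4
  rw [abs_le] at h4
  rw [abs_lt] at hs2 ⊢
  constructor <;> linarith [h4.1, h4.2, hs2.1, hs2.2]

end Continuity

/-! ### Mutual energies and their polarised positivity -/

section Energy

variable {X : Type*} [TopologicalSpace X] [T2Space X] [LocallyCompactSpace X] [MeasurableSpace X]
  [BorelSpace X] {κ : X → X → EReal}

/-- `φ` is a minorant of the kernel `κ`. -/
def IsMinorant (κ : X → X → EReal) (φ : C_c(X × X, ℝ)) : Prop :=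
  ∀ p : X × X, ((φ p : ℝ) : EReal) ≤ κ p.1 p.2

/-- Minorants are directed upwards, so one of them can be almost optimal for several pairs of
measures at once. -/
theorem IsMinorant.sup {φ ψ : C_c(X × X, ℝ)} (hφ : IsMinorant κ φ) (hψ : IsMinorant κ ψ) :
    IsMinorant κ (φ ⊔ ψ) := fun p => by
  rw [CompactlySupportedContinuousMap.sup_apply, EReal.coe_strictMono.monotone.map_max]
  exact sup_le (hφ p) (hψ p)

/-- Excludes the value `⊥` for energies, and compensates for negative values of `κ`. On compact `X`
a constant works, because a lower semicontinuous function attains its minimum there. -/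
theorem IsKernel.exists_minorant (hκ : IsKernel κ) :
    ∃ φ : C_c(X × X, ℝ), IsMinorant κ φ ∧ ∀ p, φ p ≤ 0 := by
  by_cases hX : CompactSpace X
  · rcases isEmpty_or_nonempty X with hE | hE
    · exact ⟨0, fun p => (hE.false p.1).elim, fun p => le_rfl⟩
    · obtain ⟨p₀, -, hp₀⟩ := LowerSemicontinuousOn.exists_isMinOn (univ_nonempty (α := X × X))
        isCompact_univ (hκ.lsc.lowerSemicontinuousOn univ)
      have hc : ∃ c : ℝ, c ≤ 0 ∧ (c : EReal) ≤ κ p₀.1 p₀.2 := by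
        obtain ⟨c, hc⟩ := EReal.lt_iff_exists_real_btwn.1 (bot_lt_iff_ne_bot.2 (hκ.ne_bot p₀.1 p₀.2))
        exact ⟨min c 0, min_le_right _ _,
          (EReal.coe_le_coe_iff.2 (min_le_left _ _)).trans hc.2.le⟩
      obtain ⟨c, hc0, hc⟩ := hc
      exact ⟨⟨ContinuousMap.const _ c, HasCompactSupport.of_compactSpace _⟩,
        fun p => hc.trans (hp₀ (mem_univ p)), fun p => hc0⟩
  · exact ⟨0, fun p => by simpa using hκ.nonneg hX p.1 p.2, fun p => le_rfl⟩

namespace PosRadon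

theorem mutualEnergy_le_iff {μ ν : PosRadon X} {M : ℝ} :
    μ.mutualEnergy κ ν ≤ (M : EReal) ↔ ∀ φ, IsMinorant κ φ → pairing φ μ ν ≤ M := by
  unfold mutualEnergy
  rw [iSup₂_le_iff]
  exact forall₂_congr fun φ _ => EReal.coe_le_coe_iff

theorem le_mutualEnergy {φ : C_c(X × X, ℝ)} (hφ : IsMinorant κ φ) (μ ν : PosRadon X) :
    (pairing φ μ ν : EReal) ≤ μ.mutualEnergy κ ν :=
  le_iSup₂ (f := fun (φ : C_c(X × X, ℝ)) (_ : ∀ p : X × X, ((φ p : ℝ) : EReal) ≤ κ p.1 p.2) =>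
    ((∫ x, ∫ y, φ (x, y) ∂ν.1 ∂μ.1 : ℝ) : EReal)) φ hφ

theorem mutualEnergy_ne_bot (hκ : IsKernel κ) (μ ν : PosRadon X) : μ.mutualEnergy κ ν ≠ ⊥ := by
  obtain ⟨φ, hφ, -⟩ := hκ.exists_minorant
  exact ne_bot_of_le_ne_bot (EReal.coe_ne_bot _) (le_mutualEnergy hφ μ ν)

theorem exists_minorant_lt {μ ν : PosRadon X} {r : ℝ} (h : (r : EReal) < μ.mutualEnergy κ ν) :
    ∃ φ, IsMinorant κ φ ∧ r < pairing φ μ ν := by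
  unfold mutualEnergy at h
  obtain ⟨φ, h⟩ := lt_iSup_iff.1 h
  obtain ⟨hφ, h⟩ := lt_iSup_iff.1 h
  exact ⟨φ, hφ, EReal.coe_lt_coe_iff.1 h⟩

theorem mutualEnergy_eq_iff {μ ν : PosRadon X} {e : ℝ} :
    μ.mutualEnergy κ ν = (e : EReal) ↔ (∀ φ, IsMinorant κ φ → pairing φ μ ν ≤ e) ∧
      ∀ ε : ℝ, 0 < ε → ∃ φ, IsMinorant κ φ ∧ e - ε < pairing φ μ ν := by
  constructor
  · intro h
    refine ⟨mutualEnergy_le_iff.1 h.le, fun ε hε => exists_minorant_lt ?_⟩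
    rw [h]
    exact EReal.coe_lt_coe_iff.2 (sub_lt_self _ hε)
  · rintro ⟨h1, h2⟩
    refine le_antisymm (mutualEnergy_le_iff.2 h1) ?_
    refine EReal.ge_of_forall_gt_iff_ge.1 fun z hz => ?_
    rw [EReal.coe_lt_coe_iff] at hz
    obtain ⟨φ, hφ, h⟩ := h2 (e - z) (sub_pos.2 hz)
    rw [sub_sub_cancel] at h
    exact (EReal.coe_le_coe_iff.2 h.le).trans (le_mutualEnergy hφ μ ν)

/-- The real value of the mutual energy. -/
def energy (κ : X → X → EReal) (μ ν : PosRadon X) : ℝ := (μ.mutualEnergy κ ν).toReal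

theorem coe_energy (hκ : IsKernel κ) {μ ν : PosRadon X} (h : μ.mutualEnergy κ ν ≠ ⊤) :
    μ.mutualEnergy κ ν = (μ.energy κ ν : EReal) :=
  (EReal.coe_toReal h (mutualEnergy_ne_bot hκ μ ν)).symm

theorem energy_eq {μ ν : PosRadon X} {e : ℝ} (h : μ.mutualEnergy κ ν = e) :
    μ.energy κ ν = e := by
  rw [energy, h, EReal.toReal_coe]

theorem mutualEnergy_comm (hsym : ∀ x y, κ x y = κ y x) (μ ν : PosRadon X) :
    μ.mutualEnergy κ ν = ν.mutualEnergy κ μ := by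
  have key : ∀ μ ν : PosRadon X, μ.mutualEnergy κ ν ≤ ν.mutualEnergy κ μ := fun μ ν => by
    refine iSup₂_le fun φ hφ => ?_
    change (pairing φ μ ν : EReal) ≤ _
    rw [← pairing_swap]
    exact le_mutualEnergy (fun p => (hφ (p.2, p.1)).trans_eq (hsym _ _)) ν μ
  exact le_antisymm (key _ _) (key _ _)

theorem mutualEnergy_add_left {μ μ' ν : PosRadon X} {e e' : ℝ} (h : μ.mutualEnergy κ ν = e)
    (h' : μ'.mutualEnergy κ ν = e') : (μ + μ').mutualEnergy κ ν = ((e + e' : ℝ) : EReal) := by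
  rw [mutualEnergy_eq_iff] at h h' ⊢
  refine ⟨fun φ hφ => ?_, fun ε hε => ?_⟩
  · rw [pairing_add_left]
    exact add_le_add (h.1 φ hφ) (h'.1 φ hφ)
  · obtain ⟨φ, hφ, h1⟩ := h.2 (ε / 2) (half_pos hε)
    obtain ⟨ψ, hψ, h2⟩ := h'.2 (ε / 2) (half_pos hε)
    refine ⟨φ ⊔ ψ, hφ.sup hψ, ?_⟩
    rw [pairing_add_left]
    have h3 : pairing φ μ ν ≤ pairing (φ ⊔ ψ) μ ν := pairing_mono (fun p => le_sup_left) _ _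
    have h4 : pairing ψ μ' ν ≤ pairing (φ ⊔ ψ) μ' ν := pairing_mono (fun p => le_sup_right) _ _
    linarith

theorem mutualEnergy_zero_left (hκ : IsKernel κ) (ν : PosRadon X) :
    (0 : PosRadon X).mutualEnergy κ ν = ((0 : ℝ) : EReal) := by
  rw [mutualEnergy_eq_iff]
  obtain ⟨φ, hφ, -⟩ := hκ.exists_minorant
  exact ⟨fun φ _ => (pairing_zero_left φ ν).le, fun ε hε => ⟨φ, hφ, by
    rw [pairing_zero_left]; linarith⟩⟩

theorem mutualEnergy_zero_right (hκ : IsKernel κ) (ν : PosRadon X) :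
    ν.mutualEnergy κ 0 = ((0 : ℝ) : EReal) := by
  rw [mutualEnergy_eq_iff]
  obtain ⟨φ, hφ, -⟩ := hκ.exists_minorant
  exact ⟨fun φ _ => (pairing_zero_right φ ν).le, fun ε hε => ⟨φ, hφ, by
    rw [pairing_zero_right]; linarith⟩⟩

theorem mutualEnergy_smul_left (hκ : IsKernel κ) {μ ν : PosRadon X} {e : ℝ} (c : ℝ≥0)
    (h : μ.mutualEnergy κ ν = e) : (c • μ).mutualEnergy κ ν = ((c * e : ℝ) : EReal) := by
  rcases eq_or_ne c 0 with rfl | hc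
  · have : (0 : ℝ≥0) • μ = 0 := PosRadon.ext (by rw [smul_val, zero_smul, zero_val])
    rw [this, mutualEnergy_zero_left hκ, NNReal.coe_zero, zero_mul]
  have hc' : (0 : ℝ) < c := NNReal.coe_pos.2 (pos_iff_ne_zero.2 hc)
  rw [mutualEnergy_eq_iff] at h ⊢
  refine ⟨fun φ hφ => ?_, fun ε hε => ?_⟩
  · rw [pairing_smul_left]
    exact mul_le_mul_of_nonneg_left (h.1 φ hφ) hc'.le
  · obtain ⟨φ, hφ, h1⟩ := h.2 (ε / c) (by positivity)
    refine ⟨φ, hφ, ?_⟩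
    rw [pairing_smul_left]
    have := mul_lt_mul_of_pos_left h1 hc'
    rwa [mul_sub, mul_div_cancel₀ _ hc'.ne'] at this

theorem mutualEnergy_mono (h0 : ∀ x y, 0 ≤ κ x y) {μ μ' ν ν' : PosRadon X}
    (hμ : μ.1 ≤ μ'.1) (hν : ν.1 ≤ ν'.1) : μ.mutualEnergy κ ν ≤ μ'.mutualEnergy κ ν' := by
  refine iSup₂_le fun φ hφ => ?_
  have hm : IsMinorant κ (φ ⊔ 0) := IsMinorant.sup hφ fun p => by simpa using h0 p.1 p.2
  refine le_trans ?_ (le_mutualEnergy hm μ' ν')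
  exact EReal.coe_le_coe_iff.2 ((pairing_mono (fun p => le_sup_left) μ ν).trans
    (pairing_mono_measure (fun p => le_sup_right) hμ hν))

/-- If `κ` takes negative values, energies need not be monotone in the measures. Monotonicity is
applied instead to `φ ⊔ ψ - ψ ≥ 0` with `ψ ≤ 0` a fixed minorant, at the cost of a constant
independent of `φ`. -/
theorem mutualEnergy_ne_top_of_le (hκ : IsKernel κ) {μ μ' ν ν' : PosRadon X}
    (hμ : μ.1 ≤ μ'.1) (hν : ν.1 ≤ ν'.1) (h : μ'.mutualEnergy κ ν' ≠ ⊤) :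
    μ.mutualEnergy κ ν ≠ ⊤ := by
  obtain ⟨ψ, hψ, hψ0⟩ := hκ.exists_minorant
  refine ne_top_of_le_ne_top (EReal.coe_ne_top (μ'.energy κ ν' - pairing ψ μ' ν'))
    (mutualEnergy_le_iff.2 fun φ hφ => ?_)
  have h1 := mutualEnergy_le_iff.1 (coe_energy hκ h).le _ (hφ.sup hψ)
  have h2 : pairing φ μ ν ≤ pairing (φ ⊔ ψ) μ ν := pairing_mono (fun p => le_sup_left) μ ν
  have h3 : ∀ μ ν, pairing (φ ⊔ ψ) μ ν = pairing (φ ⊔ ψ - ψ) μ ν + pairing ψ μ ν := fun μ ν => by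
    rw [← pairing_add, sub_add_cancel]
  have h4 : pairing (φ ⊔ ψ - ψ) μ ν ≤ pairing (φ ⊔ ψ - ψ) μ' ν' :=
    pairing_mono_measure (fun p => by
      rw [CompactlySupportedContinuousMap.sub_apply, sub_nonneg]; exact le_sup_right) hμ hν
  have h5 : pairing ψ μ ν ≤ 0 := by
    rw [← pairing_zero μ ν]; exact pairing_mono hψ0 μ ν
  have h6 := h3 μ ν
  have h7 := h3 μ' ν'
  linarith

theorem toSigned_pos (ν : PosRadon X) : ν.toSigned.pos = ν := rfl

theorem toSigned_neg (ν : PosRadon X) : ν.toSigned.neg = 0 := rfl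

theorem mem_posFiniteEnergy_iff (hκ : IsKernel κ) {ν : PosRadon X} :
    ν ∈ posFiniteEnergy κ ↔ ν.mutualEnergy κ ν ≠ ⊤ := by
  have hP : ν.toSigned.energyPlus κ ν.toSigned = ν.mutualEnergy κ ν := by
    simp only [SignedRadon.energyPlus, toSigned_pos, toSigned_neg, mutualEnergy_zero_left hκ, EReal.coe_zero,
      add_zero]
  have hM : ν.toSigned.energyMinus κ ν.toSigned = 0 := by
    simp only [SignedRadon.energyMinus, toSigned_pos, toSigned_neg, mutualEnergy_zero_left hκ,
      mutualEnergy_zero_right hκ, EReal.coe_zero, add_zero]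
  simp only [posFiniteEnergy, mem_ofPred_eq, SignedRadon.FiniteEnergy, SignedRadon.EnergyDefined,
    SignedRadon.mutualEnergy, hP, hM, sub_zero, lt_top_iff_ne_top]
  exact ⟨fun h => h.2.2, fun h => ⟨fun h' => h h'.1,
    bot_lt_iff_ne_bot.2 (mutualEnergy_ne_bot hκ _ _), h⟩⟩

theorem coe_energy_self (hκ : IsKernel κ) {ν : PosRadon X} (h : ν ∈ posFiniteEnergy κ) :
    ν.mutualEnergy κ ν = (ν.energy κ ν : EReal) :=
  coe_energy hκ ((mem_posFiniteEnergy_iff hκ).1 h)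

/-- Polarised positivity for finite measures, by means of the Hahn decomposition. -/
theorem energy_add_energy_ge_of_isFiniteMeasure (hκ : IsKernel κ) (hpd : IsPositiveDefinite κ)
    {μ ν : PosRadon X} [IsFiniteMeasure μ.1] [IsFiniteMeasure ν.1]
    (hμ : μ ∈ posFiniteEnergy κ) (hν : ν ∈ posFiniteEnergy κ) :
    μ.mutualEnergy κ ν ≠ ⊤ ∧ 2 * μ.energy κ ν ≤ μ.energy κ μ + ν.energy κ ν := by
  rw [mem_posFiniteEnergy_iff hκ] at hμ hν
  have hsym := mutualEnergy_comm (X := X) hpd.1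
  -- Positivity is assumed only for mutually singular parts, so the common part `c` of `μ` and `ν`
  -- is removed: it is `ν` on `D` and `μ` off `D`. The remainders `p` and `n` are singular, and in
  -- the polarised inequality the contributions of `c` cancel.
  obtain ⟨D, hD, h1, h2⟩ := hahn_decomposition μ.1 ν.1
  have hle1 : ν.1.restrict D ≤ μ.1.restrict D := Measure.le_iff.2 fun t ht => by
    rw [Measure.restrict_apply ht, Measure.restrict_apply ht]
    exact h1 _ (ht.inter hD) inter_subset_right
  have hle2 : μ.1.restrict Dᶜ ≤ ν.1.restrict Dᶜ := Measure.le_iff.2 fun t ht => by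
    rw [Measure.restrict_apply ht, Measure.restrict_apply ht]
    exact h2 _ (ht.inter hD.compl) inter_subset_right
  have hp' : μ.1.restrict D - ν.1.restrict D ≤ μ.1.restrict D := Measure.sub_le
  have hn' : ν.1.restrict Dᶜ - μ.1.restrict Dᶜ ≤ ν.1.restrict Dᶜ := Measure.sub_le
  have hμD := Measure.restrict_add_restrict_compl (μ := μ.1) hD
  have hνD := Measure.restrict_add_restrict_compl (μ := ν.1) hD
  have hcμ : ν.1.restrict D + μ.1.restrict Dᶜ ≤ μ.1 := by
    conv_rhs => rw [← hμD]
    exact add_le_add hle1 le_rfl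
  have hcν : ν.1.restrict D + μ.1.restrict Dᶜ ≤ ν.1 := by
    conv_rhs => rw [← hνD]
    exact add_le_add le_rfl hle2
  have hpμ := hp'.trans Measure.restrict_le_self
  have hnν := hn'.trans Measure.restrict_le_self
  let p : PosRadon X := ⟨_, Measure.Regular.of_le hpμ⟩
  let n : PosRadon X := ⟨_, Measure.Regular.of_le hnν⟩
  let c : PosRadon X := ⟨_, Measure.Regular.of_le hcμ⟩
  have hμpc : μ = p + c := PosRadon.ext <| by
    rw [add_val]
    change μ.1 = (μ.1.restrict D - ν.1.restrict D) + (ν.1.restrict D + μ.1.restrict Dᶜ)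
    rw [← add_assoc, Measure.sub_add_cancel_of_le hle1, hμD]
  have hνnc : ν = n + c := PosRadon.ext <| by
    rw [add_val]
    change ν.1 = (ν.1.restrict Dᶜ - μ.1.restrict Dᶜ) + (ν.1.restrict D + μ.1.restrict Dᶜ)
    rw [add_comm (ν.1.restrict D), ← add_assoc, Measure.sub_add_cancel_of_le hle2, add_comm, hνD]
  have hsing : p.1 ⟂ₘ n.1 := by
    refine ⟨Dᶜ, hD.compl, ?_, ?_⟩
    · refine le_antisymm ((hp' _).trans_eq ?_) bot_le
      rw [Measure.restrict_apply hD.compl, compl_inter_self, measure_empty]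
    · refine le_antisymm ((hn' _).trans_eq ?_) bot_le
      rw [compl_compl, Measure.restrict_apply hD, inter_compl_self, measure_empty]
  let σ : SignedRadon X := ⟨p, n, fun K _ => ((hsing.restrict K).symm.restrict K).symm⟩
  have epp := coe_energy hκ (mutualEnergy_ne_top_of_le hκ (μ := p) (ν := p) hpμ hpμ hμ)
  have epc := coe_energy hκ (mutualEnergy_ne_top_of_le hκ (μ := p) (ν := c) hpμ hcμ hμ)
  have ecc := coe_energy hκ (mutualEnergy_ne_top_of_le hκ (μ := c) (ν := c) hcμ hcμ hμ)
  have enn := coe_energy hκ (mutualEnergy_ne_top_of_le hκ (μ := n) (ν := n) hnν hnν hν)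
  have enc := coe_energy hκ (mutualEnergy_ne_top_of_le hκ (μ := n) (ν := c) hnν hcν hν)
  have hplus : σ.energyPlus κ σ = ((p.energy κ p + n.energy κ n : ℝ) : EReal) := by
    change p.mutualEnergy κ p + n.mutualEnergy κ n = _
    rw [epp, enn, EReal.coe_add]
  have hdef : σ.EnergyDefined κ σ := fun h => by
    rw [hplus] at h
    exact EReal.coe_ne_top _ h.1
  have hpos := hpd.2 σ hdef
  have hminus : σ.energyMinus κ σ = p.mutualEnergy κ n + p.mutualEnergy κ n := by
    change p.mutualEnergy κ n + n.mutualEnergy κ p = _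
    rw [hsym n p]
  -- Were this term infinite, the energy of `σ` would be defined and equal to `-∞`.
  have hpn : p.mutualEnergy κ n ≠ ⊤ := fun h => by
    rw [SignedRadon.mutualEnergy, hminus, h, EReal.top_add_top, EReal.sub_top] at hpos
    exact absurd hpos (by simp)
  have epn := coe_energy hκ hpn
  rw [SignedRadon.mutualEnergy, hplus, hminus, epn, ← EReal.coe_add, ← EReal.coe_sub,
    ← EReal.coe_zero, EReal.coe_le_coe_iff] at hpos
  have ecp := (hsym c p).trans epc
  have enp := (hsym n p).trans epn
  have ecn := (hsym c n).trans enc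
  have add_right : ∀ {μ ν ν' : PosRadon X} {e e' : ℝ}, μ.mutualEnergy κ ν = e →
      μ.mutualEnergy κ ν' = e' → μ.mutualEnergy κ (ν + ν') = ((e + e' : ℝ) : EReal) := by
    intro μ ν ν' e e' h h'
    rw [hsym] at h h' ⊢
    exact mutualEnergy_add_left h h'
  have hμν : μ.mutualEnergy κ ν = ((p.energy κ n + p.energy κ c +
      (n.energy κ c + c.energy κ c) : ℝ) : EReal) := by
    rw [hμpc, hνnc]
    exact mutualEnergy_add_left (add_right epn epc) (add_right ecn ecc)
  have hμμ : μ.mutualEnergy κ μ = ((p.energy κ p + p.energy κ c +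
      (p.energy κ c + c.energy κ c) : ℝ) : EReal) := by
    rw [hμpc]
    exact mutualEnergy_add_left (add_right epp epc) (add_right ecp ecc)
  have hνν : ν.mutualEnergy κ ν = ((n.energy κ n + n.energy κ c +
      (n.energy κ c + c.energy κ c) : ℝ) : EReal) := by
    rw [hνnc]
    exact mutualEnergy_add_left (add_right enn enc) (add_right ecn ecc)
  refine ⟨by rw [hμν]; exact EReal.coe_ne_top _, ?_⟩
  rw [energy_eq hμν, energy_eq hμμ, energy_eq hνν]
  linarith

theorem restrict_le (μ : PosRadon X) {K : Set X} (hK : IsCompact K) :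
    (μ.restrict K hK).1 ≤ μ.1 := Measure.restrict_le_self

instance (μ : PosRadon X) {K : Set X} (hK : IsCompact K) : IsFiniteMeasure (μ.restrict K hK).1 :=
  ⟨by
    change μ.1.restrict K univ < ⊤
    rw [Measure.restrict_apply_univ]
    exact hK.measure_lt_top⟩

/-- Against a single minorant the measures may be cut down to a compact set, where the finite case
applies. In particular all mutual energies within `𝓔⁺` are finite. -/
theorem two_mul_mutualEnergy_le (hκ : IsKernel κ) (hpd : IsPositiveDefinite κ)
    {μ ν : PosRadon X} (hμ : μ ∈ posFiniteEnergy κ) (hν : ν ∈ posFiniteEnergy κ) :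
    μ.mutualEnergy κ ν ≤ (((μ.energy κ μ + ν.energy κ ν) / 2 : ℝ) : EReal) := by
  refine mutualEnergy_le_iff.2 fun φ hφ => ?_
  obtain ⟨L, hL, hφL, hmono⟩ : ∃ L : Set X, ∃ hL : IsCompact L,
      (∀ x y, φ (x, y) ≠ 0 → x ∈ L ∧ y ∈ L) ∧ ∀ μ ∈ posFiniteEnergy κ,
        (μ.restrict L hL).mutualEnergy κ (μ.restrict L hL) ≤ μ.mutualEnergy κ μ := by
    -- On compact `X` the kernel may be negative and restriction could raise the energy, but all
    -- measures are already finite. Otherwise `κ ≥ 0` and restriction lowers the energy.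
    by_cases hX : CompactSpace X
    · refine ⟨univ, isCompact_univ, fun _ _ _ => ⟨mem_univ _, mem_univ _⟩, fun μ _ => ?_⟩
      have : μ.restrict univ isCompact_univ = μ := PosRadon.ext Measure.restrict_univ
      rw [this]
    · obtain ⟨L, hL, hφL⟩ := exists_compact_support φ
      exact ⟨L, hL, hφL, fun μ _ => mutualEnergy_mono (hκ.nonneg hX) (μ.restrict_le hL)
        (μ.restrict_le hL)⟩
  have hmem : ∀ {μ : PosRadon X}, μ ∈ posFiniteEnergy κ → μ.restrict L hL ∈ posFiniteEnergy κ :=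
    fun {μ} hμ => (mem_posFiniteEnergy_iff hκ).2
      (ne_top_of_le_ne_top ((mem_posFiniteEnergy_iff hκ).1 hμ) (hmono μ hμ))
  have hle : ∀ {μ : PosRadon X}, μ ∈ posFiniteEnergy κ →
      (μ.restrict L hL).energy κ (μ.restrict L hL) ≤ μ.energy κ μ := fun {μ} hμ => by
    have := hmono μ hμ
    rwa [coe_energy_self hκ hμ, coe_energy_self hκ (hmem hμ), EReal.coe_le_coe_iff] at this
  obtain ⟨h1, h2⟩ := energy_add_energy_ge_of_isFiniteMeasure hκ hpd (hmem hμ) (hmem hν)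
  have h3 := mutualEnergy_le_iff.1 (coe_energy hκ h1).le φ hφ
  rw [pairing_restrict hL hφL] at h3
  linarith [hle hμ, hle hν]

section PositiveDefinite

variable (hκ : IsKernel κ) (hpd : IsPositiveDefinite κ)
include hκ hpd

theorem mutualEnergy_eq_energy {μ ν : PosRadon X} (hμ : μ ∈ posFiniteEnergy κ)
    (hν : ν ∈ posFiniteEnergy κ) : μ.mutualEnergy κ ν = (μ.energy κ ν : EReal) :=
  coe_energy hκ (ne_top_of_le_ne_top (EReal.coe_ne_top _)
    (two_mul_mutualEnergy_le hκ hpd hμ hν))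

theorem two_mul_energy_le {μ ν : PosRadon X} (hμ : μ ∈ posFiniteEnergy κ)
    (hν : ν ∈ posFiniteEnergy κ) : 2 * μ.energy κ ν ≤ μ.energy κ μ + ν.energy κ ν := by
  have := two_mul_mutualEnergy_le hκ hpd hμ hν
  rw [mutualEnergy_eq_energy hκ hpd hμ hν, EReal.coe_le_coe_iff] at this
  linarith

omit hκ in
theorem energy_comm (μ ν : PosRadon X) : μ.energy κ ν = ν.energy κ μ := by
  rw [energy, mutualEnergy_comm hpd.1, energy]

theorem energy_add_left {μ μ' ν : PosRadon X} (hμ : μ ∈ posFiniteEnergy κ)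
    (hμ' : μ' ∈ posFiniteEnergy κ) (hν : ν ∈ posFiniteEnergy κ) :
    (μ + μ').energy κ ν = μ.energy κ ν + μ'.energy κ ν :=
  energy_eq (mutualEnergy_add_left (mutualEnergy_eq_energy hκ hpd hμ hν)
    (mutualEnergy_eq_energy hκ hpd hμ' hν))

theorem energy_smul_left {μ ν : PosRadon X} (c : ℝ≥0) (hμ : μ ∈ posFiniteEnergy κ)
    (hν : ν ∈ posFiniteEnergy κ) : (c • μ).energy κ ν = c * μ.energy κ ν :=
  energy_eq (mutualEnergy_smul_left hκ c (mutualEnergy_eq_energy hκ hpd hμ hν))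

theorem add_mem {μ ν : PosRadon X} (hμ : μ ∈ posFiniteEnergy κ) (hν : ν ∈ posFiniteEnergy κ) :
    μ + ν ∈ posFiniteEnergy κ := by
  have hsym := mutualEnergy_comm (X := X) hpd.1
  have h : ∀ {ρ : PosRadon X}, ρ ∈ posFiniteEnergy κ →
      (μ + ν).mutualEnergy κ ρ = ((μ.energy κ ρ + ν.energy κ ρ : ℝ) : EReal) := fun {ρ} hρ =>
    mutualEnergy_add_left (mutualEnergy_eq_energy hκ hpd hμ hρ)
      (mutualEnergy_eq_energy hκ hpd hν hρ)
  rw [mem_posFiniteEnergy_iff hκ, mutualEnergy_add_left ((hsym _ _).trans (h hμ))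
    ((hsym _ _).trans (h hν))]
  exact EReal.coe_ne_top _

theorem smul_mem (c : ℝ≥0) {μ : PosRadon X} (hμ : μ ∈ posFiniteEnergy κ) :
    c • μ ∈ posFiniteEnergy κ := by
  rw [mem_posFiniteEnergy_iff hκ, mutualEnergy_smul_left hκ c ((mutualEnergy_comm hpd.1 _ _).trans
    (mutualEnergy_smul_left hκ c (coe_energy_self hκ hμ)))]
  exact EReal.coe_ne_top _

omit hpd in
theorem zero_mem : (0 : PosRadon X) ∈ posFiniteEnergy κ := by
  rw [mem_posFiniteEnergy_iff hκ, mutualEnergy_zero_left hκ]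
  exact EReal.coe_ne_top _

end PositiveDefinite

end PosRadon

end Energy

/-! ### Realisation of the energy space in a Hilbert space -/

/-- A symmetric positive semidefinite real kernel is the Gram kernel of a family of vectors in a
Hilbert space. -/
theorem exists_gram_representation {S : Type u} (B : S → S → ℝ) (hB : ∀ s t, B s t = B t s)
    (hpos : ∀ c : S →₀ ℝ, 0 ≤ c.sum fun s x => c.sum fun t y => x * y * B s t) :
    ∃ (H : Type u) (_ : NormedAddCommGroup H) (_ : InnerProductSpace ℝ H) (_ : CompleteSpace H)
      (J : S → H), ∀ s t, inner ℝ (J s) (J t) = B s t := by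
  -- Scalars become operators on `ℝ`, the form in which a reproducing kernel Hilbert space takes its
  -- kernel.
  let K : Matrix S S (ℝ →L[ℝ] ℝ) := fun s t => B s t • ContinuousLinearMap.id ℝ ℝ
  have hK : K.PosSemidef := by
    have htfae := (RKHS.posSemidef_tfae (K := K)).out 0 2
    refine htfae.2 ⟨?_, fun c => ?_⟩
    · ext s t
      have : K.conjTranspose s t = star (K t s) := rfl
      rw [this]
      have h1 : star (ContinuousLinearMap.id ℝ ℝ) = ContinuousLinearMap.id ℝ ℝ :=
        star_one (ℝ →L[ℝ] ℝ)
      simp [K, hB s t, h1]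
    · refine (hpos c).trans_eq ?_
      simp only [K, RCLike.re_to_real]
      refine Finsupp.sum_congr fun s _ => Finsupp.sum_congr fun t _ => ?_
      simp [hB s t]
      ring
  have : Fact K.PosSemidef := ⟨hK⟩
  refine ⟨RKHS.OfKernel K, inferInstance, inferInstance, inferInstance,
    fun s => RKHS.kerFun (RKHS.OfKernel K) s 1, fun s t => ?_⟩
  rw [← RKHS.kernel_inner, RKHS.OfKernel.kernel_ofKernel]
  simp [K, hB s t]

section Embedding

variable {X : Type u} [TopologicalSpace X] [T2Space X] [LocallyCompactSpace X] [MeasurableSpace X]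
  [BorelSpace X] {κ : X → X → EReal}

open PosRadon

/-- A realisation of the positive measures of finite energy as vectors of a Hilbert space. -/
structure EnergyEmbedding (κ : X → X → EReal) (H : Type*) [NormedAddCommGroup H]
    [InnerProductSpace ℝ H] where
  toFun : PosRadon X → H
  inner_eq : ∀ μ ∈ posFiniteEnergy κ, ∀ ν ∈ posFiniteEnergy κ,
    inner ℝ (toFun μ) (toFun ν) = μ.energy κ ν

/-- The Gram form must be nonnegative for arbitrary real coefficients. As `𝓔⁺` is a convex cone, a
finite combination acts as a difference `μ - ν` of two of its members, and the form equals `‖μ‖² +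
‖ν‖² - 2κ(μ, ν)`, nonnegative by `two_mul_energy_le`. -/
theorem exists_energyEmbedding (hκ : IsKernel κ) (hpd : IsPositiveDefinite κ) :
    ∃ (H : Type u) (_ : NormedAddCommGroup H) (_ : InnerProductSpace ℝ H) (_ : CompleteSpace H),
      Nonempty (EnergyEmbedding κ H) := by
  classical
  have key : ∀ c : posFiniteEnergy κ →₀ ℝ, ∃ μ ∈ posFiniteEnergy κ, ∃ ν ∈ posFiniteEnergy κ,
      ∀ ρ ∈ posFiniteEnergy κ,
        (c.sum fun s x => x * s.1.energy κ ρ) = μ.energy κ ρ - ν.energy κ ρ := by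
    intro c
    induction c using Finsupp.induction with
    | zero =>
      exact ⟨0, zero_mem hκ, 0, zero_mem hκ, fun ρ _ => by simp⟩
    | single_add s x c _ _ ih =>
      obtain ⟨μ, hμ, ν, hν, h⟩ := ih
      have hsum : ∀ ρ : PosRadon X, ((Finsupp.single s x + c).sum fun s x => x * s.1.energy κ ρ) =
          x * s.1.energy κ ρ + c.sum fun s x => x * s.1.energy κ ρ := fun ρ => by
        rw [Finsupp.sum_add_index' (by simp) (by intros; ring),
          Finsupp.sum_single_index (by simp)]
      rcases le_total 0 x with hx | hx
      · have hm := smul_mem hκ hpd x.toNNReal s.2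
        refine ⟨_, add_mem hκ hpd hm hμ, ν, hν, fun ρ hρ => ?_⟩
        rw [hsum, h ρ hρ, energy_add_left hκ hpd hm hμ hρ, energy_smul_left hκ hpd _ s.2 hρ,
          Real.coe_toNNReal x hx]
        ring
      · have hm := smul_mem hκ hpd (-x).toNNReal s.2
        refine ⟨μ, hμ, _, add_mem hκ hpd hm hν, fun ρ hρ => ?_⟩
        rw [hsum, h ρ hρ, energy_add_left hκ hpd hm hν hρ, energy_smul_left hκ hpd _ s.2 hρ,
          Real.coe_toNNReal _ (neg_nonneg.2 hx)]
        ring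
  obtain ⟨H, i1, i2, i3, J, hJ⟩ := exists_gram_representation
    (fun s t : posFiniteEnergy κ => s.1.energy κ t.1) (fun s t => energy_comm hpd s.1 t.1) (by
      intro c
      obtain ⟨μ, hμ, ν, hν, h⟩ := key c
      have h1 : ∀ ρ ∈ posFiniteEnergy κ,
          (c.sum fun s x => x * ρ.energy κ s.1) = μ.energy κ ρ - ν.energy κ ρ := fun ρ hρ => by
        rw [← h ρ hρ]
        exact Finsupp.sum_congr fun s _ => by rw [energy_comm hpd]
      have h2 : (c.sum fun s x => c.sum fun t y => x * y * s.1.energy κ t.1) =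
          (c.sum fun s x => x * μ.energy κ s.1) - c.sum fun s x => x * ν.energy κ s.1 := by
        rw [← Finsupp.sum_sub]
        refine Finsupp.sum_congr fun s _ => ?_
        rw [← mul_sub, ← h1 s.1 s.2, Finsupp.mul_sum]
        exact Finsupp.sum_congr fun t _ => by ring
      rw [h2, h1 μ hμ, h1 ν hν]
      have := two_mul_energy_le hκ hpd hμ hν
      rw [energy_comm hpd ν μ]
      linarith)
  -- Measures of infinite energy receive the default vector `0`, about which `inner_eq` says
  -- nothing.
  refine ⟨H, i1, i2, i3, ⟨⟨fun μ => if h : μ ∈ posFiniteEnergy κ then J ⟨μ, h⟩ else 0, ?_⟩⟩⟩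
  intro μ hμ ν hν
  rw [dif_pos hμ, dif_pos hν, hJ]

namespace EnergyEmbedding

variable {H : Type*} [NormedAddCommGroup H] [InnerProductSpace ℝ H] (T : EnergyEmbedding κ H)

theorem norm_sq_eq {μ : PosRadon X} (hμ : μ ∈ posFiniteEnergy κ) :
    ‖T.toFun μ‖ ^ 2 = μ.energy κ μ := by
  rw [← T.inner_eq μ hμ μ hμ, real_inner_self_eq_norm_sq]

variable (hκ : IsKernel κ) (hpd : IsPositiveDefinite κ)
include hκ hpd

/-- The seminorm of `𝓔` has become a norm in `H`, so it suffices that the difference of the two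
sides has norm zero, which is bilinearity of the energy. -/
theorem map_add {μ ν : PosRadon X} (hμ : μ ∈ posFiniteEnergy κ) (hν : ν ∈ posFiniteEnergy κ) :
    T.toFun (μ + ν) = T.toFun μ + T.toFun ν := by
  have h := add_mem hκ hpd hμ hν
  rw [← sub_eq_zero, ← inner_self_eq_zero (𝕜 := ℝ)]
  simp only [inner_sub_left, inner_sub_right, inner_add_left, inner_add_right,
    T.inner_eq _ h _ h, T.inner_eq _ hμ _ h, T.inner_eq _ hν _ h, T.inner_eq _ h _ hμ,
    T.inner_eq _ h _ hν, T.inner_eq _ hμ _ hμ, T.inner_eq _ hμ _ hν, T.inner_eq _ hν _ hμ,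
    T.inner_eq _ hν _ hν, energy_add_left hκ hpd hμ hν h, energy_comm hpd _ (μ + ν),
    energy_add_left hκ hpd hμ hν hμ, energy_add_left hκ hpd hμ hν hν]
  ring

theorem map_smul (c : ℝ≥0) {μ : PosRadon X} (hμ : μ ∈ posFiniteEnergy κ) :
    T.toFun (c • μ) = (c : ℝ) • T.toFun μ := by
  have h := smul_mem hκ hpd c hμ
  rw [← sub_eq_zero, ← inner_self_eq_zero (𝕜 := ℝ)]
  simp only [inner_sub_left, inner_sub_right, real_inner_smul_left, real_inner_smul_right,
    T.inner_eq _ h _ h, T.inner_eq _ hμ _ h, T.inner_eq _ h _ hμ, T.inner_eq _ hμ _ hμ,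
    energy_smul_left hκ hpd c hμ h, energy_comm hpd _ (c • μ), energy_smul_left hκ hpd c hμ hμ]
  ring

omit hpd in
theorem map_zero : T.toFun 0 = 0 := by
  have h := zero_mem hκ
  rw [← inner_self_eq_zero (𝕜 := ℝ), T.inner_eq _ h _ h]
  exact energy_eq (mutualEnergy_zero_left hκ 0)

/-- The vector of a signed measure. -/
def signed (ν : SignedRadon X) : H := T.toFun ν.pos - T.toFun ν.neg

end EnergyEmbedding

namespace SignedRadon

/-- If either part had infinite energy, `κ(ν, ν)` would be undefined or `⊤`. Conversely the mixed
terms are finite by polarised positivity. -/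
theorem finiteEnergy_iff (hκ : IsKernel κ) (hpd : IsPositiveDefinite κ) {ν : SignedRadon X} :
    ν.FiniteEnergy κ ↔ ν.pos ∈ posFiniteEnergy κ ∧ ν.neg ∈ posFiniteEnergy κ := by
  constructor
  · rintro ⟨h1, h2, h3⟩
    have hne : ν.energyPlus κ ν ≠ ⊤ := fun h => by
      have hm : ν.energyMinus κ ν ≠ ⊤ := fun h' => h1 ⟨h, h'⟩
      rw [mutualEnergy, h, EReal.top_sub hm] at h3
      exact lt_irrefl _ h3
    rw [mem_posFiniteEnergy_iff hκ, mem_posFiniteEnergy_iff hκ]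
    constructor
    · intro h
      exact hne (by rw [energyPlus, h, EReal.top_add_of_ne_bot (mutualEnergy_ne_bot hκ _ _)])
    · intro h
      exact hne (by rw [energyPlus, h, EReal.add_top_of_ne_bot (mutualEnergy_ne_bot hκ _ _)])
  · rintro ⟨hp, hn⟩
    obtain ⟨r, hP⟩ : ∃ r : ℝ, ν.energyPlus κ ν = r := ⟨_, by
      rw [energyPlus, coe_energy_self hκ hp, coe_energy_self hκ hn, ← EReal.coe_add]⟩
    obtain ⟨r', hM⟩ : ∃ r : ℝ, ν.energyMinus κ ν = r := ⟨_, by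
      rw [energyMinus, mutualEnergy_eq_energy hκ hpd hp hn, mutualEnergy_eq_energy hκ hpd hn hp,
        ← EReal.coe_add]⟩
    refine ⟨fun h => EReal.coe_ne_top _ (hP.symm.trans h.1), ?_, ?_⟩
    · rw [mutualEnergy, hP, hM, ← EReal.coe_sub]
      exact EReal.bot_lt_coe _
    · rw [mutualEnergy, hP, hM, ← EReal.coe_sub]
      exact EReal.coe_lt_top _

variable {H : Type*} [NormedAddCommGroup H] [InnerProductSpace ℝ H] (T : EnergyEmbedding κ H)
  (hκ : IsKernel κ) (hpd : IsPositiveDefinite κ)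
include hκ hpd

theorem mutualEnergy_eq_inner {μ ν : SignedRadon X} (hμ : μ.FiniteEnergy κ)
    (hν : ν.FiniteEnergy κ) :
    μ.mutualEnergy κ ν = ((inner ℝ (T.signed μ) (T.signed ν) : ℝ) : EReal) := by
  rw [finiteEnergy_iff hκ hpd] at hμ hν
  rw [mutualEnergy, energyPlus, energyMinus, mutualEnergy_eq_energy hκ hpd hμ.1 hν.1,
    mutualEnergy_eq_energy hκ hpd hμ.1 hν.2, mutualEnergy_eq_energy hκ hpd hμ.2 hν.1,
    mutualEnergy_eq_energy hκ hpd hμ.2 hν.2, ← EReal.coe_add, ← EReal.coe_add, ← EReal.coe_sub,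
    EReal.coe_eq_coe_iff, EnergyEmbedding.signed, EnergyEmbedding.signed, inner_sub_left,
    inner_sub_right, inner_sub_right, T.inner_eq _ hμ.1 _ hν.1, T.inner_eq _ hμ.1 _ hν.2,
    T.inner_eq _ hμ.2 _ hν.1, T.inner_eq _ hμ.2 _ hν.2]
  ring

theorem mutualEnergy_self_eq {μ : SignedRadon X} (hμ : μ.FiniteEnergy κ) :
    μ.mutualEnergy κ μ = ((‖T.signed μ‖ ^ 2 : ℝ) : EReal) := by
  rw [mutualEnergy_eq_inner T hκ hpd hμ hμ, real_inner_self_eq_norm_sq]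

theorem distSq_eq {μ ν : SignedRadon X} (hμ : μ.FiniteEnergy κ) (hν : ν.FiniteEnergy κ) :
    distSq κ μ ν = ((‖T.signed μ - T.signed ν‖ ^ 2 : ℝ) : EReal) := by
  rw [distSq, mutualEnergy_eq_inner T hκ hpd hμ hμ, mutualEnergy_eq_inner T hκ hpd hν hν,
    mutualEnergy_eq_inner T hκ hpd hμ hν, mutualEnergy_eq_inner T hκ hpd hν hμ, ← EReal.coe_add,
    ← EReal.coe_add, ← EReal.coe_sub, EReal.coe_eq_coe_iff, ← real_inner_self_eq_norm_sq,
    inner_sub_left, inner_sub_right, inner_sub_right]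
  ring

end SignedRadon

theorem EnergyEmbedding.signed_toSigned {H : Type*} [NormedAddCommGroup H]
    [InnerProductSpace ℝ H] (T : EnergyEmbedding κ H) (hκ : IsKernel κ) (ν : PosRadon X) :
    T.signed ν.toSigned = T.toFun ν := by
  rw [signed, toSigned_pos, toSigned_neg, T.map_zero hκ, sub_zero]

end Embedding

/-! ### Vague compactness -/

section VagueCompactness

variable {X : Type*} [TopologicalSpace X] [T2Space X] [LocallyCompactSpace X] [MeasurableSpace X]
  [BorelSpace X]

theorem Ultrafilter.exists_tendsto_of_eventually_abs_le {α : Type*} (U : Ultrafilter α) {f : α → ℝ}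
    {C : ℝ} (h : ∀ᶠ s in U, |f s| ≤ C) : ∃ l, |l| ≤ C ∧ Tendsto f U (𝓝 l) := by
  have hmem : Icc (-C) C ∈ U.map f := h.mono fun s hs => abs_le.1 hs
  obtain ⟨l, hl, hUl⟩ := isCompact_Icc.ultrafilter_le_nhds (U.map f) (le_principal_iff.2 hmem)
  exact ⟨l, abs_le.2 hl, hUl⟩

/-- Vaguely bounded families of Radon measures are relatively compact. -/
theorem PosRadon.exists_tendsto_ultrafilter {α : Type*} (U : Ultrafilter α) {ν : α → PosRadon X}
    (h : ∀ φ : C_c(X, ℝ), ∃ C, ∀ᶠ s in U, |∫ x, φ x ∂(ν s).1| ≤ C) :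
    ∃ ν₀ : PosRadon X, Tendsto ν U (𝓝 ν₀) := by
  have h' : ∀ φ : C_c(X, ℝ), ∃ l, Tendsto (fun s => ∫ x, φ x ∂(ν s).1) U (𝓝 l) := fun φ => by
    obtain ⟨C, hC⟩ := h φ
    obtain ⟨l, -, hl⟩ := U.exists_tendsto_of_eventually_abs_le hC
    exact ⟨l, hl⟩
  choose Λ hΛ using h'
  -- The limits along the ultrafilter form a positive linear functional, which the Riesz theorem
  -- represents by a Radon measure.
  let Λ' : C_c(X, ℝ) →ₗ[ℝ] ℝ :=
    { toFun := Λ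
      map_add' := fun φ ψ => by
        refine tendsto_nhds_unique (hΛ (φ + ψ)) (((hΛ φ).add (hΛ ψ)).congr fun s => ?_)
        exact (integral_add (integrable_cc φ (ν s)) (integrable_cc ψ (ν s))).symm
      map_smul' := fun c φ => by
        refine tendsto_nhds_unique (hΛ (c • φ)) (((hΛ φ).const_mul c).congr fun s => ?_)
        exact (integral_const_mul c _).symm }
  let L : C_c(X, ℝ) →ₚ[ℝ] ℝ := PositiveLinearMap.mk₀ Λ' fun φ hφ =>
    ge_of_tendsto' (hΛ φ) fun s => integral_nonneg hφ
  refine ⟨⟨RealRMK.rieszMeasure L, inferInstance⟩, PosRadon.tendsto_iff.2 fun φ => ?_⟩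
  change Tendsto _ _ (𝓝 (∫ x, φ x ∂(RealRMK.rieszMeasure L)))
  rw [RealRMK.integral_rieszMeasure]
  exact hΛ φ

theorem PosRadon.measure_eq_zero_of_tendsto {α : Type*} {F : Filter α} [F.NeBot]
    {ν : α → PosRadon X} {ν₀ : PosRadon X} (h : Tendsto ν F (𝓝 ν₀)) {V : Set X} (hV : IsOpen V)
    (hν : ∀ᶠ s in F, (ν s).1 V = 0) : ν₀.1 V = 0 := by
  rw [hV.measure_eq_iSup_isCompact]
  simp only [ENNReal.iSup_eq_zero]
  intro K hKV hK
  obtain ⟨χ, hχ1, hχ0, -, hχV⟩ := exists_cutoff hK hV hKV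
  have h0 : ∫ x, χ x ∂ν₀.1 = 0 := by
    refine tendsto_nhds_unique (PosRadon.tendsto_iff.1 h χ) (tendsto_const_nhds.congr' ?_)
    filter_upwards [hν] with s hs
    refine (integral_eq_zero_of_ae ?_).symm
    filter_upwards [measure_eq_zero_iff_ae_notMem.1 hs] with x hx
    exact image_eq_zero_of_notMem_tsupport fun h => hx (hχV h)
  rw [integral_eq_zero_iff_of_nonneg hχ0 (integrable_cc χ ν₀)] at h0
  refine measure_mono_null ?_ h0
  intro x hx hx0
  have := hχ1 x hx
  rw [hx0] at this
  exact zero_ne_one this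

/-- A bound for `∫ g dν` with `g > 0` continuous bounds all the integrals of functions in `C_c`. -/
theorem PosRadon.exists_abs_integral_le (g : C(X, ℝ)) (hg : ∀ x, 0 < g x) (a : ℝ)
    (φ : C_c(X, ℝ)) : ∃ C : ℝ, ∀ ν : PosRadon X,
      ∫⁻ x, ENNReal.ofReal (g x) ∂ν.1 ≤ ENNReal.ofReal a → |∫ x, φ x ∂ν.1| ≤ C := by
  obtain ⟨B, hB⟩ : ∃ B : ℝ, ∀ x, |φ x| ≤ B * g x := by
    have hcont : Continuous fun x => |φ x| / g x := by
      refine φ.continuous.abs.div g.continuous fun x => (hg x).ne'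
    have hsupp : HasCompactSupport fun x => |φ x| / g x := by
      refine HasCompactSupport.intro φ.hasCompactSupport.isCompact fun x hx => ?_
      rw [image_eq_zero_of_notMem_tsupport hx, abs_zero, zero_div]
    obtain ⟨B, hB⟩ := hcont.bounded_above_of_compact_support hsupp
    refine ⟨B, fun x => ?_⟩
    have := (Real.norm_eq_abs _ ▸ (le_abs_self _)).trans (hB x)
    rwa [div_le_iff₀ (hg x)] at this
  refine ⟨max B 0 * max a 0, fun ν hν => ?_⟩
  have hmeas : Measurable fun x => ENNReal.ofReal (g x) := g.continuous.measurable.ennreal_ofReal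
  have h1 : ∫⁻ x, ENNReal.ofReal |φ x| ∂ν.1 ≤ ENNReal.ofReal (max B 0 * max a 0) := by
    calc ∫⁻ x, ENNReal.ofReal |φ x| ∂ν.1
        ≤ ∫⁻ x, ENNReal.ofReal (max B 0) * ENNReal.ofReal (g x) ∂ν.1 := by
          refine lintegral_mono fun x => ?_
          rw [← ENNReal.ofReal_mul (le_max_right _ _)]
          exact ENNReal.ofReal_le_ofReal ((hB x).trans
            (mul_le_mul_of_nonneg_right (le_max_left _ _) (hg x).le))
      _ = ENNReal.ofReal (max B 0) * ∫⁻ x, ENNReal.ofReal (g x) ∂ν.1 :=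
          lintegral_const_mul _ hmeas
      _ ≤ ENNReal.ofReal (max B 0) * ENNReal.ofReal (max a 0) := by
          gcongr
          exact hν.trans (ENNReal.ofReal_le_ofReal (le_max_left _ _))
      _ = _ := (ENNReal.ofReal_mul (le_max_right _ _)).symm
  refine abs_integral_le_integral_abs.trans ?_
  rw [integral_eq_lintegral_of_nonneg_ae (.of_forall fun x => abs_nonneg _)
    (integrable_cc φ ν).abs.aestronglyMeasurable]
  exact ENNReal.toReal_le_of_le_ofReal (by positivity) h1

end VagueCompactness

/-! ### Weak limits in Hilbert space and Mazur's lemma -/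

section WeakLimits

variable {H : Type*} [NormedAddCommGroup H] [InnerProductSpace ℝ H] [CompleteSpace H]

/-- Bounded families in a Hilbert space have weak limits along ultrafilters. -/
theorem Ultrafilter.exists_weak_limit {α : Type*} (U : Ultrafilter α) {v : α → H} {M : ℝ}
    (h : ∀ᶠ s in U, ‖v s‖ ≤ M) :
    ∃ w : H, ∀ x : H, Tendsto (fun s => inner ℝ (v s) x) U (𝓝 (inner ℝ w x)) := by
  have h' : ∀ x : H, ∃ l, |l| ≤ M * ‖x‖ ∧ Tendsto (fun s => inner ℝ (v s) x) U (𝓝 l) := fun x => by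
    refine U.exists_tendsto_of_eventually_abs_le ?_
    filter_upwards [h] with s hs
    exact (abs_real_inner_le_norm _ _).trans (mul_le_mul_of_nonneg_right hs (norm_nonneg x))
  choose l hl hlt using h'
  let f : H →ₗ[ℝ] ℝ :=
    { toFun := l
      map_add' := fun x y => tendsto_nhds_unique (hlt (x + y))
        (((hlt x).add (hlt y)).congr fun s => (inner_add_right _ _ _).symm)
      map_smul' := fun c x => tendsto_nhds_unique (hlt (c • x))
        (((hlt x).const_mul c).congr fun s => (real_inner_smul_right _ _ _).symm) }
  let f' : StrongDual ℝ H := f.mkContinuous M hl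
  refine ⟨(InnerProductSpace.toDual ℝ H).symm f', fun x => ?_⟩
  rw [InnerProductSpace.toDual_symm_apply]
  exact hlt x

/-- Weak limits of a convex set belong to its strong closure. -/
theorem mem_closure_of_weak_limit {α : Type*} {F : Filter α} [F.NeBot] {v : α → H} {w : H}
    (h : ∀ x : H, Tendsto (fun s => inner ℝ (v s) x) F (𝓝 (inner ℝ w x))) {C : Set H}
    (hC : Convex ℝ C) (hv : ∀ᶠ s in F, v s ∈ C) : w ∈ closure C := by
  by_contra hw
  obtain ⟨f, r, hr, hC'⟩ := geometric_hahn_banach_point_closed hC.closure isClosed_closure hw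
  have hf : ∀ x, f x = inner ℝ x ((InnerProductSpace.toDual ℝ H).symm f) := fun x => by
    rw [real_inner_comm, InnerProductSpace.toDual_symm_apply]
  have : r ≤ f w := by
    rw [hf]
    refine ge_of_tendsto (h _) ?_
    filter_upwards [hv] with s hs
    rw [← hf]
    exact (hC' _ (subset_closure hs)).le
  exact absurd hr (not_lt.2 this)

end WeakLimits

/-! ### Consistency: vague limits are weak limits -/

section Consistency

variable {X : Type u} [TopologicalSpace X] [T2Space X] [LocallyCompactSpace X] [MeasurableSpace X]
  [BorelSpace X] {κ : X → X → EReal}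

open PosRadon

/-- Lower semicontinuity of the energy. -/
theorem PosRadon.mutualEnergy_le_of_tendsto {α : Type*} {F : Filter α} [F.NeBot]
    {ν : α → PosRadon X} {ν₀ : PosRadon X} (h : Tendsto ν F (𝓝 ν₀)) {M : ℝ}
    (hM : ∀ᶠ s in F, (ν s).mutualEnergy κ (ν s) ≤ (M : EReal)) :
    ν₀.mutualEnergy κ ν₀ ≤ (M : EReal) := by
  rw [mutualEnergy_le_iff]
  intro φ hφ
  refine le_of_tendsto (tendsto_pairing h h φ) ?_
  filter_upwards [hM] with s hs
  exact mutualEnergy_le_iff.1 hs φ hφ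

theorem EnergyEmbedding.convex_image {H : Type*} [NormedAddCommGroup H] [InnerProductSpace ℝ H]
    (T : EnergyEmbedding κ H) (hκ : IsKernel κ) (hpd : IsPositiveDefinite κ)
    {N : Set (PosRadon X)} (hN : N ⊆ posFiniteEnergy κ)
    (hconv : ∀ μ ∈ N, ∀ ν ∈ N, ∀ a b : ℝ≥0, a + b = 1 → a • μ + b • ν ∈ N) :
    Convex ℝ (T.toFun '' N) := by
  rintro _ ⟨μ, hμ, rfl⟩ _ ⟨ν, hν, rfl⟩ a b ha hb hab
  refine ⟨a.toNNReal • μ + b.toNNReal • ν, hconv μ hμ ν hν _ _ ?_, ?_⟩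
  · rw [← Real.toNNReal_add ha hb, hab, Real.toNNReal_one]
  · rw [T.map_add hκ hpd (smul_mem hκ hpd _ (hN hμ)) (smul_mem hκ hpd _ (hN hν)),
      T.map_smul hκ hpd _ (hN hμ), T.map_smul hκ hpd _ (hN hν), Real.coe_toNNReal a ha,
      Real.coe_toNNReal b hb]

/-- The vague topology has convex neighbourhood bases. -/
theorem PosRadon.exists_convex_nhds {ν₀ : PosRadon X} {W : Set (PosRadon X)} (hW : W ∈ 𝓝 ν₀) :
    ∃ V ∈ 𝓝 ν₀, V ⊆ W ∧ ∀ μ ∈ V, ∀ ν ∈ V, ∀ a b : ℝ≥0, a + b = 1 → a • μ + b • ν ∈ V := by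
  rw [nhds_induced, mem_comap] at hW
  obtain ⟨V, hV, hVW⟩ := hW
  obtain ⟨C, ⟨hC, hCc⟩, hCV⟩ := (LocallyConvexSpace.convex_basis (𝕜 := ℝ)
    (fun φ : C_c(X, ℝ) => ∫ x, φ x ∂ν₀.1)).mem_iff.1 hV
  refine ⟨(fun (ν : PosRadon X) (φ : C_c(X, ℝ)) => ∫ x, φ x ∂ν.1) ⁻¹' C, ?_,
    (preimage_mono hCV).trans hVW, ?_⟩
  · rw [nhds_induced]
    exact preimage_mem_comap hC
  · intro μ hμ ν hν a b hab
    have := hCc hμ hν a.coe_nonneg b.coe_nonneg (by exact_mod_cast hab)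
    rw [mem_preimage]
    convert this using 1
    ext φ
    rw [integral_cc_add, integral_cc_smul, integral_cc_smul]
    rfl

/-- For a consistent kernel, strongly bounded and vaguely convergent families in `𝓔⁺` converge
weakly in the completion to the vague limit. -/
theorem EnergyEmbedding.tendsto_inner_of_tendsto {H : Type*} [NormedAddCommGroup H]
    [InnerProductSpace ℝ H] [CompleteSpace H] (T : EnergyEmbedding κ H) (hκ : IsKernel κ)
    (hpd : IsPositiveDefinite κ) (hcons : IsConsistent κ) {α : Type*} (U : Ultrafilter α)
    {ν : α → PosRadon X} {ν₀ : PosRadon X} (hν : Tendsto ν U (𝓝 ν₀)) {M : ℝ}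
    (hM : ∀ᶠ s in U, (ν s).mutualEnergy κ (ν s) ≤ (M : EReal)) :
    ν₀ ∈ posFiniteEnergy κ ∧
      ∀ x : H, Tendsto (fun s => inner ℝ (T.toFun (ν s)) x) U (𝓝 (inner ℝ (T.toFun ν₀) x)) := by
  have hν₀ : ν₀ ∈ posFiniteEnergy κ := (mem_posFiniteEnergy_iff hκ).2
    (ne_top_of_le_ne_top (EReal.coe_ne_top M) (mutualEnergy_le_of_tendsto hν hM))
  have hfin : ∀ᶠ s in U, ν s ∈ posFiniteEnergy κ := by
    filter_upwards [hM] with s hs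
    exact (mem_posFiniteEnergy_iff hκ).2 (ne_top_of_le_ne_top (EReal.coe_ne_top M) hs)
  refine ⟨hν₀, ?_⟩
  have hbound : ∀ᶠ s in U, ‖T.toFun (ν s)‖ ≤ √M := by
    filter_upwards [hM, hfin] with s hs hs'
    refine Real.le_sqrt_of_sq_le ?_
    rwa [T.norm_sq_eq hs', ← EReal.coe_le_coe_iff, ← coe_energy_self hκ hs']
  obtain ⟨w, hw⟩ := U.exists_weak_limit hbound
  suffices h : w = T.toFun ν₀ by rwa [h] at hw
  -- Mazur's lemma in convex vague neighbourhoods of `ν₀`: some measures are at once vaguely close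
  -- to `ν₀` and strongly close to the weak limit `w`.
  have happrox : ∀ W ∈ 𝓝 ν₀, ∀ ε : ℝ, 0 < ε →
      ∃ ρ ∈ W, ρ ∈ posFiniteEnergy κ ∧ dist (T.toFun ρ) w < ε := by
    intro W hW ε hε
    obtain ⟨V, hV, hVW, hVc⟩ := exists_convex_nhds hW
    have hc := T.convex_image hκ hpd (N := V ∩ posFiniteEnergy κ) inter_subset_right
      fun μ hμ ν hν a b hab => ⟨hVc μ hμ.1 ν hν.1 a b hab,
        add_mem hκ hpd (smul_mem hκ hpd a hμ.2) (smul_mem hκ hpd b hν.2)⟩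
    have hcl := mem_closure_of_weak_limit hw hc (by
      filter_upwards [hν hV, hfin] with s hs hs'
      exact ⟨ν s, ⟨hs, hs'⟩, rfl⟩)
    obtain ⟨_, ⟨ρ, hρ, rfl⟩, hd⟩ := Metric.mem_closure_iff.1 hcl ε hε
    exact ⟨ρ, hVW hρ.1, hρ.2, by rwa [dist_comm]⟩
  rcases hcons with hC1 | hC2
  -- Under `ConsistencyC1`: `G` joins vague neighbourhoods of `ν₀` with strong neighbourhoods of
  -- `w`, and is proper by `happrox`. It is strongly Cauchy and converges vaguely to `ν₀`, so its
  -- strong limit `w` must be the vector of `ν₀`.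
  · let G : Filter (PosRadon X) := 𝓝 ν₀ ⊓ (𝓟 (posFiniteEnergy κ) ⊓ comap T.toFun (𝓝 w))
    have hG : G.NeBot := by
      rw [inf_neBot_iff]
      intro W hW S hS
      rw [mem_inf_iff_superset] at hS
      obtain ⟨S₁, hS₁, S₂, hS₂, hS⟩ := hS
      obtain ⟨B, hB, hBS⟩ := mem_comap.1 hS₂
      obtain ⟨ε, hε, hεB⟩ := Metric.mem_nhds_iff.1 hB
      obtain ⟨ρ, h1, h2, h3⟩ := happrox W hW ε hε
      exact ⟨ρ, h1, hS ⟨hS₁ h2, hBS (hεB h3)⟩⟩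
    have hGfin : posFiniteEnergy κ ∈ G := mem_inf_of_right (mem_inf_of_left (mem_principal_self _))
    have hGw : Tendsto T.toFun G (𝓝 w) :=
      tendsto_comap.mono_left (inf_le_right.trans inf_le_right)
    have hmem : ∀ {ρ : PosRadon X}, ρ ∈ posFiniteEnergy κ → ρ.toSigned.FiniteEnergy κ :=
      fun {ρ} hρ => hρ
    have hcauchy : ∀ ε : ℝ, 0 < ε → ∃ S ∈ G, ∀ ν ∈ S, ∀ ν' ∈ S,
        SignedRadon.distSq κ ν.toSigned ν'.toSigned < (ε : EReal) := by
      intro ε hε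
      have hδ : 0 < √ε / 2 := by positivity
      refine ⟨_, inter_mem hGfin (hGw (Metric.ball_mem_nhds w hδ)), ?_⟩
      rintro ρ ⟨hρ, hρw⟩ ρ' ⟨hρ', hρw'⟩
      rw [SignedRadon.distSq_eq T hκ hpd (hmem hρ) (hmem hρ'), T.signed_toSigned hκ,
        T.signed_toSigned hκ, EReal.coe_lt_coe_iff]
      have h1 : dist (T.toFun ρ) w < √ε / 2 := hρw
      have h2 : dist (T.toFun ρ') w < √ε / 2 := hρw'
      have h3 : ‖T.toFun ρ - T.toFun ρ'‖ < √ε := by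
        rw [← dist_eq_norm]
        linarith [dist_triangle_right (T.toFun ρ) (T.toFun ρ') w]
      calc ‖T.toFun ρ - T.toFun ρ'‖ ^ 2 < √ε ^ 2 := by gcongr
        _ = ε := Real.sq_sqrt hε.le
    have hlim := hC1 G hG hGfin hcauchy ν₀ hν₀ (ClusterPt.of_le_nhds inf_le_left)
    have hlim' : Tendsto (fun ρ => ((‖T.toFun ρ - T.toFun ν₀‖ ^ 2 : ℝ) : EReal)) G
        (𝓝 ((0 : ℝ) : EReal)) := by
      rw [EReal.coe_zero]
      refine hlim.congr' ?_
      filter_upwards [hGfin] with ρ hρ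
      rw [SignedRadon.distSq_eq T hκ hpd (hmem hρ) (hmem hν₀), T.signed_toSigned hκ,
        T.signed_toSigned hκ]
    rw [EReal.tendsto_coe] at hlim'
    have := tendsto_nhds_unique hlim' ((hGw.sub_const (T.toFun ν₀)).norm.pow 2)
    rw [← sub_eq_zero, ← norm_eq_zero]
    exact pow_eq_zero_iff two_ne_zero |>.1 this.symm
  -- Under `ConsistencyC2`: `w - T.toFun ν₀` is orthogonal to the vectors of all measures in `𝓔⁺`.
  -- Since `w` lies in their strong closure, the difference is orthogonal to itself.
  · have horth : ∀ ρ ∈ posFiniteEnergy κ, inner ℝ (w - T.toFun ν₀) (T.toFun ρ) = 0 := by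
      intro ρ hρ
      have hF : posFiniteEnergy κ ∈ map ν U := hfin
      have h1 := hC2 (map ν U) inferInstance hF ⟨M, by
        rw [eventually_map]
        filter_upwards [hM, hfin] with s hs hs'
        rwa [SignedRadon.mutualEnergy_self_eq T hκ hpd hs', T.signed_toSigned hκ,
          T.norm_sq_eq hs', ← coe_energy_self hκ hs']⟩ ν₀ hν₀ hν ρ.toSigned hρ
      rw [SignedRadon.mutualEnergy_eq_inner T hκ hpd hν₀ hρ, tendsto_map'_iff] at h1
      have h2 : Tendsto (fun s => ((inner ℝ (T.toFun (ν s)) (T.toFun ρ) : ℝ) : EReal)) U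
          (𝓝 ((inner ℝ (T.toFun ν₀) (T.toFun ρ) : ℝ) : EReal)) := by
        rw [T.signed_toSigned hκ, T.signed_toSigned hκ] at h1
        refine h1.congr' ?_
        filter_upwards [hfin] with s hs
        rw [Function.comp_apply, SignedRadon.mutualEnergy_eq_inner T hκ hpd hs hρ,
          T.signed_toSigned hκ, T.signed_toSigned hκ]
      rw [EReal.tendsto_coe] at h2
      rw [inner_sub_left, tendsto_nhds_unique (hw _) h2, sub_self]
    have hw0 : inner ℝ (w - T.toFun ν₀) w = 0 := by
      have hcl : IsClosed {x : H | inner ℝ (w - T.toFun ν₀) x = 0} :=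
        isClosed_eq (by fun_prop) continuous_const
      have hmem : w ∈ closure {x : H | inner ℝ (w - T.toFun ν₀) x = 0} := by
        rw [Metric.mem_closure_iff]
        intro ε hε
        obtain ⟨ρ, -, hρ, hd⟩ := happrox univ univ_mem ε hε
        exact ⟨T.toFun ρ, horth ρ hρ, by rwa [dist_comm]⟩
      rwa [hcl.closure_eq] at hmem
    rw [← sub_eq_zero, ← inner_self_eq_zero (𝕜 := ℝ)]
    rw [inner_sub_right, hw0, horth ν₀ hν₀, sub_zero]

end Consistency

/-! ### Exhaustion by compact sets -/

section Exhaustion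

variable {X : Type*} [TopologicalSpace X] [T2Space X] [MeasurableSpace X] [BorelSpace X]

/-- A Radon measure which is `σ`-finite is concentrated on a `σ`-compact set. -/
theorem PosRadon.exists_compact_exhaustion (μ : PosRadon X) {S : ℕ → Set X}
    (hS : ∀ n, MeasurableSet (S n)) (hfin : ∀ n, μ.1 (S n) ≠ ⊤) (hnull : μ.1 (⋃ n, S n)ᶜ = 0) :
    ∃ K : ℕ → Set X, (∀ n, IsCompact (K n)) ∧ Monotone K ∧ (∀ n, K n ⊆ ⋃ m, S m) ∧
      μ.1 (⋃ n, K n)ᶜ = 0 := by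
  -- For the pair `(n, k)`: a compact part of `S n` that misses measure less than `1 / (k + 1)`.
  have h : ∀ p : ℕ × ℕ, ∃ K ⊆ S p.1, IsCompact K ∧ μ.1 (S p.1 \ K) < ((p.2 : ℝ≥0∞) + 1)⁻¹ :=
    fun p => (hS p.1).exists_isCompact_sdiff_lt (hfin p.1) (by simp)
  choose K hKS hK hKμ using h
  let e : ℕ ≃ ℕ × ℕ := (Denumerable.eqv (ℕ × ℕ)).symm
  refine ⟨accumulate fun n => K (e n), fun n => isCompact_accumulate (fun n => hK (e n)) n,
    monotone_accumulate, fun n => ?_, ?_⟩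
  · exact iUnion₂_subset fun m _ => (hKS (e m)).trans (subset_iUnion S (e m).1)
  · rw [iUnion_accumulate]
    have hsub : (⋃ n, K (e n))ᶜ ⊆ (⋃ n, S n)ᶜ ∪ ⋃ n, S n \ ⋃ m, K (n, m) := by
      intro x hx
      by_cases hxS : x ∈ ⋃ n, S n
      · obtain ⟨n, hn⟩ := mem_iUnion.1 hxS
        refine Or.inr (mem_iUnion.2 ⟨n, hn, fun hxK => hx ?_⟩)
        obtain ⟨m, hm⟩ := mem_iUnion.1 hxK
        exact mem_iUnion.2 ⟨e.symm (n, m), by rwa [Equiv.apply_symm_apply]⟩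
      · exact Or.inl hxS
    refine measure_mono_null hsub (measure_union_null hnull (measure_iUnion_null fun n => ?_))
    have hle : ∀ m : ℕ, μ.1 (S n \ ⋃ m, K (n, m)) ≤ ((m : ℝ≥0∞) + 1)⁻¹ := fun m =>
      (measure_mono (sdiff_subset_sdiff_right (subset_iUnion (fun m => K (n, m)) m))).trans
        (hKμ (n, m)).le
    have h1 : Tendsto (fun m : ℕ => ((m + 1 : ℕ) : ℝ≥0∞)⁻¹) atTop (𝓝 0) :=
      ENNReal.tendsto_inv_nat_nhds_zero.comp (tendsto_add_atTop_nat 1)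
    exact le_antisymm (ge_of_tendsto' h1 fun m => (hle m).trans_eq (by push_cast; rfl)) bot_le

theorem lintegral_eq_iSup_of_exhaustion {μ : Measure X} {K : ℕ → Set X}
    (hmono : Monotone K) (hnull : μ (⋃ n, K n)ᶜ = 0) (F : X → ℝ≥0∞) :
    ∫⁻ x, F x ∂μ = ⨆ n, ∫⁻ x in K n, F x ∂μ := by
  rw [← setLIntegral_iUnion_of_directed F hmono.directed_le]
  have : μ.restrict (⋃ n, K n) = μ := Measure.restrict_eq_self_of_ae_mem
    (by rw [ae_iff]; exact hnull)
  rw [this]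

/-- Exhaustion by compact sets of the measure `g μ` for `g > 0` with `∫ g dμ < ∞`. -/
theorem PosRadon.exists_compact_lt_lintegral (μ : PosRadon X) (g : C(X, ℝ)) (hg : ∀ x, 0 < g x)
    (hfin : ∫⁻ x, ENNReal.ofReal (g x) ∂μ.1 ≠ ⊤) {c : ℝ≥0∞}
    (hc : c < ∫⁻ x, ENNReal.ofReal (g x) ∂μ.1) :
    ∃ K, IsCompact K ∧ c < ∫⁻ x in K, ENNReal.ofReal (g x) ∂μ.1 := by
  have hmeas : Measurable fun x => ENNReal.ofReal (g x) := g.continuous.measurable.ennreal_ofReal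
  have hpos : ∀ n : ℕ, (0 : ℝ≥0∞) < ((n : ℝ≥0∞) + 1)⁻¹ := fun n => by simp
  -- A regular measure need not be inner regular on sets of infinite measure. The superlevel sets of
  -- `g > 0` have finite measure by Markov's inequality and cover `X`, so `μ` is carried by a
  -- `σ`-compact set.
  have hU : (⋃ n : ℕ, {x | ((n : ℝ≥0∞) + 1)⁻¹ ≤ ENNReal.ofReal (g x)}) = univ := by
    refine eq_univ_of_forall fun x => ?_
    obtain ⟨n, hn⟩ := ENNReal.exists_inv_nat_lt (ENNReal.ofReal_pos.2 (hg x)).ne'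
    exact mem_iUnion.2 ⟨n, (ENNReal.inv_le_inv.2 le_self_add).trans hn.le⟩
  obtain ⟨K, hK, hmono, -, hnull⟩ := μ.exists_compact_exhaustion
    (S := fun n => {x | ((n : ℝ≥0∞) + 1)⁻¹ ≤ ENNReal.ofReal (g x)})
    (fun n => measurableSet_le measurable_const hmeas)
    (fun n => (meas_ge_le_lintegral_div hmeas.aemeasurable (hpos n).ne' (by simp)).trans_lt
      (ENNReal.div_lt_top hfin (hpos n).ne') |>.ne)
    (by rw [hU, compl_univ, measure_empty])
  rw [lintegral_eq_iSup_of_exhaustion hmono hnull, lt_iSup_iff] at hc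
  obtain ⟨n, hn⟩ := hc
  exact ⟨K n, hK n, hn⟩

end Exhaustion

/-! ### Finite capacity and tightness -/

section Capacity

variable {X : Type u} [TopologicalSpace X] [T2Space X] [LocallyCompactSpace X] [MeasurableSpace X]
  [BorelSpace X] {κ : X → X → EReal}

open PosRadon

/-- Measures of finite capacity sets: probability measures on their compact subsets have energy
bounded away from zero. -/
theorem inv_ofReal_energy_le_interiorCapacity (hκ : IsKernel κ) {E L : Set X} (hL : IsCompact L)
    (hLE : L ⊆ E) {τ : PosRadon X} (hτ : τ ∈ posFiniteEnergy κ) (hτL : τ.1 Lᶜ = 0)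
    (hτ1 : τ.1 univ = 1) : (ENNReal.ofReal (τ.energy κ τ))⁻¹ ≤ interiorCapacity κ E := by
  refine le_trans ?_ (le_iSup₂ (f := fun (K : Set X) (_ : IsCompact K ∧ K ⊆ E) =>
    (⨅ (ν : PosRadon X) (_ : ν.1 Kᶜ = 0 ∧ ν.1 univ = 1), ν.mutualEnergy κ ν).toENNReal⁻¹)
    L ⟨hL, hLE⟩)
  rw [ENNReal.inv_le_inv, ← EReal.real_coe_toENNReal, ← coe_energy_self hκ hτ]
  exact EReal.toENNReal_le_toENNReal (iInf₂_le (f := fun (ν : PosRadon X)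
    (_ : ν.1 Lᶜ = 0 ∧ ν.1 univ = 1) => ν.mutualEnergy κ ν) τ ⟨hτL, hτ1⟩)

theorem restrict_mem (hκ : IsKernel κ) {μ : PosRadon X}
    (hμ : μ ∈ posFiniteEnergy κ) {L : Set X} (hL : IsCompact L) :
    μ.restrict L hL ∈ posFiniteEnergy κ :=
  (mem_posFiniteEnergy_iff hκ).2 (mutualEnergy_ne_top_of_le hκ (μ.restrict_le hL)
    (μ.restrict_le hL) ((mem_posFiniteEnergy_iff hκ).1 hμ))

/-- Normalised restriction of a measure of finite energy to a compact set. -/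
theorem exists_normalized_restriction (hκ : IsKernel κ) (hpd : IsPositiveDefinite κ)
    (h0 : ∀ x y, 0 ≤ κ x y) {μ : PosRadon X} (hμ : μ ∈ posFiniteEnergy κ) {L : Set X}
    (hL : IsCompact L) (hμL : μ.1 L ≠ 0) :
    ∃ τ ∈ posFiniteEnergy κ, τ.1 Lᶜ = 0 ∧ τ.1 univ = 1 ∧
      τ.energy κ τ ≤ ((μ.1 L).toReal⁻¹) ^ 2 * μ.energy κ μ := by
  have hfin : μ.1 L ≠ ⊤ := hL.measure_ne_top
  have hr := restrict_mem hκ hμ hL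
  set c : ℝ≥0 := (μ.1 L).toNNReal⁻¹
  have hc : (c : ℝ) = (μ.1 L).toReal⁻¹ := rfl
  have hm := smul_mem hκ hpd c hr
  have hval : (c • μ.restrict L hL).1 = c • μ.1.restrict L := rfl
  refine ⟨c • μ.restrict L hL, hm, ?_, ?_, ?_⟩
  · rw [hval, Measure.smul_apply, Measure.restrict_apply hL.measurableSet.compl,
      compl_inter_self, measure_empty, smul_zero]
  · rw [hval, Measure.smul_apply, Measure.restrict_apply_univ, ENNReal.smul_def, smul_eq_mul,
      ENNReal.coe_inv (ENNReal.toNNReal_ne_zero.2 ⟨hμL, hfin⟩), ENNReal.coe_toNNReal hfin,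
      ENNReal.inv_mul_cancel hμL hfin]
  · rw [energy_smul_left hκ hpd c hr hm, energy_comm hpd, energy_smul_left hκ hpd c hr hr,
      ← mul_assoc, ← hc, ← sq]
    have := mutualEnergy_mono h0 (μ.restrict_le hL) (μ.restrict_le hL)
    rw [coe_energy_self hκ hμ, coe_energy_self hκ hr, EReal.coe_le_coe_iff] at this
    gcongr

/-- Measures of finite energy do not charge compact sets of capacity zero. -/
theorem measure_eq_zero_of_interiorCapacity_eq_zero (hκ : IsKernel κ) (hpd : IsPositiveDefinite κ)
    (h0 : ∀ x y, 0 ≤ κ x y) {μ : PosRadon X} (hμ : μ ∈ posFiniteEnergy κ) {E L : Set X}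
    (hE : interiorCapacity κ E = 0) (hL : IsCompact L) (hLE : L ⊆ E) : μ.1 L = 0 := by
  by_contra hμL
  obtain ⟨τ, hτ, hτL, hτ1, -⟩ := exists_normalized_restriction hκ hpd h0 hμ hL hμL
  have := inv_ofReal_energy_le_interiorCapacity hκ hL hLE hτ hτL hτ1
  rw [hE, nonpos_iff_eq_zero, ENNReal.inv_eq_zero] at this
  exact ENNReal.ofReal_ne_top this

/-- On a set of finite capacity, bounded families in `𝓔⁺` are uniformly tight. -/
theorem exists_compact_measure_compl_le (hκ : IsKernel κ) (hpd : IsPositiveDefinite κ)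
    (hcons : IsConsistent κ) (h0 : ∀ x y, 0 ≤ κ x y) {E : Set X} (hE : IsClosed E)
    (hcap : interiorCapacity κ E < ⊤) (M : ℝ) {δ : ℝ≥0∞} (hδ : δ ≠ 0) :
    ∃ K, IsCompact K ∧ ∀ μ ∈ posFiniteEnergy κ, μ.1 Eᶜ = 0 → μ.energy κ μ ≤ M →
      μ.1 Kᶜ ≤ δ := by
  -- If tightness fails, every compact `K` has a measure of energy at most `M` with mass above `δ`
  -- off `K`. Normalising its restriction to a compact subset of `E` outside `K` gives probability
  -- measures `τ K` with an energy bound independent of `K`.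
  by_contra! hcon
  obtain ⟨H, i1, i2, i3, ⟨T⟩⟩ := exists_energyEmbedding hκ hpd
  have hex : ∀ K : TopologicalSpace.Compacts X, ∃ τ ∈ posFiniteEnergy κ, ∃ L, IsCompact L ∧
      L ⊆ E ∧ Disjoint L (K : Set X) ∧ τ.1 Lᶜ = 0 ∧ τ.1 univ = 1 ∧
        τ.energy κ τ ≤ (δ.toReal⁻¹) ^ 2 * max M 0 := by
    intro K
    obtain ⟨μ, hμ, hμE, hμM, hμK⟩ := hcon K K.isCompact
    obtain ⟨L, hLK, hL, hμL⟩ := K.isCompact.isClosed.isOpen_compl.exists_lt_isCompact hμK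
    have hLE : μ.1 (L ∩ E) = μ.1 L := measure_inter_conull hμE
    have hμL' : μ.1 (L ∩ E) ≠ 0 := by
      rw [hLE]
      exact (bot_le.trans_lt hμL).ne'
    obtain ⟨τ, hτ, hτL, hτ1, hτe⟩ :=
      exists_normalized_restriction hκ hpd h0 hμ (hL.inter_right hE) hμL'
    refine ⟨τ, hτ, L ∩ E, hL.inter_right hE, inter_subset_right,
      (disjoint_left.2 fun x hx hxK => hLK hx.1 hxK), hτL, hτ1, hτe.trans ?_⟩
    have hδL : δ.toReal ≤ (μ.1 (L ∩ E)).toReal := by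
      rw [hLE]
      exact ENNReal.toReal_mono hL.measure_ne_top hμL.le
    have hδ0 : 0 < δ.toReal := ENNReal.toReal_pos hδ (hμL.trans_le le_top).ne
    gcongr
    · rw [← T.norm_sq_eq hμ]
      positivity
    · exact hμM.trans (le_max_left _ _)
  choose τ hτ L hL hLE hLK hτL hτ1 hτe using hex
  -- `τ K` does not charge `K`, which eventually contains the support of any given test function.
  have hvague : Tendsto τ atTop (𝓝 0) := by
    rw [PosRadon.tendsto_iff]
    intro φ
    rw [zero_val, integral_zero_measure]
    refine tendsto_const_nhds.congr' ?_
    filter_upwards [eventually_ge_atTop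
      (⟨tsupport φ, φ.hasCompactSupport⟩ : TopologicalSpace.Compacts X)] with K hK
    refine (integral_eq_zero_of_ae ?_).symm
    filter_upwards [measure_eq_zero_iff_ae_notMem.1 (hτL K)] with x hx
    rw [notMem_compl_iff] at hx
    exact image_eq_zero_of_notMem_tsupport fun h => disjoint_left.1 (hLK K) hx (hK h)
  let U : Ultrafilter (TopologicalSpace.Compacts X) := Ultrafilter.of atTop
  obtain ⟨-, hweak⟩ := T.tendsto_inner_of_tendsto hκ hpd hcons U
    (hvague.mono_left (Ultrafilter.of_le atTop)) (M := (δ.toReal⁻¹) ^ 2 * max M 0)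
    (.of_forall fun K => by
      rw [coe_energy_self hκ (hτ K)]
      exact EReal.coe_le_coe_iff.2 (hτe K))
  -- Consistency turns vague convergence to `0` into weak convergence. As `N` is convex, `0` is even
  -- a strong limit of probability measures on compact subsets of `E`.
  let N : Set (PosRadon X) := {ρ | ρ ∈ posFiniteEnergy κ ∧ ρ.1 univ = 1 ∧
    ∃ L, IsCompact L ∧ L ⊆ E ∧ ρ.1 Lᶜ = 0}
  have hNc : Convex ℝ (T.toFun '' N) := by
    refine T.convex_image hκ hpd (fun ρ hρ => hρ.1) ?_
    rintro ρ ⟨h1, h2, A, hA, hAE, h3⟩ ρ' ⟨h1', h2', A', hA', hAE', h3'⟩ a b hab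
    refine ⟨add_mem hκ hpd (smul_mem hκ hpd a h1) (smul_mem hκ hpd b h1'), ?_, A ∪ A',
      hA.union hA', union_subset hAE hAE', ?_⟩
    · rw [add_val, smul_val, smul_val, Measure.add_apply, Measure.smul_apply, Measure.smul_apply,
        h2, h2', ENNReal.smul_def, ENNReal.smul_def, smul_eq_mul, smul_eq_mul, mul_one, mul_one,
        ← ENNReal.coe_add, hab, ENNReal.coe_one]
    · rw [add_val, smul_val, smul_val, Measure.add_apply, Measure.smul_apply, Measure.smul_apply,
        measure_mono_null (compl_subset_compl.2 subset_union_left) h3,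
        measure_mono_null (compl_subset_compl.2 subset_union_right) h3', smul_zero, smul_zero,
        add_zero]
  have hcl := mem_closure_of_weak_limit hweak hNc
    (.of_forall fun K => ⟨τ K, ⟨hτ K, hτ1 K, L K, hL K, hLE K, hτL K⟩, rfl⟩)
  rw [T.map_zero hκ] at hcl
  -- A probability measure on a compact subset of `E` with energy at most `r ^ 2` would push the
  -- capacity above its value.
  obtain ⟨r, hr0, hr⟩ : ∃ r : ℝ, 0 < r ∧ interiorCapacity κ E < (ENNReal.ofReal (r ^ 2))⁻¹ := by
    have h1 : 0 < (interiorCapacity κ E)⁻¹ := ENNReal.inv_pos.2 hcap.ne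
    obtain ⟨q, hq0, hq⟩ := ENNReal.lt_iff_exists_nnreal_btwn.1 h1
    refine ⟨√q, Real.sqrt_pos.2 (by exact_mod_cast hq0), ?_⟩
    rw [Real.sq_sqrt q.coe_nonneg, ENNReal.ofReal_coe_nnreal]
    exact ENNReal.lt_inv_iff_lt_inv.2 hq
  obtain ⟨_, ⟨ρ, ⟨hρ, hρ1, A, hA, hAE, hρA⟩, rfl⟩, hd⟩ := Metric.mem_closure_iff.1 hcl r hr0
  rw [dist_zero_left] at hd
  have h1 := inv_ofReal_energy_le_interiorCapacity hκ hA hAE hρ hρA hρ1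
  have h2 : ρ.energy κ ρ ≤ r ^ 2 := by
    rw [← T.norm_sq_eq hρ]
    gcongr
  exact absurd (h1.trans_lt hr) (not_lt.2 (ENNReal.inv_le_inv.2 (ENNReal.ofReal_le_ofReal h2)))

end Capacity

/-! ### Potentials and uniform integrability -/

section Potential

variable {X : Type u} [TopologicalSpace X] [T2Space X] [LocallyCompactSpace X] [MeasurableSpace X]
  [BorelSpace X] {κ : X → X → EReal}

open PosRadon

theorem le_potential {φ : C_c(X, ℝ)} {x : X} (hφ : ∀ y, ((φ y : ℝ) : EReal) ≤ κ x y)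
    (ω : PosRadon X) : ((∫ y, φ y ∂ω.1 : ℝ) : EReal) ≤ ω.potential κ x :=
  le_iSup₂ (f := fun (φ : C_c(X, ℝ)) (_ : ∀ y, ((φ y : ℝ) : EReal) ≤ κ x y) =>
    ((∫ y, φ y ∂ω.1 : ℝ) : EReal)) φ hφ

/-- The potential at `x` only sees minorants of `κ(x, ·)`, whereas the energy needs minorants on `X
× X`. Lowering `φ` by a small `δ` and cutting it at `0` gives a minorant of `κ(x', ·)` for all `x'`
near `x`, by lower semicontinuity and compactness; a cutoff `u` in the first variable then yields
`Φ`. -/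
theorem exists_minorant_of_lt_potential (hκ : IsKernel κ) (h0 : ∀ x y, 0 ≤ κ x y)
    {ω : PosRadon X} {x : X} {r : ℝ} (hr : (r : EReal) < ω.potential κ x) :
    ∃ Φ : C_c(X × X, ℝ), IsMinorant κ Φ ∧ (∀ p, 0 ≤ Φ p) ∧ r < partialIntegral Φ ω x := by
  obtain ⟨φ, hr⟩ := lt_iSup_iff.1 hr
  obtain ⟨hφ, hr⟩ := lt_iSup_iff.1 hr
  rw [EReal.coe_lt_coe_iff] at hr
  obtain ⟨χ, hχ1, hχ0, -, -⟩ := exists_cutoff φ.hasCompactSupport.isCompact isOpen_univ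
    (subset_univ (tsupport φ))
  set m := ∫ y, χ y ∂ω.1
  have hm : 0 ≤ m := integral_nonneg hχ0
  obtain ⟨δ, hδ, hδm⟩ : ∃ δ : ℝ, 0 < δ ∧ δ * m < ∫ y, φ y ∂ω.1 - r := by
    have h1 : 0 < ∫ y, φ y ∂ω.1 - r := sub_pos.2 hr
    refine ⟨(∫ y, φ y ∂ω.1 - r) / (m + 1), by positivity, ?_⟩
    rw [div_mul_eq_mul_div, div_lt_iff₀ (by positivity)]
    nlinarith
  let ψ : C_c(X, ℝ) :=
    { toFun := fun y => max (φ y - δ) 0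
      continuous_toFun := by fun_prop
      hasCompactSupport' := by
        refine HasCompactSupport.intro φ.hasCompactSupport.isCompact fun y hy => ?_
        rw [image_eq_zero_of_notMem_tsupport hy, zero_sub, max_eq_right (neg_nonpos.2 hδ.le)] }
  have hψ : ∀ y, ψ y = max (φ y - δ) 0 := fun y => rfl
  have hlocal : ∀ᶠ x' in 𝓝 x, ∀ y, ((ψ y : ℝ) : EReal) ≤ κ x' y := by
    have h := φ.hasCompactSupport.isCompact.eventually_forall_of_forall_eventually (x₀ := x)
      (P := fun x' y => ((φ y - δ : ℝ) : EReal) ≤ κ x' y) (fun y _ => by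
        have h1 : ((φ y - δ / 2 : ℝ) : EReal) < κ x y :=
          lt_of_lt_of_le (EReal.coe_lt_coe_iff.2 (by linarith)) (hφ y)
        have h2 : ∀ᶠ z : X × X in 𝓝 (x, y), φ z.2 - δ < φ y - δ / 2 := by
          have hc : Continuous fun z : X × X => φ z.2 - δ := by fun_prop
          exact (hc.tendsto (x, y)).eventually_lt_const (by simp only; linarith)
        filter_upwards [hκ.lsc (x, y) _ h1, h2] with z hz1 hz2
        exact (EReal.coe_le_coe_iff.2 hz2.le).trans hz1.le)
    filter_upwards [h] with x' hx' y
    rw [hψ]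
    by_cases hy : y ∈ tsupport φ
    · rw [EReal.coe_strictMono.monotone.map_max]
      exact max_le (hx' y hy) (h0 x' y)
    · rw [image_eq_zero_of_notMem_tsupport hy, zero_sub, max_eq_right (neg_nonpos.2 hδ.le)]
      exact h0 x' y
  obtain ⟨V, hV, hVo, hxV⟩ := eventually_nhds_iff.1 hlocal
  obtain ⟨u, hu1, hu0, hule, huV⟩ := exists_cutoff isCompact_singleton hVo (singleton_subset_iff.2 hxV)
  let Φ : C_c(X × X, ℝ) :=
    { toFun := fun p => u p.1 * ψ p.2
      continuous_toFun := by fun_prop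
      hasCompactSupport' := by
        refine HasCompactSupport.intro (u.hasCompactSupport.isCompact.prod
          ψ.hasCompactSupport.isCompact) fun p hp => ?_
        by_contra hne
        exact hp ⟨subset_tsupport _ (left_ne_zero_of_mul hne),
          subset_tsupport _ (right_ne_zero_of_mul hne)⟩ }
  have hΦ : ∀ p, Φ p = u p.1 * ψ p.2 := fun p => rfl
  have hψ0 : ∀ y, 0 ≤ ψ y := fun y => le_max_right _ _
  refine ⟨Φ, fun p => ?_, fun p => mul_nonneg (hu0 _) (hψ0 _), ?_⟩
  · rw [hΦ]
    by_cases hp : p.1 ∈ V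
    · refine le_trans (EReal.coe_le_coe_iff.2 ?_) (hV p.1 hp p.2)
      exact mul_le_of_le_one_left (hψ0 _) (hule _)
    · rw [image_eq_zero_of_notMem_tsupport fun h => hp (huV h), zero_mul]
      exact h0 _ _
  · have h1 : partialIntegral Φ ω x = ∫ y, ψ y ∂ω.1 := by
      rw [partialIntegral_apply]
      refine integral_congr_ae (.of_forall fun y => ?_)
      simp only [hΦ]
      rw [hu1 x rfl, one_mul]
    have h2 : ∫ y, φ y ∂ω.1 - δ * m ≤ ∫ y, ψ y ∂ω.1 := by
      rw [← integral_const_mul, ← integral_sub (integrable_cc φ ω)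
        ((integrable_cc χ ω).const_mul δ)]
      refine integral_mono ((integrable_cc φ ω).sub ((integrable_cc χ ω).const_mul δ))
        (integrable_cc ψ ω) fun y => ?_
      simp only [hψ]
      by_cases hy : y ∈ tsupport φ
      · rw [hχ1 y hy, mul_one]
        exact le_max_left _ _
      · rw [image_eq_zero_of_notMem_tsupport hy, zero_sub]
        exact le_max_of_le_right (neg_nonpos.2 (mul_nonneg hδ.le (hχ0 y)))
    rw [h1]
    linarith

theorem lowerSemicontinuous_potential (hκ : IsKernel κ) (h0 : ∀ x y, 0 ≤ κ x y) (ω : PosRadon X) :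
    LowerSemicontinuous fun x => ω.potential κ x := by
  intro x c hc
  obtain ⟨r, hcr, hr⟩ := EReal.lt_iff_exists_real_btwn.1 hc
  obtain ⟨Φ, hΦ, -, hΦr⟩ := exists_minorant_of_lt_potential hκ h0 hr
  filter_upwards [(partialIntegral Φ ω).continuous.continuousAt.eventually_const_lt hΦr] with x' hx'
  exact hcr.trans ((EReal.coe_lt_coe_iff.2 hx').trans_le
    (le_potential (φ := sliceLeft Φ x') (fun y => hΦ (x', y)) ω))

/-- A Dini-type argument: minorants good near a point are glued over `K` by finite suprema. -/
theorem exists_minorant_on_compact (hκ : IsKernel κ) (h0 : ∀ x y, 0 ≤ κ x y) {ω : PosRadon X}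
    {f : X → ℝ} (hf : Continuous f) {K : Set X} (hK : IsCompact K)
    (hfK : ∀ x ∈ K, (f x : EReal) ≤ ω.potential κ x) {ε : ℝ} (hε : 0 < ε) :
    ∃ Φ : C_c(X × X, ℝ), IsMinorant κ Φ ∧ (∀ p, 0 ≤ Φ p) ∧
      ∀ x ∈ K, f x - ε < partialIntegral Φ ω x := by
  have hnhds : ∀ x ∈ K, ∃ Φ : C_c(X × X, ℝ), IsMinorant κ Φ ∧ (∀ p, 0 ≤ Φ p) ∧
      ∀ᶠ x' in 𝓝 x, f x' - ε < partialIntegral Φ ω x' := by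
    intro x hx
    have hlt : ((f x - ε / 2 : ℝ) : EReal) < ω.potential κ x :=
      (EReal.coe_lt_coe_iff.2 (by linarith)).trans_le (hfK x hx)
    obtain ⟨Φ, hΦ, hΦ0, hΦx⟩ := exists_minorant_of_lt_potential hκ h0 hlt
    refine ⟨Φ, hΦ, hΦ0, ?_⟩
    have hc : Continuous fun x' => partialIntegral Φ ω x' - f x' :=
      (partialIntegral Φ ω).continuous.sub hf
    filter_upwards [(hc.tendsto x).eventually_const_lt (u := -ε) (by linarith)] with x' hx'
    linarith
  refine hK.induction_on (p := fun K => ∃ Φ : C_c(X × X, ℝ), IsMinorant κ Φ ∧ (∀ p, 0 ≤ Φ p) ∧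
      ∀ x ∈ K, f x - ε < partialIntegral Φ ω x) ?_ ?_ ?_ ?_
  · exact ⟨0, fun p => by simpa using h0 p.1 p.2, fun p => le_rfl, fun x hx => hx.elim⟩
  · rintro s t hst ⟨Φ, h1, h2, h3⟩
    exact ⟨Φ, h1, h2, fun x hx => h3 x (hst hx)⟩
  · rintro s t ⟨Φ, h1, h2, h3⟩ ⟨Ψ, h1', h2', h3'⟩
    have hle : ∀ {φ ψ : C_c(X × X, ℝ)}, (∀ p, φ p ≤ ψ p) → ∀ x,
        partialIntegral φ ω x ≤ partialIntegral ψ ω x := fun {φ ψ} h x =>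
      integral_mono (integrable_cc (sliceLeft φ x) ω) (integrable_cc (sliceLeft ψ x) ω)
        fun y => h (x, y)
    refine ⟨Φ ⊔ Ψ, h1.sup h1', fun p => (h2 p).trans le_sup_left, ?_⟩
    rintro x (hx | hx)
    · exact (h3 x hx).trans_le (hle (fun p => le_sup_left) x)
    · exact (h3' x hx).trans_le (hle (fun p => le_sup_right) x)
  · intro x hx
    obtain ⟨Φ, h1, h2, h3⟩ := hnhds x hx
    exact ⟨_, mem_nhdsWithin_of_mem_nhds h3, Φ, h1, h2, fun x' hx' => hx'⟩

/-- A function majorised nearly everywhere by the potential of `ω` has integral at most the mutual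
energy with `ω`. -/
theorem lintegral_le_of_le_potential (hκ : IsKernel κ) (hpd : IsPositiveDefinite κ)
    (h0 : ∀ x y, 0 ≤ κ x y) {μ : PosRadon X} (hμ : μ ∈ posFiniteEnergy κ)
    (hfin : μ.1 univ ≠ ⊤) {E : Set X} (hE : IsClosed E) (hμE : μ.1 Eᶜ = 0) {ω : PosRadon X}
    {f : X → ℝ} (hf : Continuous f)
    (hne : NearlyEverywhere κ E fun x => (f x : EReal) ≤ ω.potential κ x) {C : ℝ}
    (hC : μ.mutualEnergy κ ω ≤ (C : EReal)) :
    ∫⁻ x, ENNReal.ofReal (f x) ∂μ.1 ≤ ENNReal.ofReal C := by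
  have hsub : ∀ s : Set X, μ.1 s ≠ ⊤ := fun s => measure_ne_top_of_subset (subset_univ s) hfin
  have hpm : Measurable fun x => ω.potential κ x :=
    (lowerSemicontinuous_potential hκ h0 ω).measurable
  have hfm : Measurable fun x => (f x : EReal) := hf.measurable.coe_real_ereal
  have hD : MeasurableSet {x ∈ E | ¬ (f x : EReal) ≤ ω.potential κ x} :=
    hE.measurableSet.inter (measurableSet_le hfm hpm).compl
  -- Measures of finite energy do not charge compact sets of capacity zero; inner regularity extends
  -- this to the measurable exceptional set.
  have hD0 : μ.1 {x ∈ E | ¬ (f x : EReal) ≤ ω.potential κ x} = 0 := by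
    by_contra hpos
    obtain ⟨L, hLD, hL, hμL⟩ := hD.exists_lt_isCompact_of_ne_top (hsub _)
      (pos_iff_ne_zero.2 hpos)
    exact hμL.ne' (measure_eq_zero_of_interiorCapacity_eq_zero hκ hpd h0 hμ hne hL hLD)
  obtain ⟨K, hK, hmono, hKS, hnull⟩ := μ.exists_compact_exhaustion
    (S := fun _ => {x | (f x : EReal) ≤ ω.potential κ x})
    (fun _ => measurableSet_le hfm hpm) (fun _ => hsub _) (by
      rw [iUnion_const]
      refine measure_mono_null ?_ (measure_union_null hμE hD0)
      intro x hx
      by_cases hxE : x ∈ E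
      · exact Or.inr ⟨hxE, hx⟩
      · exact Or.inl hxE)
  rw [lintegral_eq_iSup_of_exhaustion hmono hnull]
  refine iSup_le fun n => ?_
  rw [iUnion_const] at hKS
  refine ENNReal.le_of_forall_pos_le_add fun η hη _ => ?_
  have hm : (0 : ℝ) < (μ.1 (K n)).toReal + 1 := by positivity
  have hε : 0 < (η : ℝ) / ((μ.1 (K n)).toReal + 1) := by positivity
  obtain ⟨Φ, hΦ, hΦ0, hΦK⟩ := exists_minorant_on_compact hκ h0 hf (hK n) (fun x hx => hKS n hx) hε
  have hI0 : ∀ x, 0 ≤ partialIntegral Φ ω x := fun x => integral_nonneg fun y => hΦ0 (x, y)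
  have hIm : Measurable fun x => ENNReal.ofReal (partialIntegral Φ ω x) :=
    (partialIntegral Φ ω).continuous.measurable.ennreal_ofReal
  calc ∫⁻ x in K n, ENNReal.ofReal (f x) ∂μ.1
      ≤ ∫⁻ x in K n, (ENNReal.ofReal (partialIntegral Φ ω x) +
          ENNReal.ofReal (η / ((μ.1 (K n)).toReal + 1))) ∂μ.1 := by
        refine setLIntegral_mono' (hK n).measurableSet fun x hx => ?_
        rw [← ENNReal.ofReal_add (hI0 x) hε.le]
        exact ENNReal.ofReal_le_ofReal (by linarith [hΦK x hx])
    _ = ∫⁻ x in K n, ENNReal.ofReal (partialIntegral Φ ω x) ∂μ.1 +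
          ENNReal.ofReal (η / ((μ.1 (K n)).toReal + 1)) * μ.1 (K n) := by
        rw [lintegral_add_left hIm, setLIntegral_const]
    _ ≤ ENNReal.ofReal C + η := by
        gcongr
        · refine (setLIntegral_le_lintegral _ _).trans ?_
          rw [← ofReal_integral_eq_lintegral_ofReal (integrable_cc (partialIntegral Φ ω) μ)
            (.of_forall hI0)]
          exact ENNReal.ofReal_le_ofReal (mutualEnergy_le_iff.1 hC Φ hΦ)
        · have h1 : ENNReal.ofReal (η / ((μ.1 (K n)).toReal + 1)) *
              ENNReal.ofReal (μ.1 (K n)).toReal ≤ ENNReal.ofReal η := by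
            rw [← ENNReal.ofReal_mul hε.le]
            refine ENNReal.ofReal_le_ofReal ?_
            rw [div_mul_eq_mul_div, div_le_iff₀ hm]
            nlinarith [η.coe_nonneg]
          rwa [ENNReal.ofReal_toReal (hK n).measure_ne_top, ENNReal.ofReal_coe_nnreal] at h1

theorem potential_nonneg (h0 : ∀ x y, 0 ≤ κ x y) (ω : PosRadon X) (x : X) :
    0 ≤ ω.potential κ x := by
  have := le_potential (κ := κ) (φ := 0) (x := x) (fun y => by simpa using h0 x y) ω
  simpa using this

/-- The tails of `∫ g dμ` are uniformly small over bounded families in `𝓔⁺` on a set of finite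
capacity, provided that `g` is bounded or is majorised by a power of a potential. -/
theorem exists_compact_lintegral_compl_le (hκ : IsKernel κ) (hpd : IsPositiveDefinite κ)
    (hcons : IsConsistent κ) (h0 : ∀ x y, 0 ≤ κ x y) {E : Set X} (hE : IsClosed E)
    (hcap : interiorCapacity κ E < ⊤) (g : C(X, ℝ)) (hg : ∀ x, 0 < g x)
    (hgrowth : BddAbove (g '' E) ∨ ∃ r : ℝ, 1 < r ∧ ∃ ω : SignedRadon X, ω.FiniteEnergy κ ∧
      NearlyEverywhere κ E fun x => ((g x ^ r : ℝ) : EReal) ≤ ω.potential κ x)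
    (M : ℝ) {ε : ℝ} (hε : 0 < ε) :
    ∃ K, IsCompact K ∧ ∀ μ ∈ posFiniteEnergy κ, μ.1 Eᶜ = 0 → μ.energy κ μ ≤ M →
      ∫⁻ x in Kᶜ, ENNReal.ofReal (g x) ∂μ.1 ≤ ENNReal.ofReal ε := by
  rcases hgrowth with ⟨B, hB⟩ | ⟨r, hr, ω, hω, hne⟩
  · have hB' : 0 < max B 1 := lt_max_of_lt_right one_pos
    obtain ⟨K, hK, h⟩ := exists_compact_measure_compl_le hκ hpd hcons h0 hE hcap M
      (δ := ENNReal.ofReal (ε / max B 1)) (ENNReal.ofReal_pos.2 (by positivity)).ne'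
    refine ⟨K, hK, fun μ hμ hμE hμM => ?_⟩
    calc ∫⁻ x in Kᶜ, ENNReal.ofReal (g x) ∂μ.1
        ≤ ∫⁻ x in Kᶜ, ENNReal.ofReal (max B 1) ∂μ.1 := by
          refine lintegral_mono_ae (ae_restrict_of_ae ?_)
          filter_upwards [measure_eq_zero_iff_ae_notMem.1 hμE] with x hx
          rw [notMem_compl_iff] at hx
          exact ENNReal.ofReal_le_ofReal ((hB (mem_image_of_mem g hx)).trans (le_max_left _ _))
      _ = ENNReal.ofReal (max B 1) * μ.1 Kᶜ := setLIntegral_const _ _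
      _ ≤ ENNReal.ofReal (max B 1) * ENNReal.ofReal (ε / max B 1) := by
          gcongr
          exact h μ hμ hμE hμM
      _ = ENNReal.ofReal ε := by
          rw [← ENNReal.ofReal_mul hB'.le, mul_div_cancel₀ _ hB'.ne']
  · have hωp := ((SignedRadon.finiteEnergy_iff hκ hpd).1 hω).1
    set C : ℝ := (max M 0 + ω.pos.energy κ ω.pos) / 2
    have hC0 : 0 ≤ C := by
      obtain ⟨H, i1, i2, i3, ⟨T⟩⟩ := exists_energyEmbedding hκ hpd
      have : 0 ≤ ω.pos.energy κ ω.pos := by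
        rw [← T.norm_sq_eq hωp]
        positivity
      positivity
    -- Here `r > 1` enters: `t ^ (1 - r)` tends to `0`. The level `t` makes the contribution of
    -- large values of `g` small, and the compact set is chosen afterwards.
    obtain ⟨t, ht0, ht⟩ : ∃ t : ℝ, 0 < t ∧ t ^ (1 - r) * C ≤ ε / 2 := by
      have h1 : Tendsto (fun t : ℝ => t ^ (1 - r) * C) atTop (𝓝 (0 * C)) := by
        have := tendsto_rpow_neg_atTop (sub_pos.2 hr)
        rw [neg_sub] at this
        exact this.mul_const C
      rw [zero_mul] at h1
      obtain ⟨t, ht1, ht2⟩ := ((eventually_gt_atTop 0).and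
        (h1.eventually_le_const (half_pos hε))).exists
      exact ⟨t, ht1, ht2⟩
    -- Where `g` exceeds `t`, write `g = g ^ (1 - r) * g ^ r` and use `1 - r < 0`.
    have hpt : ∀ x, g x ≤ t + t ^ (1 - r) * g x ^ r := by
      intro x
      have hp : 0 ≤ t ^ (1 - r) * g x ^ r :=
        mul_nonneg (Real.rpow_nonneg ht0.le _) (Real.rpow_nonneg (hg x).le _)
      rcases le_total (g x) t with h | h
      · linarith
      · have h1 : g x ^ (1 - r) ≤ t ^ (1 - r) :=
          Real.rpow_le_rpow_of_nonpos ht0 h (by linarith)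
        have h2 : g x ^ (1 - r) * g x ^ r = g x := by
          rw [← Real.rpow_add (hg x), sub_add_cancel, Real.rpow_one]
        have h3 := mul_le_mul_of_nonneg_right h1 (Real.rpow_nonneg (hg x).le r)
        linarith
    have hfc : Continuous fun x => g x ^ r :=
      g.continuous.rpow_const fun x => Or.inl (hg x).ne'
    -- As `κ ≥ 0`, dropping `ω.neg` can only raise the potential, including where the difference has
    -- the default value `⊥`.
    have hne' : NearlyEverywhere κ E fun x => ((g x ^ r : ℝ) : EReal) ≤ ω.pos.potential κ x := by
      refine le_antisymm (le_trans ?_ hne.le) bot_le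
      refine iSup₂_le fun K hK => ?_
      refine le_iSup₂ (f := fun (K : Set X) (_ : IsCompact K ∧
        K ⊆ {x ∈ E | ¬ ((g x ^ r : ℝ) : EReal) ≤ ω.potential κ x}) =>
        (⨅ (ν : PosRadon X) (_ : ν.1 Kᶜ = 0 ∧ ν.1 univ = 1), ν.mutualEnergy κ ν).toENNReal⁻¹) K
        ⟨hK.1, fun x hx => ⟨(hK.2 hx).1, fun h => (hK.2 hx).2 (h.trans ?_)⟩⟩
      rw [SignedRadon.potential]
      refine EReal.sub_le_of_le_add ?_
      exact le_add_of_nonneg_right (potential_nonneg h0 _ _)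
    -- This compact set serves only to show that the measures `μ` have finite total mass.
    obtain ⟨K₁, hK₁, hfin⟩ := exists_compact_measure_compl_le hκ hpd hcons h0 hE hcap M
      (δ := 1) one_ne_zero
    obtain ⟨K, hK, h⟩ := exists_compact_measure_compl_le hκ hpd hcons h0 hE hcap M
      (δ := ENNReal.ofReal (ε / 2 / t)) (ENNReal.ofReal_pos.2 (by positivity)).ne'
    refine ⟨K, hK, fun μ hμ hμE hμM => ?_⟩
    have huniv : μ.1 univ ≠ ⊤ := by
      rw [← union_compl_self K₁]
      exact ((measure_union_le _ _).trans_lt (ENNReal.add_lt_top.2 ⟨hK₁.measure_lt_top,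
        (hfin μ hμ hμE hμM).trans_lt ENNReal.one_lt_top⟩)).ne
    have hμC : μ.mutualEnergy κ ω.pos ≤ (C : EReal) := by
      refine (two_mul_mutualEnergy_le hκ hpd hμ hωp).trans (EReal.coe_le_coe_iff.2 ?_)
      have : μ.energy κ μ ≤ max M 0 := hμM.trans (le_max_left _ _)
      simp only [C]
      linarith
    have hint := lintegral_le_of_le_potential hκ hpd h0 hμ huniv hE hμE hfc hne' hμC
    calc ∫⁻ x in Kᶜ, ENNReal.ofReal (g x) ∂μ.1
        ≤ ∫⁻ x in Kᶜ, (ENNReal.ofReal t +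
            ENNReal.ofReal (t ^ (1 - r)) * ENNReal.ofReal (g x ^ r)) ∂μ.1 := by
          refine lintegral_mono fun x => ?_
          rw [← ENNReal.ofReal_mul (Real.rpow_nonneg ht0.le _), ← ENNReal.ofReal_add ht0.le
            (mul_nonneg (Real.rpow_nonneg ht0.le _) (Real.rpow_nonneg (hg x).le _))]
          exact ENNReal.ofReal_le_ofReal (hpt x)
      _ = ENNReal.ofReal t * μ.1 Kᶜ +
            ENNReal.ofReal (t ^ (1 - r)) * ∫⁻ x in Kᶜ, ENNReal.ofReal (g x ^ r) ∂μ.1 := by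
          rw [lintegral_add_left measurable_const, setLIntegral_const,
            lintegral_const_mul _ hfc.measurable.ennreal_ofReal]
      _ ≤ ENNReal.ofReal t * ENNReal.ofReal (ε / 2 / t) +
            ENNReal.ofReal (t ^ (1 - r)) * ENNReal.ofReal C := by
          gcongr
          · exact h μ hμ hμE hμM
          · exact (setLIntegral_le_lintegral _ _).trans hint
      _ ≤ ENNReal.ofReal (ε / 2) + ENNReal.ofReal (ε / 2) := by
          gcongr
          · rw [← ENNReal.ofReal_mul ht0.le, mul_div_cancel₀ _ ht0.ne']
          · rw [← ENNReal.ofReal_mul (Real.rpow_nonneg ht0.le _)]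
            exact ENNReal.ofReal_le_ofReal ht
      _ = ENNReal.ofReal ε := by
          rw [← ENNReal.ofReal_add (by positivity) (by positivity), add_halves]

end Potential

/-! ### Vague limits of measures associated with a condenser -/

section CondenserLimits

variable {ι : Type*} {P : Set ι} {X : Type u} [TopologicalSpace X] [T2Space X]
  [LocallyCompactSpace X] [MeasurableSpace X] [BorelSpace X] {κ : X → X → EReal}

open PosRadon

/-- Continuity of `ν ↦ ∫ g dν` along vaguely convergent families with uniformly small tails. -/
theorem lintegral_eq_of_tendsto {α : Type*} {F : Filter α} [F.NeBot] {ν : α → PosRadon X}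
    {ν₀ : PosRadon X} (h : Tendsto ν F (𝓝 ν₀)) (g : C(X, ℝ)) (hg : ∀ x, 0 < g x) {a : ℝ}
    (ha : ∀ᶠ s in F, ∫⁻ x, ENNReal.ofReal (g x) ∂(ν s).1 = ENNReal.ofReal a)
    (htail : ∀ ε : ℝ, 0 < ε → ∃ K, IsCompact K ∧
      (∫⁻ x in Kᶜ, ENNReal.ofReal (g x) ∂ν₀.1 ≤ ENNReal.ofReal ε) ∧
      ∀ᶠ s in F, ∫⁻ x in Kᶜ, ENNReal.ofReal (g x) ∂(ν s).1 ≤ ENNReal.ofReal ε) :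
    ∫⁻ x, ENNReal.ofReal (g x) ∂ν₀.1 = ENNReal.ofReal a := by
  have key : ∀ ε : ℝ≥0, 0 < ε → ∫⁻ x, ENNReal.ofReal (g x) ∂ν₀.1 ≤ ENNReal.ofReal a + ε ∧
      ENNReal.ofReal a ≤ ∫⁻ x, ENNReal.ofReal (g x) ∂ν₀.1 + ε := by
    intro ε hε
    obtain ⟨K, hK, hK0, hKs⟩ := htail ε hε
    obtain ⟨χ, hχ1, hχ0, hχle, -⟩ := exists_cutoff hK isOpen_univ (subset_univ K)
    -- `ψ` can be tested against vague convergence and differs from `g` only off `K`, where the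
    -- tails are small.
    let ψ : C_c(X, ℝ) :=
      { toFun := fun x => g x * χ x
        continuous_toFun := by fun_prop
        hasCompactSupport' := χ.hasCompactSupport.mul_left }
    have hψ : ∀ x, ψ x = g x * χ x := fun x => rfl
    have hψ0 : ∀ x, 0 ≤ ψ x := fun x => mul_nonneg (hg x).le (hχ0 x)
    have hψle : ∀ x, ψ x ≤ g x := fun x => mul_le_of_le_one_right (hg x).le (hχle x)
    have h1 : ∀ ρ : PosRadon X, ENNReal.ofReal (∫ x, ψ x ∂ρ.1) =
        ∫⁻ x, ENNReal.ofReal (ψ x) ∂ρ.1 := fun ρ =>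
      ofReal_integral_eq_lintegral_ofReal (integrable_cc ψ ρ) (.of_forall hψ0)
    have h2 : ∀ ρ : PosRadon X, ENNReal.ofReal (∫ x, ψ x ∂ρ.1) ≤
        ∫⁻ x, ENNReal.ofReal (g x) ∂ρ.1 := fun ρ => by
      rw [h1]
      exact lintegral_mono fun x => ENNReal.ofReal_le_ofReal (hψle x)
    have h3 : ∀ ρ : PosRadon X, ∫⁻ x in Kᶜ, ENNReal.ofReal (g x) ∂ρ.1 ≤ ENNReal.ofReal ε →
        ∫⁻ x, ENNReal.ofReal (g x) ∂ρ.1 ≤ ENNReal.ofReal (∫ x, ψ x ∂ρ.1) + ε := fun ρ hρ => by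
      rw [h1, ← lintegral_add_compl _ hK.measurableSet, ← ENNReal.ofReal_coe_nnreal]
      refine add_le_add ?_ hρ
      refine le_trans (le_of_eq ?_) (setLIntegral_le_lintegral K _)
      refine setLIntegral_congr_fun hK.measurableSet fun x hx => ?_
      simp only [hψ, hχ1 x hx, mul_one]
    have hlim : Tendsto (fun s => ENNReal.ofReal (∫ x, ψ x ∂(ν s).1)) F
        (𝓝 (ENNReal.ofReal (∫ x, ψ x ∂ν₀.1))) :=
      (ENNReal.continuous_ofReal.tendsto _).comp (PosRadon.tendsto_iff.1 h ψ)
    constructor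
    · refine (h3 ν₀ hK0).trans (add_le_add (le_of_tendsto hlim ?_) le_rfl)
      filter_upwards [ha] with s hs
      rw [← hs]
      exact h2 _
    · refine le_trans (ge_of_tendsto (hlim.add_const (ε : ℝ≥0∞)) ?_) (add_le_add (h2 ν₀) le_rfl)
      filter_upwards [ha, hKs] with s hs hs'
      rw [← hs]
      exact h3 _ hs'
  exact le_antisymm (ENNReal.le_of_forall_pos_le_add fun ε hε _ => (key ε hε).1)
    (ENNReal.le_of_forall_pos_le_add fun ε hε _ => (key ε hε).2)

variable {A : Condenser P X}

theorem CondenserMeasure.tendsto_iff {α : Type*} {F : Filter α} {μ : α → CondenserMeasure A}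
    {l : CondenserMeasure A} :
    Tendsto μ F (𝓝 l) ↔ ∀ i, Tendsto (fun s => (μ s).coord i) F (𝓝 (l.coord i)) := by
  rw [nhds_induced, tendsto_comap_iff, tendsto_pi_nhds]
  rfl

/-- Vague compactness of sets of measures associated with a condenser. -/
theorem CondenserMeasure.exists_tendsto_ultrafilter {α : Type*} (U : Ultrafilter α)
    {μ : α → CondenserMeasure A} {a : ι → ℝ} {g : ι → C(X, ℝ)} (hg : ∀ i x, 0 < g i x)
    (h : ∀ i, ∀ᶠ s in U,
      ∫⁻ x, ENNReal.ofReal (g i x) ∂((μ s).coord i).1 ≤ ENNReal.ofReal (a i)) :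
    ∃ l : CondenserMeasure A, Tendsto μ U (𝓝 l) := by
  have hc : ∀ i, ∃ ν₀ : PosRadon X, Tendsto (fun s => (μ s).coord i) U (𝓝 ν₀) := fun i => by
    refine PosRadon.exists_tendsto_ultrafilter U fun φ => ?_
    obtain ⟨C, hC⟩ := PosRadon.exists_abs_integral_le (g i) (hg i) (a i) φ
    exact ⟨C, (h i).mono fun s hs => hC _ hs⟩
  choose l hl using hc
  exact ⟨⟨l, fun i => PosRadon.measure_eq_zero_of_tendsto (hl i) (A.isClosed i).isOpen_compl
    (.of_forall fun s => (μ s).supported i)⟩, CondenserMeasure.tendsto_iff.2 hl⟩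

variable [Countable ι]

namespace CondenserMeasure

theorem sumOver_val (μ : CondenserMeasure A) (S : Set ι) :
    (μ.sumOver S).1 = Measure.sum fun i : S => (μ.coord i).1 := rfl

theorem sumOver_apply (μ : CondenserMeasure A) (S : Set ι) {E : Set X} (hE : MeasurableSet E) :
    (μ.sumOver S).1 E = ∑' i : S, (μ.coord i).1 E := by
  rw [sumOver_val, Measure.sum_apply _ hE]

theorem coord_le_sumOver (μ : CondenserMeasure A) {S : Set ι} {i : ι} (hi : i ∈ S) :
    (μ.coord i).1 ≤ (μ.sumOver S).1 :=
  Measure.le_sum (fun i : S => (μ.coord i).1) ⟨i, hi⟩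

theorem integral_sumOver (μ : CondenserMeasure A) (S : Set ι) (φ : C_c(X, ℝ)) {t : Finset S}
    (ht : ∀ i : S, (A.plate i ∩ tsupport φ).Nonempty → i ∈ t) :
    ∫ x, φ x ∂(μ.sumOver S).1 = ∑ i ∈ t, ∫ x, φ x ∂(μ.coord i).1 := by
  have h := integrable_cc φ (μ.sumOver S)
  rw [sumOver_val] at h ⊢
  rw [integral_sum_measure h, tsum_eq_sum]
  intro i hi
  refine integral_eq_zero_of_ae ?_
  filter_upwards [measure_eq_zero_iff_ae_notMem.1 (μ.supported i)] with x hx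
  rw [notMem_compl_iff] at hx
  exact image_eq_zero_of_notMem_tsupport fun hφ => hi (ht i ⟨x, hx, hφ⟩)

/-- The support of a test function meets only finitely many plates, so the limit passes through a
finite sum even if `S` is infinite. -/
theorem tendsto_sumOver {α : Type*} {F : Filter α} {μ : α → CondenserMeasure A}
    {l : CondenserMeasure A} (h : Tendsto μ F (𝓝 l)) (S : Set ι) :
    Tendsto (fun s => (μ s).sumOver S) F (𝓝 (l.sumOver S)) := by
  rw [PosRadon.tendsto_iff]
  intro φ
  have hfin : (Subtype.val ⁻¹' {i | (A.plate i ∩ tsupport φ).Nonempty} : Set S).Finite :=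
    (A.finite_inter _ φ.hasCompactSupport.isCompact).preimage Subtype.val_injective.injOn
  have ht : ∀ i : S, (A.plate i ∩ tsupport φ).Nonempty → i ∈ hfin.toFinset :=
    fun i hi => hfin.mem_toFinset.2 hi
  simp only [integral_sumOver _ S φ ht]
  exact tendsto_finsetSum _ fun i _ =>
    PosRadon.tendsto_iff.1 (CondenserMeasure.tendsto_iff.1 h i) φ

theorem sumOver_compl_biUnion (μ : CondenserMeasure A) (S : Set ι) :
    (μ.sumOver S).1 (⋃ i ∈ S, A.plate i)ᶜ = 0 := by
  have hms : MeasurableSet (⋃ i ∈ S, A.plate i) :=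
    MeasurableSet.biUnion (Set.to_countable S) fun i _ => (A.isClosed i).measurableSet
  rw [sumOver_apply _ _ hms.compl, ENNReal.tsum_eq_zero]
  exact fun i => measure_mono_null
    (compl_subset_compl.2 (subset_biUnion_of_mem (u := A.plate) i.2)) (μ.supported i)

/-- The bound for the total masses. -/
theorem sumOver_univ_le (μ : CondenserMeasure A) (S : Set ι) {a : ι → ℝ} (ha : ∀ i, 0 < a i)
    {g : ι → C(X, ℝ)}
    (hμ : ∀ i, ∫⁻ x, ENNReal.ofReal (g i x) ∂(μ.coord i).1 = ENNReal.ofReal (a i)) :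
    (μ.sumOver S).1 univ ≤
      ∑' i, ENNReal.ofReal (a i) / (⨅ x ∈ A.plate i, ENNReal.ofReal (g i x)) := by
  rw [sumOver_apply _ _ MeasurableSet.univ]
  refine le_trans (ENNReal.tsum_le_tsum fun i => ?_) (ENNReal.tsum_comp_le_tsum_of_injective
    (Subtype.val_injective (p := fun i => i ∈ S))
    fun i => ENNReal.ofReal (a i) / (⨅ x ∈ A.plate i, ENNReal.ofReal (g i x)))
  rw [ENNReal.le_div_iff_mul_le (Or.inr (ENNReal.ofReal_pos.2 (ha i)).ne')
    (Or.inr ENNReal.ofReal_ne_top), ← hμ i, mul_comm, ← lintegral_const]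
  refine lintegral_mono_ae ?_
  filter_upwards [measure_eq_zero_iff_ae_notMem.1 (μ.supported i)] with x hx
  rw [notMem_compl_iff] at hx
  exact iInf₂_le x hx

end CondenserMeasure

/-- The hypotheses on the condenser, the numbers `a i` and the functions `g i`. -/
structure Condenser.Admits (κ : X → X → EReal) (a : ι → ℝ) (g : ι → C(X, ℝ))
    (A : Condenser P X) : Prop where
  standing : Pᶜ = ∅ ∨
    ((∑' i, ENNReal.ofReal (a i) / (⨅ x ∈ A.plate i, ENNReal.ofReal (g i x))) < ⊤ ∧
      (⨆ x ∈ A.posUnion, ⨆ y ∈ A.negUnion, κ x y) < ⊤)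
  growth : ∀ i, BddAbove (g i '' A.plate i) ∨
    ∃ r : ℝ, 1 < r ∧ ∃ ω : SignedRadon X, ω.FiniteEnergy κ ∧
      NearlyEverywhere κ (A.plate i) fun x => ((g i x ^ r : ℝ) : EReal) ≤ ω.potential κ x
  plates : ∀ i, IsCompact (A.plate i) ∨ interiorCapacity κ (A.plate i) < ⊤

/-- On compact plates the growth condition comes from continuity and the capacity condition is void;
the standing condition is monotone. -/
theorem Condenser.Admits.of_le {a : ι → ℝ} {g : ι → C(X, ℝ)} (hA : A.Admits κ a g)
    {K : Condenser P X} (hKA : K ≤ A) (hK : ∀ i, IsCompact (K.plate i)) : K.Admits κ a g where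
  standing := hA.standing.imp_right fun ⟨h1, h2⟩ => by
    constructor
    · refine (ENNReal.tsum_le_tsum fun i => ?_).trans_lt h1
      exact ENNReal.div_le_div_left (biInf_mono (hKA i)) _
    · refine lt_of_le_of_lt ?_ h2
      have hp : K.posUnion ⊆ A.posUnion := iUnion₂_mono fun i _ => hKA i
      have hn : K.negUnion ⊆ A.negUnion := iUnion₂_mono fun i _ => hKA i
      exact (biSup_mono hp).trans (iSup₂_mono fun x _ => biSup_mono hn)
  growth i := Or.inl (((hK i).image (g i).continuous).bddAbove)
  plates i := Or.inl (hK i)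

/-- The mutual energy of the positive and negative parts is bounded above. -/
theorem exists_bound_mutualEnergy (hκ : IsKernel κ) {a : ι → ℝ} (ha : ∀ i, 0 < a i)
    {g : ι → C(X, ℝ)} (hA : A.Admits κ a g) :
    ∃ D : ℝ, ∀ μ ∈ A.admissible κ a g,
      (μ.sumOver P).mutualEnergy κ (μ.sumOver Pᶜ) ≤ (D : EReal) := by
  rcases hA.standing with hP | ⟨hT, hB⟩
  · refine ⟨0, fun μ _ => ?_⟩
    have h0 : μ.sumOver Pᶜ = 0 := PosRadon.ext <| by
      have : IsEmpty (Pᶜ : Set ι) := isEmpty_coe_sort.2 hP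
      rw [CondenserMeasure.sumOver_val, Measure.sum_of_isEmpty, zero_val]
    rw [h0, mutualEnergy_zero_right hκ]
  · set s := ⨆ x ∈ A.posUnion, ⨆ y ∈ A.negUnion, κ x y
    set t := ∑' i, ENNReal.ofReal (a i) / (⨅ x ∈ A.plate i, ENNReal.ofReal (g i x))
    -- The supremum may be negative, but only a nonnegative bound may be multiplied by upper bounds
    -- of the masses.
    have hB0 : 0 ≤ max s.toReal 0 := le_max_right _ _
    have hκB : ∀ x ∈ A.posUnion, ∀ y ∈ A.negUnion, κ x y ≤ (max s.toReal 0 : ℝ) :=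
      fun x hx y hy => by
        have h1 : κ x y ≤ s := le_trans (le_iSup₂ (f := fun y (_ : y ∈ A.negUnion) => κ x y) y hy)
          (le_iSup₂ (f := fun x (_ : x ∈ A.posUnion) => ⨆ y ∈ A.negUnion, κ x y) x hx)
        exact h1.trans ((EReal.le_coe_toReal hB.ne).trans
          (EReal.coe_le_coe_iff.2 (le_max_left _ _)))
    refine ⟨max s.toReal 0 * t.toReal * t.toReal, fun μ hμ => ?_⟩
    have hmass : ∀ S : Set ι, (μ.sumOver S).1 univ ≤ t := fun S => μ.sumOver_univ_le S ha hμ.2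
    have hfin : ∀ S : Set ι, IsFiniteMeasure (μ.sumOver S).1 := fun S => ⟨(hmass S).trans_lt hT⟩
    have hreal : ∀ S : Set ι, (μ.sumOver S).1.real univ ≤ t.toReal := fun S =>
      ENNReal.toReal_mono hT.ne (hmass S)
    have hint : ∀ (S : Set ι) (φ : C_c(X, ℝ)) (C : ℝ), 0 ≤ C →
        (∀ x ∈ ⋃ i ∈ S, A.plate i, φ x ≤ C) → ∫ x, φ x ∂(μ.sumOver S).1 ≤ C * t.toReal := by
      intro S φ C hC hφ
      have := hfin S
      calc ∫ x, φ x ∂(μ.sumOver S).1 ≤ ∫ x, C ∂(μ.sumOver S).1 := by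
            refine integral_mono_ae (integrable_cc φ _) (integrable_const C) ?_
            filter_upwards [measure_eq_zero_iff_ae_notMem.1 (μ.sumOver_compl_biUnion S)] with x hx
            rw [notMem_compl_iff] at hx
            exact hφ x hx
        _ = C * (μ.sumOver S).1.real univ := by rw [integral_const, smul_eq_mul, mul_comm]
        _ ≤ C * t.toReal := mul_le_mul_of_nonneg_left (hreal S) hC
    refine mutualEnergy_le_iff.2 fun φ hφ => ?_
    refine hint P (partialIntegral φ (μ.sumOver Pᶜ)) _
      (mul_nonneg hB0 ENNReal.toReal_nonneg) fun x hx => ?_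
    exact hint Pᶜ (sliceLeft φ x) _ hB0 fun y hy =>
      EReal.coe_le_coe_iff.1 ((hφ (x, y)).trans (hκB x hx y hy))

theorem CondenserMeasure.R_pos (μ : CondenserMeasure A) : μ.R.pos = μ.sumOver P := rfl

theorem CondenserMeasure.R_neg (μ : CondenserMeasure A) : μ.R.neg = μ.sumOver Pᶜ := rfl

/-- A bound for the energy of `Rμ` yields bounds for the energies of its two parts. -/
theorem exists_bound_energy (hκ : IsKernel κ) (hpd : IsPositiveDefinite κ) {a : ι → ℝ}
    (ha : ∀ i, 0 < a i) {g : ι → C(X, ℝ)} (hA : A.Admits κ a g) (M : ℝ) :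
    ∃ M' : ℝ, ∀ μ ∈ A.admissible κ a g, μ.R.mutualEnergy κ μ.R ≤ (M : EReal) →
      μ.sumOver P ∈ posFiniteEnergy κ ∧ μ.sumOver Pᶜ ∈ posFiniteEnergy κ ∧
      (μ.sumOver P).energy κ (μ.sumOver P) ≤ M' ∧
      (μ.sumOver Pᶜ).energy κ (μ.sumOver Pᶜ) ≤ M' := by
  obtain ⟨D, hD⟩ := exists_bound_mutualEnergy hκ ha hA
  obtain ⟨H, i1, i2, i3, ⟨T⟩⟩ := exists_energyEmbedding hκ hpd
  -- Expanding the energy gives `‖μ⁺‖² + ‖μ⁻‖² ≤ M + 2κ(μ⁺, μ⁻)`, and both squares are nonnegative.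
  refine ⟨M + 2 * D, fun μ hμ hM => ?_⟩
  obtain ⟨hp, hn⟩ := (SignedRadon.finiteEnergy_iff hκ hpd).1 hμ.1
  have h1 := hD μ hμ
  rw [SignedRadon.mutualEnergy_self_eq T hκ hpd hμ.1, EReal.coe_le_coe_iff,
    EnergyEmbedding.signed, norm_sub_sq_real, T.norm_sq_eq hp, T.norm_sq_eq hn,
    T.inner_eq _ hp _ hn] at hM
  rw [CondenserMeasure.R_pos, CondenserMeasure.R_neg] at hM
  rw [CondenserMeasure.R_pos] at hp
  rw [CondenserMeasure.R_neg] at hn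
  rw [mutualEnergy_eq_energy hκ hpd hp hn, EReal.coe_le_coe_iff] at h1
  have h2 := T.norm_sq_eq hp ▸ sq_nonneg ‖T.toFun (μ.sumOver P)‖
  have h3 := T.norm_sq_eq hn ▸ sq_nonneg ‖T.toFun (μ.sumOver Pᶜ)‖
  exact ⟨hp, hn, by linarith, by linarith⟩

/-- The class of admissible measures of bounded energy is closed for the `A`-vague topology, and
the energy is lower semicontinuous on it. -/
theorem admissible_of_tendsto (hκ : IsKernel κ) (hpd : IsPositiveDefinite κ)
    (hcons : IsConsistent κ) {a : ι → ℝ} (ha : ∀ i, 0 < a i) {g : ι → C(X, ℝ)}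
    (hg : ∀ i x, 0 < g i x) (hA : A.Admits κ a g) {α : Type*} (U : Ultrafilter α)
    {μ : α → CondenserMeasure A} {l : CondenserMeasure A} (hl : Tendsto μ U (𝓝 l)) {M : ℝ}
    (hμ : ∀ᶠ s in U, μ s ∈ A.admissible κ a g)
    (hM : ∀ᶠ s in U, (μ s).R.mutualEnergy κ (μ s).R ≤ (M : EReal)) :
    l ∈ A.admissible κ a g ∧ l.R.mutualEnergy κ l.R ≤ (M : EReal) := by
  obtain ⟨H, i1, i2, i3, ⟨T⟩⟩ := exists_energyEmbedding hκ hpd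
  obtain ⟨M', hM'⟩ := exists_bound_energy hκ hpd ha hA M
  have hbd : ∀ᶠ s in U, (μ s).sumOver P ∈ posFiniteEnergy κ ∧
      (μ s).sumOver Pᶜ ∈ posFiniteEnergy κ ∧
      ((μ s).sumOver P).energy κ ((μ s).sumOver P) ≤ M' ∧
      ((μ s).sumOver Pᶜ).energy κ ((μ s).sumOver Pᶜ) ≤ M' := by
    filter_upwards [hμ, hM] with s h1 h2
    exact hM' _ h1 h2
  have hbdP : ∀ᶠ s in U, ((μ s).sumOver P).mutualEnergy κ ((μ s).sumOver P) ≤ (M' : EReal) := by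
    filter_upwards [hbd] with s hs
    rw [coe_energy_self hκ hs.1]
    exact EReal.coe_le_coe_iff.2 hs.2.2.1
  have hbdN : ∀ᶠ s in U, ((μ s).sumOver Pᶜ).mutualEnergy κ ((μ s).sumOver Pᶜ) ≤ (M' : EReal) := by
    filter_upwards [hbd] with s hs
    rw [coe_energy_self hκ hs.2.1]
    exact EReal.coe_le_coe_iff.2 hs.2.2.2
  obtain ⟨hlP, hwP⟩ := T.tendsto_inner_of_tendsto hκ hpd hcons U
    (CondenserMeasure.tendsto_sumOver hl P) hbdP
  obtain ⟨hlN, hwN⟩ := T.tendsto_inner_of_tendsto hκ hpd hcons U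
    (CondenserMeasure.tendsto_sumOver hl Pᶜ) hbdN
  have hlR : l.R.FiniteEnergy κ := (SignedRadon.finiteEnergy_iff hκ hpd).2 ⟨hlP, hlN⟩
  refine ⟨⟨hlR, fun i => ?_⟩, ?_⟩
  · refine lintegral_eq_of_tendsto (CondenserMeasure.tendsto_iff.1 hl i) (g i) (hg i)
      (hμ.mono fun s hs => hs.2 i) fun ε hε => ?_
    -- A compact plate has no tails. A noncompact closed plate forces `X` to be noncompact, hence `κ
    -- ≥ 0`, and each coordinate inherits the energy bound of the part that contains it.
    by_cases hc : IsCompact (A.plate i)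
    · have h0 : ∀ ν : CondenserMeasure A,
          ∫⁻ x in (A.plate i)ᶜ, ENNReal.ofReal (g i x) ∂(ν.coord i).1 ≤ ENNReal.ofReal ε :=
        fun ν => by
          rw [setLIntegral_measure_zero _ _ (ν.supported i)]
          exact bot_le
      exact ⟨A.plate i, hc, h0 l, .of_forall fun s => h0 (μ s)⟩
    · have hX : ¬ CompactSpace X := fun h => hc (A.isClosed i).isCompact
      have h0 := hκ.nonneg hX
      obtain ⟨K, hK, htail⟩ := exists_compact_lintegral_compl_le hκ hpd hcons h0 (A.isClosed i)
        ((hA.plates i).resolve_left hc) (g i) (hg i) (hA.growth i) M' hε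
      have hcoord : ∀ᶠ s in U,
          ((μ s).coord i).mutualEnergy κ ((μ s).coord i) ≤ (M' : EReal) := by
        filter_upwards [hbdP, hbdN] with s h1 h2
        by_cases hi : i ∈ P
        · exact (mutualEnergy_mono h0 ((μ s).coord_le_sumOver hi)
            ((μ s).coord_le_sumOver hi)).trans h1
        · exact (mutualEnergy_mono h0 ((μ s).coord_le_sumOver (S := Pᶜ) hi)
            ((μ s).coord_le_sumOver (S := Pᶜ) hi)).trans h2
      have hfin : ∀ ν : CondenserMeasure A,
          (ν.coord i).mutualEnergy κ (ν.coord i) ≤ (M' : EReal) →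
          ∫⁻ x in Kᶜ, ENNReal.ofReal (g i x) ∂(ν.coord i).1 ≤ ENNReal.ofReal ε := by
        intro ν hν
        have hmem : ν.coord i ∈ posFiniteEnergy κ := (mem_posFiniteEnergy_iff hκ).2
          (ne_top_of_le_ne_top (EReal.coe_ne_top M') hν)
        refine htail _ hmem (ν.supported i) ?_
        rwa [coe_energy_self hκ hmem, EReal.coe_le_coe_iff] at hν
      refine ⟨K, hK, hfin l ?_, hcoord.mono fun s hs => hfin _ hs⟩
      exact mutualEnergy_le_of_tendsto (CondenserMeasure.tendsto_iff.1 hl i) hcoord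
  · rw [SignedRadon.mutualEnergy_self_eq T hκ hpd hlR, EReal.coe_le_coe_iff]
    -- Weak lower semicontinuity of the norm: `2⟨v, w⟩ ≤ ‖v‖² + ‖w‖²`, with `w` the vector of the
    -- limit, passes to the limit along `U`.
    have hw : Tendsto (fun s => inner ℝ (T.signed (μ s).R) (T.signed l.R)) U
        (𝓝 (inner ℝ (T.signed l.R) (T.signed l.R))) := by
      have := (hwP (T.signed l.R)).sub (hwN (T.signed l.R))
      rw [← inner_sub_left] at this
      refine this.congr fun s => ?_
      rw [← inner_sub_left]
      rfl
    have hle : ∀ᶠ s in U, inner ℝ (T.signed (μ s).R) (T.signed l.R) ≤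
        (M + ‖T.signed l.R‖ ^ 2) / 2 := by
      filter_upwards [hμ, hM] with s h1 h2
      rw [SignedRadon.mutualEnergy_self_eq T hκ hpd h1.1, EReal.coe_le_coe_iff] at h2
      have h3 := norm_sub_sq_real (T.signed (μ s).R) (T.signed l.R)
      have h4 := sq_nonneg ‖T.signed (μ s).R - T.signed l.R‖
      linarith
    have := le_of_tendsto hw hle
    rw [real_inner_self_eq_norm_sq] at this
    linarith

end CondenserLimits

/-! ### Approximation by compact condensers -/

section InnerApproximation

open PosRadon

/-- The condenser obtained from `A` by shrinking its plates. -/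
def Condenser.shrink {ι : Type*} {P : Set ι} {X : Type*} [TopologicalSpace X]
    (A : Condenser P X) (B : ι → Set X) (hne : ∀ i, (B i).Nonempty) (hcl : ∀ i, IsClosed (B i))
    (hsub : ∀ i, B i ⊆ A.plate i) : Condenser P X where
  plate := B
  nonempty := hne
  isClosed := hcl
  finite_inter K hK := (A.finite_inter K hK).subset fun i hi =>
    hi.mono (inter_subset_inter_left K (hsub i))
  disjoint i hi j hj := (A.disjoint i hi j hj).mono (hsub i) (hsub j)

variable {ι : Type*} [Countable ι] {P : Set ι} {X : Type u} [TopologicalSpace X] [T2Space X]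
  [LocallyCompactSpace X] [MeasurableSpace X] [BorelSpace X] {κ : X → X → EReal}
  {A : Condenser P X}

theorem SignedRadon.mutualEnergy_self_eq_energy (hκ : IsKernel κ) (hpd : IsPositiveDefinite κ)
    {μ : SignedRadon X} (hμ : μ.FiniteEnergy κ) :
    μ.mutualEnergy κ μ = ((μ.pos.energy κ μ.pos + μ.neg.energy κ μ.neg -
      2 * μ.pos.energy κ μ.neg : ℝ) : EReal) := by
  obtain ⟨H, i1, i2, i3, ⟨T⟩⟩ := exists_energyEmbedding hκ hpd
  obtain ⟨hp, hn⟩ := (SignedRadon.finiteEnergy_iff hκ hpd).1 hμ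
  rw [mutualEnergy_self_eq T hκ hpd hμ, EnergyEmbedding.signed, norm_sub_sq_real, T.norm_sq_eq hp,
    T.norm_sq_eq hn, T.inner_eq _ hp _ hn, EReal.coe_eq_coe_iff]
  ring

/-- Every admissible measure can be approximated by an admissible measure with compact support. -/
theorem exists_compact_admissible_le (hκ : IsKernel κ) (hpd : IsPositiveDefinite κ) {a : ι → ℝ}
    (ha : ∀ i, 0 < a i) {g : ι → C(X, ℝ)} (hg : ∀ i x, 0 < g i x) {μ : CondenserMeasure A}
    (hμ : μ ∈ A.admissible κ a g) {m : ℝ} (hm : μ.R.mutualEnergy κ μ.R < (m : EReal)) :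
    ∃ K : Condenser P X, (∀ i, IsCompact (K.plate i)) ∧ K ≤ A ∧
      ∃ ν ∈ K.admissible κ a g, ν.R.mutualEnergy κ ν.R ≤ (m : EReal) := by
  by_cases hX : CompactSpace X
  · exact ⟨A, fun i => (A.isClosed i).isCompact, le_rfl, μ, hμ, hm.le⟩
  have h0 := hκ.nonneg hX
  obtain ⟨hp, hn⟩ := (SignedRadon.finiteEnergy_iff hκ hpd).1 hμ.1
  rw [SignedRadon.mutualEnergy_self_eq_energy hκ hpd hμ.1, EReal.coe_lt_coe_iff] at hm
  rw [CondenserMeasure.R_pos, CondenserMeasure.R_neg] at hm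
  rw [CondenserMeasure.R_pos] at hp
  rw [CondenserMeasure.R_neg] at hn
  have hnonneg : ∀ ρ : PosRadon X, ρ ∈ posFiniteEnergy κ → 0 ≤ ρ.energy κ ρ := fun ρ hρ => by
    have := two_mul_energy_le hκ hpd hρ (PosRadon.zero_mem hκ)
    rw [energy_eq (mutualEnergy_zero_right hκ ρ), energy_eq (mutualEnergy_zero_right hκ 0)] at this
    linarith
  set ep := (μ.sumOver P).energy κ (μ.sumOver P) with hep
  set en := (μ.sumOver Pᶜ).energy κ (μ.sumOver Pᶜ) with hen
  set f := (μ.sumOver P).energy κ (μ.sumOver Pᶜ) with hf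
  have hep0 : 0 ≤ ep := hnonneg _ hp
  have hen0 : 0 ≤ en := hnonneg _ hn
  set δ := m - (ep + en - 2 * f) with hδ
  have hδ0 : 0 < δ := sub_pos.2 hm
  -- Of the available slack `δ`, one half pays for rescaling, by the factor `1 + q = c ^ 2` on the
  -- energies of the two parts, and the other half for the loss in the mutual energy.
  set q := δ / 2 / (ep + en + 1) with hq
  have hq0 : 0 < q := by positivity
  set c : ℝ≥0 := NNReal.sqrt (1 + q.toNNReal) with hc
  have hcsq : (c : ℝ) * c = 1 + q := by
    rw [← NNReal.coe_mul, hc, NNReal.mul_self_sqrt, NNReal.coe_add, NNReal.coe_one,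
      Real.coe_toNNReal _ hq0.le]
  have hc1 : 1 < c := by
    have := NNReal.sqrt_lt_sqrt.2 (lt_add_of_pos_right (1 : ℝ≥0) (Real.toNNReal_pos.2 hq0))
    rwa [NNReal.sqrt_one] at this
  have hqle : q * (ep + en) ≤ δ / 2 := by
    rw [hq, div_mul_eq_mul_div, div_le_iff₀ (by positivity)]
    nlinarith
  obtain ⟨φ, hφκ, hφ⟩ : ∃ φ, IsMinorant κ φ ∧ f - δ / 4 < pairing φ (μ.sumOver P) (μ.sumOver Pᶜ) :=
    exists_minorant_lt (by
      rw [mutualEnergy_eq_energy hκ hpd hp hn]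
      exact EReal.coe_lt_coe_iff.2 (by linarith))
  obtain ⟨ψ, hψκ, hψ0, hψ⟩ : ∃ ψ, IsMinorant κ ψ ∧ (∀ p, 0 ≤ ψ p) ∧
      f - δ / 4 < pairing ψ (μ.sumOver P) (μ.sumOver Pᶜ) :=
    ⟨φ ⊔ 0, hφκ.sup fun p => by simpa using h0 p.1 p.2, fun p => le_sup_right,
      hφ.trans_le (pairing_mono (fun p => le_sup_left) _ _)⟩
  obtain ⟨L, hL, hψL⟩ := exists_compact_support ψ
  -- A single factor `c > 1` controls the rescaling of all coordinates, possibly infinitely many.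
  have hthr : ∀ i, ENNReal.ofReal (a i) / c < ∫⁻ x, ENNReal.ofReal (g i x) ∂(μ.coord i).1 := by
    intro i
    rw [hμ.2 i]
    refine ENNReal.div_lt_of_lt_mul ?_
    rw [← ENNReal.ofReal_coe_nnreal, ← ENNReal.ofReal_mul (ha i).le]
    exact (ENNReal.ofReal_lt_ofReal_iff (mul_pos (ha i) (zero_lt_one.trans hc1))).2
      (lt_mul_of_one_lt_right (ha i) hc1)
  choose C hC hCi using fun i => (μ.coord i).exists_compact_lt_lintegral (g i) (hg i)
    (by rw [hμ.2 i]; exact ENNReal.ofReal_ne_top) (hthr i)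
  choose p hpA using A.nonempty
  -- `L` carries almost all of the mutual energy, `C i` almost all of the integral of `g i`, and `p
  -- i` keeps the truncated plate nonempty.
  set Q : ι → Set X := fun i => L ∪ C i ∪ {p i} with hQdef
  have hQ : ∀ i, IsCompact (Q i) := fun i => (hL.union (hC i)).union isCompact_singleton
  have hLQ : ∀ i, L ⊆ Q i := fun i => subset_union_left.trans subset_union_left
  have hCQ : ∀ i, C i ⊆ Q i := fun i => subset_union_right.trans subset_union_left
  set b : ι → ℝ≥0∞ := fun i => ∫⁻ x in Q i, ENNReal.ofReal (g i x) ∂(μ.coord i).1 with hb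
  have hb1 : ∀ i, ENNReal.ofReal (a i) / c < b i := fun i =>
    (hCi i).trans_le (lintegral_mono_set (hCQ i))
  have hb2 : ∀ i, b i ≤ ENNReal.ofReal (a i) := fun i => by
    rw [← hμ.2 i]
    exact setLIntegral_le_lintegral _ _
  have hb0 : ∀ i, b i ≠ 0 := fun i => (bot_le.trans_lt (hb1 i)).ne'
  have hbtop : ∀ i, b i ≠ ⊤ := fun i => ne_top_of_le_ne_top ENNReal.ofReal_ne_top (hb2 i)
  -- `d i` restores the constraint after truncation. From `1 ≤ d i ≤ c`, the measure `ν` dominates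
  -- `μ` on `L`, and its two parts are dominated by `c` times those of `μ`.
  set d : ι → ℝ≥0 := fun i => (ENNReal.ofReal (a i) / b i).toNNReal with hd
  have hdcoe : ∀ i, (d i : ℝ≥0∞) = ENNReal.ofReal (a i) / b i := fun i =>
    ENNReal.coe_toNNReal (ENNReal.div_ne_top ENNReal.ofReal_ne_top (hb0 i))
  have hd1 : ∀ i, 1 ≤ (d i : ℝ≥0∞) := fun i => by
    rw [hdcoe, ENNReal.le_div_iff_mul_le (Or.inl (hb0 i)) (Or.inl (hbtop i)), one_mul]
    exact hb2 i
  have hcne : (c : ℝ≥0∞) ≠ 0 := ENNReal.coe_ne_zero.2 (zero_lt_one.trans hc1).ne'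
  have hdc : ∀ i, (d i : ℝ≥0∞) ≤ c := fun i => by
    rw [hdcoe]
    refine ENNReal.div_le_of_le_mul ?_
    have := (hb1 i).le
    rwa [ENNReal.div_le_iff_le_mul (Or.inl hcne) (Or.inl ENNReal.coe_ne_top), mul_comm] at this
  let K : Condenser P X := A.shrink (fun i => A.plate i ∩ Q i)
    (fun i => ⟨p i, hpA i, Or.inr rfl⟩) (fun i => (A.isClosed i).inter (hQ i).isClosed)
    (fun i => inter_subset_left)
  let ν : CondenserMeasure K :=
    { coord := fun i => d i • (μ.coord i).restrict (Q i) (hQ i)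
      supported := fun i => by
        change (d i • (μ.coord i).1.restrict (Q i)) (A.plate i ∩ Q i)ᶜ = 0
        rw [Measure.smul_apply, Measure.restrict_apply
          ((A.isClosed i).inter (hQ i).isClosed).measurableSet.compl,
          measure_mono_null _ (μ.supported i), smul_zero]
        exact fun x hx hxA => hx.1 ⟨hxA, hx.2⟩ }
  have hν : ∀ i E, MeasurableSet E → (ν.coord i).1 E = d i * (μ.coord i).1 (E ∩ Q i) :=
    fun i E hE => by
      change (d i • (μ.coord i).1.restrict (Q i)) E = _
      rw [Measure.smul_apply, Measure.restrict_apply hE]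
      rfl
  have hle : ∀ S : Set ι, (ν.sumOver S).1 ≤ (c • μ.sumOver S).1 := fun S =>
    Measure.le_iff.2 fun E hE => by
      change _ ≤ (c • (μ.sumOver S).1) E
      rw [Measure.smul_apply, CondenserMeasure.sumOver_apply _ _ hE,
        CondenserMeasure.sumOver_apply _ _ hE, ENNReal.smul_def, smul_eq_mul,
        ← ENNReal.tsum_mul_left]
      refine ENNReal.tsum_le_tsum fun i => ?_
      rw [hν i E hE]
      exact mul_le_mul' (hdc i) (measure_mono inter_subset_left)
  have hge : ∀ S : Set ι, ((μ.sumOver S).restrict L hL).1 ≤ (ν.sumOver S).1 := fun S =>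
    Measure.le_iff.2 fun E hE => by
      change (μ.sumOver S).1.restrict L E ≤ _
      rw [Measure.restrict_apply hE, CondenserMeasure.sumOver_apply _ _ (hE.inter hL.measurableSet),
        CondenserMeasure.sumOver_apply _ _ hE]
      refine ENNReal.tsum_le_tsum fun i => ?_
      rw [hν i E hE]
      exact (measure_mono (inter_subset_inter_right E (hLQ i))).trans
        (le_mul_of_one_le_left bot_le (hd1 i))
  have hen' : ∀ S : Set ι, μ.sumOver S ∈ posFiniteEnergy κ → ν.sumOver S ∈ posFiniteEnergy κ ∧
      (ν.sumOver S).energy κ (ν.sumOver S) ≤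
        (1 + q) * (μ.sumOver S).energy κ (μ.sumOver S) := fun S hS => by
    have hcS := smul_mem hκ hpd c hS
    have h1 := mutualEnergy_mono h0 (hle S) (hle S)
    rw [coe_energy_self hκ hcS] at h1
    have h2 : ν.sumOver S ∈ posFiniteEnergy κ := (mem_posFiniteEnergy_iff hκ).2
      (ne_top_of_le_ne_top (EReal.coe_ne_top _) h1)
    refine ⟨h2, ?_⟩
    rw [coe_energy_self hκ h2, EReal.coe_le_coe_iff, energy_smul_left hκ hpd c hS hcS,
      energy_comm hpd _ (c • _), energy_smul_left hκ hpd c hS hS, ← mul_assoc, hcsq] at h1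
    exact h1
  obtain ⟨hνp, hνpe⟩ := hen' P hp
  obtain ⟨hνn, hνne⟩ := hen' Pᶜ hn
  have hνR : ν.R.FiniteEnergy κ := (SignedRadon.finiteEnergy_iff hκ hpd).2 ⟨hνp, hνn⟩
  refine ⟨K, fun i => (hQ i).inter_left (A.isClosed i), fun i => inter_subset_left, ν,
    ⟨hνR, fun i => ?_⟩, ?_⟩
  · change ∫⁻ x, ENNReal.ofReal (g i x) ∂(d i • (μ.coord i).1.restrict (Q i)) = _
    rw [lintegral_smul_measure, ENNReal.smul_def, smul_eq_mul, hdcoe]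
    exact ENNReal.div_mul_cancel (hb0 i) (hbtop i)
  · rw [SignedRadon.mutualEnergy_self_eq_energy hκ hpd hνR, EReal.coe_le_coe_iff]
    rw [CondenserMeasure.R_pos, CondenserMeasure.R_neg]
    -- The mutual energy enters with a negative sign, so a lower bound is needed; the minorant
    -- supported in `L × L` gives `f - δ / 4`. The total is at most `(1 + q) * (ep + en) - 2 * (f -
    -- δ / 4) ≤ m`.
    have h1 := mutualEnergy_le_iff.1 (mutualEnergy_eq_energy hκ hpd hνp hνn).le ψ hψκ
    have h2 := pairing_mono_measure hψ0 (hge P) (hge Pᶜ)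
    rw [pairing_restrict hL hψL] at h2
    nlinarith

end InnerApproximation

/-! ### Minimizers and the directed family of compact condensers -/

section Minimizers

open PosRadon

variable {ι : Type*} [Countable ι] {P : Set ι} {X : Type u} [TopologicalSpace X] [T2Space X]
  [LocallyCompactSpace X] [MeasurableSpace X] [BorelSpace X] {κ : X → X → EReal}
  {A : Condenser P X} {a : ι → ℝ} {g : ι → C(X, ℝ)}

theorem Condenser.infEnergy_le {μ : CondenserMeasure A} (hμ : μ ∈ A.admissible κ a g) :
    A.infEnergy κ a g ≤ μ.R.mutualEnergy κ μ.R :=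
  iInf₂_le (f := fun (μ : CondenserMeasure A) (_ : μ ∈ A.admissible κ a g) =>
    μ.R.mutualEnergy κ μ.R) μ hμ

theorem Condenser.capacity_pos_iff :
    0 < A.capacity κ a g ↔ (A.admissible κ a g).Nonempty := by
  rw [capacity, ENNReal.inv_pos, ne_eq, EReal.toENNReal_eq_top_iff]
  constructor
  · intro h
    by_contra hne
    refine h ?_
    rw [infEnergy, not_nonempty_iff_eq_empty.1 hne]
    simp
  · rintro ⟨μ, hμ⟩ h
    exact (h ▸ (infEnergy_le hμ).trans_lt hμ.1.2.2).false

theorem Condenser.exists_infEnergy_eq (hpd : IsPositiveDefinite κ)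
    (hne : (A.admissible κ a g).Nonempty) : ∃ m : ℝ, A.infEnergy κ a g = (m : EReal) := by
  obtain ⟨μ, hμ⟩ := hne
  have h0 : 0 ≤ A.infEnergy κ a g := le_iInf₂ fun ν hν => hpd.2 _ hν.1.1
  exact ⟨_, (EReal.coe_toReal ((infEnergy_le hμ).trans_lt hμ.1.2.2).ne
    (ne_bot_of_le_ne_bot EReal.zero_ne_bot h0)).symm⟩

theorem CondenserMeasure.ofLE_mem_admissible {K : Condenser P X} (h : K ≤ A)
    {μ : CondenserMeasure K} (hμ : μ ∈ K.admissible κ a g) : μ.ofLE h ∈ A.admissible κ a g := hμ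

theorem Condenser.infEnergy_anti {K : Condenser P X} (h : K ≤ A) :
    A.infEnergy κ a g ≤ K.infEnergy κ a g := by
  refine le_iInf₂ fun μ hμ => ?_
  have h1 := infEnergy_le (CondenserMeasure.ofLE_mem_admissible h hμ)
  exact h1

/-- Half the sum of two measures associated with a condenser. -/
def CondenserMeasure.halfAdd (μ ν : CondenserMeasure A) : CondenserMeasure A where
  coord i := (2⁻¹ : ℝ≥0) • (μ.coord i + ν.coord i)
  supported i := by
    change ((2⁻¹ : ℝ≥0) • ((μ.coord i).1 + (ν.coord i).1)) _ = 0
    rw [Measure.smul_apply, Measure.add_apply, μ.supported, ν.supported, add_zero, smul_zero]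

theorem CondenserMeasure.sumOver_halfAdd (μ ν : CondenserMeasure A) (S : Set ι) :
    (μ.halfAdd ν).sumOver S = (2⁻¹ : ℝ≥0) • (μ.sumOver S + ν.sumOver S) :=
  PosRadon.ext <| Measure.ext fun E hE => by
    change _ = ((2⁻¹ : ℝ≥0) • ((μ.sumOver S).1 + (ν.sumOver S).1)) E
    rw [Measure.smul_apply, Measure.add_apply, sumOver_apply _ _ hE, sumOver_apply _ _ hE,
      sumOver_apply _ _ hE, ENNReal.smul_def, smul_eq_mul, ← ENNReal.tsum_add,
      ← ENNReal.tsum_mul_left]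
    rfl

theorem EnergyEmbedding.signed_halfAdd {H : Type*} [NormedAddCommGroup H]
    [InnerProductSpace ℝ H] (T : EnergyEmbedding κ H) (hκ : IsKernel κ)
    (hpd : IsPositiveDefinite κ) {μ ν : CondenserMeasure A} (hμ : μ.R.FiniteEnergy κ)
    (hν : ν.R.FiniteEnergy κ) : (μ.halfAdd ν).R.FiniteEnergy κ ∧
      T.signed (μ.halfAdd ν).R = (2⁻¹ : ℝ) • (T.signed μ.R + T.signed ν.R) := by
  obtain ⟨hμp, hμn⟩ := (SignedRadon.finiteEnergy_iff hκ hpd).1 hμ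
  obtain ⟨hνp, hνn⟩ := (SignedRadon.finiteEnergy_iff hκ hpd).1 hν
  have hp : (μ.halfAdd ν).R.pos = (2⁻¹ : ℝ≥0) • (μ.R.pos + ν.R.pos) := μ.sumOver_halfAdd ν P
  have hn : (μ.halfAdd ν).R.neg = (2⁻¹ : ℝ≥0) • (μ.R.neg + ν.R.neg) := μ.sumOver_halfAdd ν Pᶜ
  have h1 := add_mem hκ hpd hμp hνp
  have h2 := add_mem hκ hpd hμn hνn
  rw [SignedRadon.finiteEnergy_iff hκ hpd, EnergyEmbedding.signed, hp, hn,
    T.map_smul hκ hpd _ h1, T.map_smul hκ hpd _ h2, T.map_add hκ hpd hμp hνp,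
    T.map_add hκ hpd hμn hνn, ← smul_sub, EnergyEmbedding.signed, EnergyEmbedding.signed,
    add_sub_add_comm]
  exact ⟨⟨smul_mem hκ hpd _ h1, smul_mem hκ hpd _ h2⟩, by norm_num⟩

theorem CondenserMeasure.halfAdd_mem_admissible (hκ : IsKernel κ) (hpd : IsPositiveDefinite κ)
    {μ ν : CondenserMeasure A} (hμ : μ ∈ A.admissible κ a g) (hν : ν ∈ A.admissible κ a g) :
    μ.halfAdd ν ∈ A.admissible κ a g := by
  obtain ⟨H, i1, i2, i3, ⟨T⟩⟩ := exists_energyEmbedding hκ hpd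
  refine ⟨(T.signed_halfAdd hκ hpd hμ.1 hν.1).1, fun i => ?_⟩
  change ∫⁻ x, ENNReal.ofReal (g i x) ∂((2⁻¹ : ℝ≥0) • ((μ.coord i).1 + (ν.coord i).1)) = _
  rw [lintegral_smul_measure, lintegral_add_measure, hμ.2 i, hν.2 i, ENNReal.smul_def,
    smul_eq_mul, ENNReal.coe_inv two_ne_zero, ENNReal.coe_ofNat, mul_add, ← add_mul,
    ENNReal.inv_two_add_inv_two, one_mul]

/-- The parallelogram inequality for admissible measures. -/
theorem EnergyEmbedding.norm_sub_sq_le {H : Type*} [NormedAddCommGroup H]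
    [InnerProductSpace ℝ H] (T : EnergyEmbedding κ H) (hκ : IsKernel κ)
    (hpd : IsPositiveDefinite κ) {m : ℝ} (hm : (m : EReal) ≤ A.infEnergy κ a g)
    {μ ν : CondenserMeasure A} (hμ : μ ∈ A.admissible κ a g) (hν : ν ∈ A.admissible κ a g) :
    ‖T.signed μ.R - T.signed ν.R‖ ^ 2 ≤
      2 * ‖T.signed μ.R‖ ^ 2 + 2 * ‖T.signed ν.R‖ ^ 2 - 4 * m := by
  -- The midpoint is admissible, so its energy is at least `m`.
  have h := CondenserMeasure.halfAdd_mem_admissible hκ hpd hμ hν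
  have h1 := hm.trans (Condenser.infEnergy_le h)
  rw [SignedRadon.mutualEnergy_self_eq T hκ hpd h.1, EReal.coe_le_coe_iff,
    (T.signed_halfAdd hκ hpd hμ.1 hν.1).2, norm_smul, mul_pow, norm_inv, Real.norm_ofNat] at h1
  have h2 := parallelogram_law_with_norm ℝ (T.signed μ.R) (T.signed ν.R)
  nlinarith

/-- Limits of minimizing families are minimizers. -/
theorem Condenser.Admits.mem_minimizers_of_tendsto (hκ : IsKernel κ) (hpd : IsPositiveDefinite κ)
    (hcons : IsConsistent κ) (ha : ∀ i, 0 < a i) (hg : ∀ i x, 0 < g i x)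
    (hA : A.Admits κ a g) {m : ℝ} (hm : A.infEnergy κ a g = (m : EReal)) {α : Type*}
    (U : Ultrafilter α) {μ : α → CondenserMeasure A} {l : CondenserMeasure A}
    (hl : Tendsto μ U (𝓝 l)) (hμ : ∀ᶠ s in U, μ s ∈ A.admissible κ a g)
    (hμm : ∀ ε : ℝ, 0 < ε → ∀ᶠ s in U, (μ s).R.mutualEnergy κ (μ s).R ≤ ((m + ε : ℝ) : EReal)) :
    l ∈ A.minimizers κ a g := by
  have key := fun ε hε => admissible_of_tendsto hκ hpd hcons ha hg hA U hl hμ (hμm ε hε)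
  have hadm := (key 1 one_pos).1
  refine ⟨hadm, le_antisymm ?_ (Condenser.infEnergy_le hadm)⟩
  rw [hm]
  obtain ⟨H, i1, i2, i3, ⟨T⟩⟩ := exists_energyEmbedding hκ hpd
  rw [SignedRadon.mutualEnergy_self_eq T hκ hpd hadm.1, EReal.coe_le_coe_iff]
  refine le_of_forall_pos_le_add fun ε hε => ?_
  have := (key ε hε).2
  rwa [SignedRadon.mutualEnergy_self_eq T hκ hpd hadm.1, EReal.coe_le_coe_iff] at this

theorem Condenser.exists_admissible_lt {m : ℝ} (hm : A.infEnergy κ a g = (m : EReal)) {ε : ℝ}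
    (hε : 0 < ε) : ∃ μ ∈ A.admissible κ a g, μ.R.mutualEnergy κ μ.R < ((m + ε : ℝ) : EReal) := by
  have h : A.infEnergy κ a g < ((m + ε : ℝ) : EReal) := by
    rw [hm]
    exact EReal.coe_lt_coe_iff.2 (lt_add_of_pos_right m hε)
  obtain ⟨μ, h⟩ := iInf_lt_iff.1 h
  obtain ⟨hμ, h⟩ := iInf_lt_iff.1 h
  exact ⟨μ, hμ, h⟩

/-- A minimizing sequence has a vague limit along a free ultrafilter because the constraints bound
it vaguely; stability of the admissible class makes the limit a minimizer. -/
theorem Condenser.Admits.minimizers_nonempty (hκ : IsKernel κ) (hpd : IsPositiveDefinite κ)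
    (hcons : IsConsistent κ) (ha : ∀ i, 0 < a i) (hg : ∀ i x, 0 < g i x)
    (hA : A.Admits κ a g) (hne : (A.admissible κ a g).Nonempty) :
    (A.minimizers κ a g).Nonempty := by
  obtain ⟨m, hm⟩ := Condenser.exists_infEnergy_eq hpd hne
  choose μ hμ hμm using fun n : ℕ => Condenser.exists_admissible_lt hm (Nat.one_div_pos_of_nat
    (α := ℝ) (n := n))
  obtain ⟨l, hl⟩ := CondenserMeasure.exists_tendsto_ultrafilter (hyperfilter ℕ) (a := a) hg
    (fun i => .of_forall fun n => ((hμ n).2 i).le)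
  refine ⟨l, hA.mem_minimizers_of_tendsto hκ hpd hcons ha hg hm _ hl (.of_forall hμ)
    fun ε hε => ?_⟩
  refine Nat.hyperfilter_le_atTop ?_
  filter_upwards [tendsto_one_div_add_atTop_nhds_zero_nat.eventually (gt_mem_nhds hε)] with n hn
  exact (hμm n).le.trans (EReal.coe_le_coe_iff.2 (by linarith))

/-- Plates are joined by unions; a measure admissible for one condenser remains admissible for the
larger one, so the capacity stays positive. -/
instance : IsDirectedOrder (A.CompactFamily κ a g) where
  directed K L := by
    let M : Condenser P X := A.shrink (fun i => K.1.plate i ∪ L.1.plate i)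
      (fun i => (K.1.nonempty i).inl) (fun i => (K.1.isClosed i).union (L.1.isClosed i))
      (fun i => union_subset (K.2.2.1 i) (L.2.2.1 i))
    have hK : K.1 ≤ M := fun i => subset_union_left
    have hL : L.1 ≤ M := fun i => subset_union_right
    obtain ⟨μ, hμ⟩ := Condenser.capacity_pos_iff.1 K.2.2.2
    exact ⟨⟨M, fun i => (K.2.1 i).union (L.2.1 i), fun i => union_subset (K.2.2.1 i) (L.2.2.1 i),
      Condenser.capacity_pos_iff.2 ⟨_, CondenserMeasure.ofLE_mem_admissible hK hμ⟩⟩, hK, hL⟩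

/-- The infima over the compact condensers `K ≤ A` approach that over `A`. -/
theorem Condenser.eventually_infEnergy_le (hκ : IsKernel κ) (hpd : IsPositiveDefinite κ)
    (ha : ∀ i, 0 < a i) (hg : ∀ i x, 0 < g i x) {m : ℝ}
    (hm : A.infEnergy κ a g = (m : EReal)) {ε : ℝ} (hε : 0 < ε) :
    Nonempty (A.CompactFamily κ a g) ∧ ∀ᶠ K : A.CompactFamily κ a g in atTop,
      K.1.infEnergy κ a g ≤ ((m + ε : ℝ) : EReal) := by
  obtain ⟨μ, hμ, hμm⟩ := exists_admissible_lt hm hε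
  obtain ⟨K, hK, hKA, ν, hν, hνm⟩ := exists_compact_admissible_le hκ hpd ha hg hμ hμm
  let K₀ : A.CompactFamily κ a g := ⟨K, hK, hKA, capacity_pos_iff.2 ⟨ν, hν⟩⟩
  refine ⟨⟨K₀⟩, (eventually_ge_atTop K₀).mono fun L hL => ?_⟩
  exact (infEnergy_anti (κ := κ) (a := a) (g := g) hL).trans ((infEnergy_le hν).trans hνm)

end Minimizers

end

/-! ### Convergence of the minimizers -/

theorem mainTheorem2 {X : Type*} [TopologicalSpace X] [T2Space X] [LocallyCompactSpace X]
    [MeasurableSpace X] [BorelSpace X] {ι : Type*} [Countable ι] {P : Set ι}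
    (κ : X → X → EReal) (hκ : IsKernel κ) (hpd : IsPositiveDefinite κ) (hcons : IsConsistent κ)
    (A : Condenser P X) (a : ι → ℝ) (ha : ∀ i, 0 < a i)
    (g : ι → C(X, ℝ)) (hg : ∀ i x, 0 < g i x)
    (hcap : 0 < A.capacity κ a g)
    (hstanding : Pᶜ = ∅ ∨
      ((∑' i, ENNReal.ofReal (a i) / (⨅ x ∈ A.plate i, ENNReal.ofReal (g i x))) < ⊤ ∧
        (⨆ x ∈ A.posUnion, ⨆ y ∈ A.negUnion, κ x y) < ⊤))
    (hgrowth : ∀ i, BddAbove (g i '' A.plate i) ∨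
      ∃ r : ℝ, 1 < r ∧ ∃ ω : SignedRadon X, ω.FiniteEnergy κ ∧
        NearlyEverywhere κ (A.plate i) fun x => ((g i x ^ r : ℝ) : EReal) ≤ ω.potential κ x)
    (hplates : ∀ i, IsCompact (A.plate i) ∨ interiorCapacity κ (A.plate i) < ⊤) :
    (∀ K : A.CompactFamily κ a g, (K.1.minimizers κ a g).Nonempty) ∧
    ∀ lam : (K : A.CompactFamily κ a g) → CondenserMeasure K.1,
      (∀ K, lam K ∈ K.1.minimizers κ a g) →
      (∃ μ : CondenserMeasure A,
        MapClusterPt μ atTop fun K : A.CompactFamily κ a g => (lam K).ofLE K.2.2.1) ∧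
      (∀ μ : CondenserMeasure A,
        MapClusterPt μ atTop (fun K : A.CompactFamily κ a g => (lam K).ofLE K.2.2.1) →
          μ ∈ A.minimizers κ a g) ∧
      ∀ lamA ∈ A.minimizers κ a g,
        Tendsto (fun K : A.CompactFamily κ a g => SignedRadon.distSq κ (lam K).R lamA.R)
          atTop (𝓝 0) := by
  have hA : A.Admits κ a g := ⟨hstanding, hgrowth, hplates⟩
  have hK : ∀ K : A.CompactFamily κ a g, (K.1.minimizers κ a g).Nonempty := fun K =>
    (hA.of_le K.2.2.1 K.2.1).minimizers_nonempty hκ hpd hcons ha hg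
      (Condenser.capacity_pos_iff.1 K.2.2.2)
  refine ⟨hK, fun lam hlam => ?_⟩
  obtain ⟨m, hm⟩ := Condenser.exists_infEnergy_eq hpd (Condenser.capacity_pos_iff.1 hcap)
  have hne : Nonempty (A.CompactFamily κ a g) :=
    (Condenser.eventually_infEnergy_le hκ hpd ha hg hm one_pos).1
  have hadm : ∀ K, (lam K).ofLE K.2.2.1 ∈ A.admissible κ a g := fun K =>
    CondenserMeasure.ofLE_mem_admissible K.2.2.1 (hlam K).1
  have hlim : ∀ ε : ℝ, 0 < ε → ∀ᶠ K in atTop,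
      (lam K).R.mutualEnergy κ (lam K).R ≤ ((m + ε : ℝ) : EReal) := fun ε hε =>
    (Condenser.eventually_infEnergy_le hκ hpd ha hg hm hε).2.mono fun K h => by
      rw [(hlam K).2]
      exact h
  -- Each cluster point is a limit along some ultrafilter finer than `atTop`, along which the
  -- energies tend to the infimum `m`.
  have hmin : ∀ U : Ultrafilter (A.CompactFamily κ a g), (U : Filter _) ≤ atTop →
      ∀ μ : CondenserMeasure A, Tendsto (fun K => (lam K).ofLE K.2.2.1) U (𝓝 μ) →
      μ ∈ A.minimizers κ a g := fun U hU μ h =>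
    hA.mem_minimizers_of_tendsto hκ hpd hcons ha hg hm U h (.of_forall hadm)
      fun ε hε => hU (hlim ε hε)
  refine ⟨?_, fun μ hμ => ?_, fun lamA hlamA => ?_⟩
  · obtain ⟨μ, hμ⟩ := CondenserMeasure.exists_tendsto_ultrafilter
      (Ultrafilter.of (atTop : Filter (A.CompactFamily κ a g))) (a := a) hg
      (fun i => .of_forall fun K => ((hadm K).2 i).le)
    exact ⟨μ, mapClusterPt_iff_ultrafilter.2 ⟨_, Ultrafilter.of_le _, hμ⟩⟩
  · obtain ⟨U, hU, h⟩ := mapClusterPt_iff_ultrafilter.1 hμ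
    exact hmin U hU μ h
  · obtain ⟨H, i1, i2, i3, ⟨T⟩⟩ := exists_energyEmbedding hκ hpd
    have hlamA2 := hlamA.2
    rw [SignedRadon.mutualEnergy_self_eq T hκ hpd hlamA.1.1, hm, EReal.coe_eq_coe_iff] at hlamA2
    have hdist : ∀ K, SignedRadon.distSq κ (lam K).R lamA.R =
        ((‖T.signed (lam K).R - T.signed lamA.R‖ ^ 2 : ℝ) : EReal) := fun K =>
      SignedRadon.distSq_eq T hκ hpd (hadm K).1 hlamA.1.1
    simp only [hdist]
    rw [← EReal.coe_zero, EReal.tendsto_coe, Metric.tendsto_nhds]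
    intro ε hε
    -- With energies at most `m + ε / 4` and exactly `m`, the parallelogram inequality bounds the
    -- squared distance by `ε / 2`.
    filter_upwards [hlim (ε / 4) (by positivity)] with K hKε
    have h1 := T.norm_sub_sq_le hκ hpd hm.ge (hadm K) hlamA.1
    rw [SignedRadon.mutualEnergy_self_eq T hκ hpd (hlam K).1.1, EReal.coe_le_coe_iff] at hKε
    rw [Real.dist_eq, sub_zero, abs_of_nonneg (sq_nonneg _)]
    change ‖T.signed (lam K).R - T.signed lamA.R‖ ^ 2 ≤
      2 * ‖T.signed (lam K).R‖ ^ 2 + 2 * ‖T.signed lamA.R‖ ^ 2 - 4 * m at h1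
    linarith
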